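/- Let $P_n$ denote a convex $n$-gon. A polytope $P\subset\mathbb{R}^{2r}$ is a *realization* of the product $(P_n)^r$ if its face lattice is isomorphic to that of $(P_n)^r$. Under a fixed isomorphism, its *polygon $2$-faces* are those corresponding to products of $P_n$ in one factor with a vertex of $P_n$ in each of the other factors. Let $\pi:\mathbb{R}^{2r}\to\mathbb{R}^4$ be the projection to the last four coordinates. A face $G$ of $P$ *survives* the projection if $\pi(G)$ is a face of $\pi(P)$, $\pi$ is injective on $G$, and $\pi^{-1}(\pi(G))\cap P=G$. For every $r\ge 2$ and every even $n\ge 4$ there is a realization $P^r_n\subset\mathbb{R}^{2r}$ of $(P_n)^r$ all of whose polygon $2$-faces survive the projection $\pi$ (for some choice of the isomorphism). It can be chosen as a deformed product, that is, as the solution set of a system of $rn$ linear inequalities whose matrix is lower block triangular with blocks of size $n\times 2$, all diagonal blocks being equal to one matrix $V$ for which $Vy\le\beta$ describes an $n$-gon for some positive vector $\beta\in\mathbb{R}^n$. For every $r\ge2$, every even $n\ge4$ and every realization $P^r_n\subset\mathbb{R}^{2r}$ of $(P_n)^r$ all of whose polygon $2$-faces survive the projection $\pi$, the image $\pi(P^r_n)\subset\mathbb{R}^4$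 is a $4$-polytope with $f$-vector $$(f_0,f_1,f_2,f_3)=\Bigl(n^r,\; rn^r,\; \tfrac54 rn^r-\tfrac32 n^r+rn^{r-1},\; \tfrac14 rn^r-\tfrac12 n^r+rn^{r-1}\Bigr).$$ Consequently its fatness $\dfrac{f_1+f_2-20}{f_0+f_3-10}$ tends to $9$ as $n,r\to\infty$: for every $\varepsilon>0$ there is $N$ such that for all $r\ge\max(N,2)$ and all even $n\ge\max(N,4)$ the fatness of every such $\pi(P^r_n)$ differs from $9$ by less than $\varepsilon$. -/

import Mathlib

/-- A (convex) polytope: the convex hull of a finite set of points. -/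
def IsPolytope {E : Type*} [AddCommGroup E] [Module ℝ E] (P : Set E) : Prop :=
  ∃ s : Set E, s.Finite ∧ convexHull ℝ s = P

/-- The dimension of a nonempty convex set: the dimension of its affine hull. -/
noncomputable def affDim {E : Type*} [AddCommGroup E] [Module ℝ E] (S : Set E) : ℕ :=
  Module.finrank ℝ (vectorSpan ℝ S)

/-- The face lattice of a polytope `P` (with the empty face and `P` itself), ordered by
inclusion. The faces of a polytope are its exposed faces. -/
abbrev FaceLattice {E : Type*} [AddCommGroup E] [Module ℝ E] [TopologicalSpace E]
    (P : Set E) : Type _ :=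
  {F : Set E // IsExposed ℝ P F}

/-- `fNumber P k` is the number `f_k(P)` of `k`-dimensional faces of `P`. -/
noncomputable def fNumber {E : Type*} [AddCommGroup E] [Module ℝ E] [TopologicalSpace E]
    (P : Set E) (k : ℕ) : ℕ :=
  {F : Set E | IsExposed ℝ P F ∧ F.Nonempty ∧ affDim F = k}.ncard

/-- A `4`-polytope in `ℝ⁴`. -/
def IsFourPolytope (P : Set (Fin 4 → ℝ)) : Prop :=
  IsPolytope P ∧ affDim P = 4

/-- The fatness `(f₁ + f₂ - 20) / (f₀ + f₃ - 10)` of a `4`-polytope. -/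
noncomputable def fatness (P : Set (Fin 4 → ℝ)) : ℝ :=
  ((fNumber P 1 : ℝ) + fNumber P 2 - 20) / ((fNumber P 0 : ℝ) + fNumber P 3 - 10)

/-- A convex `n`-gon in the plane: a `2`-dimensional polytope with `n` vertices. -/
def IsPolygon (n : ℕ) (Q : Set (Fin 2 → ℝ)) : Prop :=
  IsPolytope Q ∧ affDim Q = 2 ∧ fNumber Q 0 = n

/-- The orthogonal product `Q × ⋯ × Q` of `r` copies of a polygon `Q`. -/
def polygonPower (Q : Set (Fin 2 → ℝ)) (r : ℕ) : Set (Fin r → Fin 2 → ℝ) :=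
  {x | ∀ i, x i ∈ Q}

/-- `G` is one of the polygon `2`-faces of `Q × ⋯ × Q`: the product of the whole polygon `Q`
in one factor `j` with a vertex `v i` of `Q` in every other factor `i`. -/
def IsPolygonTwoFace (Q : Set (Fin 2 → ℝ)) (r : ℕ) (G : Set (Fin r → Fin 2 → ℝ)) : Prop :=
  ∃ (j : Fin r) (v : Fin r → Fin 2 → ℝ), (∀ i, v i ∈ Set.extremePoints ℝ Q) ∧
    G = {x | x j ∈ Q ∧ ∀ i, i ≠ j → x i = v i}

/-- The projection `π : ℝ²ʳ → ℝ⁴` to the last four coordinates. -/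
def lastFour (r : ℕ) (hr : 2 ≤ r) : (Fin (2 * r) → ℝ) →ₗ[ℝ] (Fin 4 → ℝ) :=
  LinearMap.funLeft ℝ ℝ fun j : Fin 4 => (⟨2 * r - 4 + j.1, by omega⟩ : Fin (2 * r))

/-- The face `G` of `P` survives the projection `p` (is strictly preserved by it): its image is a
face of `p(P)`, the projection is injective on `G` (so that `p(G)` is an isomorphic copy of `G`),
and no point of `P` outside `G` is mapped into `p(G)`. -/
def Survives {E F : Type*} [AddCommGroup E] [Module ℝ E]
    [AddCommGroup F] [Module ℝ F] [TopologicalSpace F]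
    (p : E →ₗ[ℝ] F) (P G : Set E) : Prop :=
  IsExposed ℝ (p '' P) (p '' G) ∧ Set.InjOn p G ∧ P ∩ p ⁻¹' (p '' G) = G

/-- `P ⊂ ℝ²ʳ` is a realization of a product of `r` `n`-gons (a polytope whose face lattice is
isomorphic to that of `Q × ⋯ × Q`, `Q` an `n`-gon) such that all its polygon `2`-faces survive
the projection to the last four coordinates. -/
def IsSurvivingPolygonProduct (r n : ℕ) (hr : 2 ≤ r) (P : Set (Fin (2 * r) → ℝ)) : Prop :=
  IsPolytope P ∧
    ∃ Q : Set (Fin 2 → ℝ), IsPolygon n Q ∧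
      ∃ Φ : FaceLattice (polygonPower Q r) ≃o FaceLattice P,
        ∀ G : FaceLattice (polygonPower Q r), IsPolygonTwoFace Q r G.1 →
          Survives (lastFour r hr) P (Φ G).1

/-- The `i`-th block `(x₂ᵢ, x₂ᵢ₊₁)` of two coordinates of `x ∈ ℝ²ʳ` (numbering from `0`). -/
def coordBlock {r : ℕ} (x : Fin (2 * r) → ℝ) (i : Fin r) : Fin 2 → ℝ :=
  fun c => x ⟨2 * i.1 + c.1, by omega⟩

/-- `P ⊂ ℝ²ʳ` is the solution set of a system of `r n` linear inequalities with a lower block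
triangular matrix of `r × r` blocks of size `n × 2`. All diagonal blocks are equal to one matrix
`V` such that `V y ≤ β` describes an `n`-gon for some positive `β`; the blocks `L i j` (`j < i`)
below the diagonal are arbitrary. -/
def IsDeformedProductSystem (r n : ℕ) (P : Set (Fin (2 * r) → ℝ)) : Prop :=
  ∃ (V : Matrix (Fin n) (Fin 2) ℝ) (L : Fin r → Fin r → Matrix (Fin n) (Fin 2) ℝ)
    (b : Fin r → Fin n → ℝ),
    (∃ β : Fin n → ℝ, (∀ k, 0 < β k) ∧ IsPolygon n {y | V.mulVec y ≤ β}) ∧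
    P = {x | ∀ i : Fin r,
      (∑ j ∈ Finset.univ.filter (fun j : Fin r => j < i), (L i j).mulVec (coordBlock x j)) +
        V.mulVec (coordBlock x i) ≤ b i}

/-! The theorem has two independent halves: counting the faces of any such projection, and
constructing one.

Counting. The vertices of the product are indexed by functions `x : Fin r → ν`, with `ν` the
vertices of the `n`-gon. A face of the projection lifts to a face of the product, so its vertex set
is a product of vertices, `b` edges and `a` whole polygons, with `n^a 2^b` elements. Since the
polygon `2`-faces survive, so do their edges and vertices; hence a face of type `(a, b)` has `2a +
b` edges and `a` polygons at each of its vertices. Euler's relation for the facet, and the fact that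
each of its edges lies in two of its `2`-faces, combine to `n^a 2^b (n (4 - 3a - b) + 4a) = 8n`. The
facets are therefore prisms over `n`-gons or cubes (`face_rank_four`); no genericity of the
projection is needed. Every polygon lies in two facets and every prism has two polygon bases, so the
prisms are as numerous as the polygons, namely `r n^(r-1)`. Double counting and Euler's relation in
dimension four give the other numbers (`card_facesOfRank_univ`), and the fatness estimate is
arithmetic.

Euler's relation is needed for all intervals `[G, H]` of the face lattice (`IsFaceIn.euler`). The
functionals vanishing on `G` form a vector space; each of them selects, by minimization, a face
properly containing `G`. This cuts the space into relatively open convex cells, one per face, and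
the alternating sum of their dimensions is invariant under cutting by hyperplanes (`sum_eulerSign`).

Construction. A face survives if the normals of the facets through it, restricted to the kernel of
the projection, positively span the dual of that kernel (`survives_tightFace`). For even `n` the
edges of the polygon alternate in parity, so every vertex lies on one even and one odd edge. The
blocks below the diagonal depend only on this parity, which leaves one matrix for each polygon
`2`-face, up to small entries and a sign. Its limit is given explicitly and positively spans
(`posSpan_limitMatrix`). Positive spanning is open, and it is invariant under scaling rows by
positive and columns by nonzero factors; scaling makes the lower blocks as small as desired
(`exists_smallBlocks`). Small lower blocks only perturb the right hand sides of a polygon, which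
does not alter the possible sets of tight inequalities, so the deformed product keeps the face
lattice of the product (`exists_iso_coordForm`). -/

namespace PolygonProducts
open Module Submodule
open scoped Classical

/-! ### Euler characteristic of relatively open convex cells -/

section RelOpen
variable {A : Type*} [AddCommGroup A] [Module ℝ A]

/-- A convex set that is open in its linear span. -/
structure RelOpen (C : Set A) : Prop where
  convex : Convex ℝ C
  exists_add_mem : ∀ x ∈ C, ∀ d ∈ span ℝ C, ∃ ε : ℝ, 0 < ε ∧ x + ε • d ∈ C

/-- The contribution of a cell to the Euler characteristic. -/
noncomputable def eulerSign (C : Set A) : ℤ :=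
  if C.Nonempty then (-1) ^ finrank ℝ (span ℝ C) else 0

theorem eulerSign_empty : eulerSign (∅ : Set A) = 0 := by simp [eulerSign]

theorem RelOpen.exists_forall_add_mem {C : Set A} (h : RelOpen C) {x d : A} (hx : x ∈ C)
    (hd : d ∈ span ℝ C) : ∃ ε : ℝ, 0 < ε ∧ ∀ δ, 0 ≤ δ → δ ≤ ε → x + δ • d ∈ C := by
  obtain ⟨ε, hε, hm⟩ := h.exists_add_mem x hx d hd
  refine ⟨ε, hε, fun δ h0 h1 => ?_⟩
  have := h.convex hx hm (a := 1 - δ / ε) (b := δ / ε)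
    (by rw [sub_nonneg, div_le_one hε]; exact h1) (by positivity) (by ring)
  convert this using 1
  rw [smul_add, ← add_assoc, ← add_smul, smul_smul, div_mul_cancel₀ _ hε.ne']
  simp

theorem RelOpen.inter_pos {C : Set A} (h : RelOpen C) (l : Dual ℝ A) :
    RelOpen (C ∩ {x | 0 < l x}) := by
  refine ⟨h.convex.inter (convex_halfSpace_gt l.isLinear 0), ?_⟩
  rintro x ⟨hx, hlx⟩ d hd
  obtain ⟨ε, hε, hm⟩ := h.exists_forall_add_mem hx (span_mono Set.inter_subset_left hd)
  simp only [Set.mem_ofPred_eq] at hlx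
  -- The second bound makes the change of `l` at most `l x / 2`; the `+ 1` keeps the denominator
  -- nonzero.
  refine ⟨min ε (l x / (2 * (|l d| + 1))), by positivity, hm _ (by positivity) (min_le_left _ _), ?_⟩
  simp only [Set.mem_ofPred_eq, map_add, map_smul, smul_eq_mul]
  set δ := min ε (l x / (2 * (|l d| + 1)))
  have h1 : δ ≤ l x / (2 * (|l d| + 1)) := min_le_right _ _
  have h0 : 0 < δ := by positivity
  rw [le_div_iff₀ (by positivity)] at h1
  have h2 : -(δ * |l d|) ≤ δ * l d := by
    have := neg_abs_le (l d); nlinarith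
  nlinarith

theorem RelOpen.inter_neg {C : Set A} (h : RelOpen C) (l : Dual ℝ A) :
    RelOpen (C ∩ {x | l x < 0}) := by
  have := h.inter_pos (-l)
  simpa using this

theorem RelOpen.inter_zero {C : Set A} (h : RelOpen C) (l : Dual ℝ A) :
    RelOpen (C ∩ {x | l x = 0}) := by
  refine ⟨h.convex.inter (convex_hyperplane l.isLinear 0), ?_⟩
  rintro x ⟨hx, hlx⟩ d hd
  obtain ⟨ε, hε, hm⟩ := h.exists_add_mem x hx d (span_mono Set.inter_subset_left hd)
  have hld : l d = 0 := by
    have : span ℝ (C ∩ {x | l x = 0}) ≤ LinearMap.ker l := span_le.2 fun y hy => hy.2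
    exact this hd
  refine ⟨ε, hε, hm, ?_⟩
  simp only [Set.mem_ofPred_eq] at hlx
  simp [hlx, hld]

/-- A direction `d ∈ S` is a multiple of the difference of the two points `x + ε • d` and `x`. This
yields the dimensions of the pieces of a cell cut by a hyperplane. -/
theorem span_eq_of_relOpen {C' : Set A} (hne : C'.Nonempty) (S : Submodule ℝ A)
    (hS : C' ⊆ S)
    (h : ∀ x ∈ C', ∀ d ∈ S, ∃ ε : ℝ, 0 < ε ∧ x + ε • d ∈ C') : span ℝ C' = S := by
  refine le_antisymm (span_le.2 hS) fun d hd => ?_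
  obtain ⟨x, hx⟩ := hne
  obtain ⟨ε, hε, hm⟩ := h x hx d hd
  have : d = ε⁻¹ • ((x + ε • d) - x) := by
    rw [add_sub_cancel_left, smul_smul, inv_mul_cancel₀ hε.ne', one_smul]
  rw [this]
  exact smul_mem _ _ (sub_mem (subset_span hm) (subset_span hx))

theorem RelOpen.span_inter_pos {C : Set A} (h : RelOpen C) (l : Dual ℝ A)
    (hne : (C ∩ {x | 0 < l x}).Nonempty) : span ℝ (C ∩ {x | 0 < l x}) = span ℝ C := by
  refine span_eq_of_relOpen hne _
    (fun x hx => subset_span hx.1) ?_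
  rintro x ⟨hx, hlx⟩ d hd
  obtain ⟨ε, hε, hm⟩ := h.exists_forall_add_mem hx hd
  simp only [Set.mem_ofPred_eq] at hlx
  refine ⟨min ε (l x / (2 * (|l d| + 1))), by positivity, hm _ (by positivity) (min_le_left _ _), ?_⟩
  simp only [Set.mem_ofPred_eq, map_add, map_smul, smul_eq_mul]
  set δ := min ε (l x / (2 * (|l d| + 1)))
  have h1 : δ ≤ l x / (2 * (|l d| + 1)) := min_le_right _ _
  have h0 : 0 < δ := by positivity
  rw [le_div_iff₀ (by positivity)] at h1
  have h2 : -(δ * |l d|) ≤ δ * l d := by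
    have := neg_abs_le (l d); nlinarith
  nlinarith

theorem RelOpen.span_inter_neg {C : Set A} (h : RelOpen C) (l : Dual ℝ A)
    (hne : (C ∩ {x | l x < 0}).Nonempty) : span ℝ (C ∩ {x | l x < 0}) = span ℝ C := by
  have := h.span_inter_pos (-l)
  simp only [LinearMap.neg_apply, Left.neg_pos_iff] at this
  exact this hne

theorem RelOpen.span_inter_zero {C : Set A} (h : RelOpen C) (l : Dual ℝ A)
    (hne : (C ∩ {x | l x = 0}).Nonempty) :
    span ℝ (C ∩ {x | l x = 0}) = span ℝ C ⊓ LinearMap.ker l := by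
  refine span_eq_of_relOpen hne _
    (fun x hx => ⟨subset_span hx.1, hx.2⟩) ?_
  rintro x ⟨hx, hlx⟩ d ⟨hd, hld⟩
  obtain ⟨ε, hε, hm⟩ := h.exists_add_mem x hx d hd
  refine ⟨ε, hε, hm, ?_⟩
  simp only [Set.mem_ofPred_eq] at hlx
  have : l d = 0 := hld
  simp [hlx, this]

theorem finrank_inf_ker_add_one [FiniteDimensional ℝ A] (S : Submodule ℝ A) (l : Dual ℝ A)
    {x : A} (hx : x ∈ S) (hlx : l x ≠ 0) :
    finrank ℝ (S ⊓ LinearMap.ker l : Submodule ℝ A) + 1 = finrank ℝ S := by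
  have h1 := LinearMap.finrank_range_add_finrank_ker (l.domRestrict S)
  have h2 : LinearMap.range (l.domRestrict S) = ⊤ := by
    rw [LinearMap.range_eq_top]
    apply LinearMap.surjective
    intro h0
    exact hlx (by simpa using LinearMap.congr_fun h0 ⟨x, hx⟩)
  rw [h2, finrank_top, finrank_self] at h1
  have h3 : (LinearMap.ker (l.domRestrict S)).map S.subtype = S ⊓ LinearMap.ker l := by
    ext y
    simp only [mem_map, LinearMap.mem_ker, LinearMap.domRestrict_apply, subtype_apply, mem_inf]
    constructor
    · rintro ⟨z, hz, rfl⟩; exact ⟨z.2, hz⟩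
    · rintro ⟨hy, h0⟩; exact ⟨⟨y, hy⟩, h0, rfl⟩
  rw [← h3, LinearEquiv.finrank_eq (Submodule.equivMapOfInjective _ S.injective_subtype _).symm]
  omega

/-- If the hyperplane cuts `C` properly, the two open halves keep the dimension `d` of `C` and the
slice has dimension `d - 1`, so that `(-1)^d = (-1)^d + (-1)^(d-1) + (-1)^d`. Otherwise at most one
of the pieces is nonempty, and it is `C` itself. -/
theorem RelOpen.eulerSign_split [FiniteDimensional ℝ A] {C : Set A} (h : RelOpen C)
    (l : Dual ℝ A) : eulerSign C = eulerSign (C ∩ {x | 0 < l x}) +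
      eulerSign (C ∩ {x | l x = 0}) + eulerSign (C ∩ {x | l x < 0}) := by
  by_cases hz : ∃ x ∈ C, l x = 0
  · obtain ⟨x, hx, hlx⟩ := hz
    by_cases hy : ∃ y ∈ C, l y ≠ 0
    · obtain ⟨y, hy, hly⟩ := hy
      -- From the zero `x` of `l` one can move a little in both directions `y` and `-y`, which
      -- reaches both sides.
      have key : ∀ d ∈ span ℝ C, 0 < l d → (C ∩ {x | 0 < l x}).Nonempty := by
        intro d hd hld
        obtain ⟨ε, hε, hm⟩ := h.exists_add_mem x hx d hd
        exact ⟨_, hm, by simp [hlx]; positivity⟩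
      have key' : ∀ d ∈ span ℝ C, l d < 0 → (C ∩ {x | l x < 0}).Nonempty := by
        intro d hd hld
        obtain ⟨ε, hε, hm⟩ := h.exists_add_mem x hx d hd
        exact ⟨_, hm, by simp [hlx]; exact mul_neg_of_pos_of_neg hε hld⟩
      have hys : y ∈ span ℝ C := subset_span hy
      have hnys : -y ∈ span ℝ C := neg_mem hys
      have hpos : (C ∩ {x | 0 < l x}).Nonempty := by
        rcases lt_or_gt_of_ne hly with h0 | h0
        · exact key _ hnys (by simpa using h0)
        · exact key _ hys h0
      have hneg : (C ∩ {x | l x < 0}).Nonempty := by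
        rcases lt_or_gt_of_ne hly with h0 | h0
        · exact key' _ hys h0
        · exact key' _ hnys (by simpa using h0)
      have hzero : (C ∩ {x | l x = 0}).Nonempty := ⟨x, hx, hlx⟩
      unfold eulerSign
      rw [if_pos hpos, if_pos hneg, if_pos hzero, if_pos ⟨x, hx⟩, h.span_inter_pos l hpos,
        h.span_inter_neg l hneg, h.span_inter_zero l hzero,
        ← finrank_inf_ker_add_one (span ℝ C) l hys hly]
      ring
    · push Not at hy
      have h1 : C ∩ {x | 0 < l x} = ∅ := by
        ext y; simp only [Set.mem_inter_iff, Set.mem_ofPred_eq, Set.mem_empty_iff_false, iff_false]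
        rintro ⟨h1, h2⟩; exact h2.ne' (hy y h1)
      have h2 : C ∩ {x | l x < 0} = ∅ := by
        ext y; simp only [Set.mem_inter_iff, Set.mem_ofPred_eq, Set.mem_empty_iff_false, iff_false]
        rintro ⟨h1, h2⟩; exact h2.ne (hy y h1)
      have h3 : C ∩ {x | l x = 0} = C := Set.inter_eq_left.2 hy
      rw [h1, h2, h3, eulerSign_empty]; ring
  · push Not at hz
    have h3 : C ∩ {x | l x = 0} = ∅ := by
      ext y; simp only [Set.mem_inter_iff, Set.mem_ofPred_eq, Set.mem_empty_iff_false, iff_false]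
      rintro ⟨h1, h2⟩; exact hz y h1 h2
    have key : ∀ y ∈ C, ∀ z ∈ C, 0 < l y → l z < 0 → False := by
      intro y hy z hz' hly hlz
      refine hz _ (h.convex hy hz' (a := -l z / (l y - l z)) (b := l y / (l y - l z))
        (div_nonneg (by linarith) (by linarith)) (div_nonneg (by linarith) (by linarith))
        (by rw [← add_div, div_eq_one_iff_eq (by linarith)]; ring)) ?_
      simp only [map_add, map_smul, smul_eq_mul]
      ring
    rcases C.eq_empty_or_nonempty with rfl | ⟨y, hy⟩
    · simp [eulerSign_empty]
    rcases lt_or_gt_of_ne (hz y hy) with h0 | h0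
    · have h1 : C ∩ {x | 0 < l x} = ∅ := by
        ext z; simp only [Set.mem_inter_iff, Set.mem_ofPred_eq, Set.mem_empty_iff_false, iff_false]
        rintro ⟨h1, h2⟩; exact key z h1 y hy h2 h0
      have h2 : C ∩ {x | l x < 0} = C := Set.inter_eq_left.2 fun z hz' =>
        (lt_or_gt_of_ne (hz z hz')).resolve_right fun h' => key z hz' y hy h' h0
      rw [h1, h2, h3, eulerSign_empty]; ring
    · have h1 : C ∩ {x | l x < 0} = ∅ := by
        ext z; simp only [Set.mem_inter_iff, Set.mem_ofPred_eq, Set.mem_empty_iff_false, iff_false]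
        rintro ⟨h1, h2⟩; exact key y hy z h1 h0 h2
      have h2 : C ∩ {x | 0 < l x} = C := Set.inter_eq_left.2 fun z hz' =>
        (lt_or_gt_of_ne (hz z hz')).resolve_left fun h' => key y hy z hz' h0 h'
      rw [h1, h2, h3, eulerSign_empty]; ring

/-- Additivity of the Euler characteristic for a partition of a relatively open convex set into
relatively open convex sets that are unions of cells of a hyperplane arrangement. -/
theorem sum_eulerSign [FiniteDimensional ℝ A] {κ : Type*} (K : Finset κ) (L : List (Dual ℝ A)) :
    ∀ (C : κ → Set A) (C₀ : Set A), RelOpen C₀ → (∀ k ∈ K, RelOpen (C k)) →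
      (∀ k ∈ K, C k ⊆ C₀) → (∀ x ∈ C₀, ∃! k, k ∈ K ∧ x ∈ C k) →
      (∀ x ∈ C₀, ∀ y ∈ C₀, (∀ l ∈ L, SignType.sign (l x) = SignType.sign (l y)) →
        ∀ k ∈ K, x ∈ C k → y ∈ C k) →
      ∑ k ∈ K, eulerSign (C k) = eulerSign C₀ := by
  induction L with
  | nil =>
    intro C C₀ h0 hC hsub hex hdet
    rcases C₀.eq_empty_or_nonempty with rfl | ⟨x, hx⟩
    · rw [eulerSign_empty]
      refine Finset.sum_eq_zero fun k hk => ?_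
      rw [Set.subset_empty_iff.1 (hsub k hk), eulerSign_empty]
    · obtain ⟨k, ⟨hk, hxk⟩, huniq⟩ := hex x hx
      -- With no functionals left all points have equal signs, so a cell with one point is
      -- everything.
      have hCk : C k = C₀ := (hsub k hk).antisymm fun y hy => hdet x hx y hy (by simp) k hk hxk
      rw [Finset.sum_eq_single_of_mem k hk, hCk]
      intro k' hk' hne
      have : C k' = ∅ := by
        by_contra hc
        obtain ⟨y, hy⟩ := Set.nonempty_iff_ne_empty.2 hc
        exact hne (huniq k' ⟨hk', hdet y (hsub k' hk' hy) x hx (by simp) k' hk' hy⟩)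
      rw [this, eulerSign_empty]
  | cons l L ih =>
    intro C C₀ h0 hC hsub hex hdet
    -- On each of the three sides `B` of the hyperplane `l = 0` the sign of `l` is constant, so the
    -- remaining functionals determine the cells there.
    have key : ∀ B : Set A, (∀ x ∈ B, ∀ y ∈ B, SignType.sign (l x) = SignType.sign (l y)) →
        RelOpen (C₀ ∩ B) → (∀ k ∈ K, RelOpen (C k ∩ B)) →
        ∑ k ∈ K, eulerSign (C k ∩ B) = eulerSign (C₀ ∩ B) := by
      intro B hB h0' hC'
      refine ih _ _ h0' hC' (fun k hk => Set.inter_subset_inter_left _ (hsub k hk)) ?_ ?_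
      · rintro x ⟨hx, hxB⟩
        obtain ⟨k, ⟨hk, hxk⟩, huniq⟩ := hex x hx
        exact ⟨k, ⟨hk, hxk, hxB⟩, fun k' hk' => huniq k' ⟨hk'.1, hk'.2.1⟩⟩
      · rintro x ⟨hx, hxB⟩ y ⟨hy, hyB⟩ hs k hk ⟨hxk, _⟩
        refine ⟨hdet x hx y hy ?_ k hk hxk, hyB⟩
        intro l' hl'
        rcases List.mem_cons.1 hl' with rfl | hl'
        · exact hB x hxB y hyB
        · exact hs l' hl'
    rw [h0.eulerSign_split l, ← key _ ?_ (h0.inter_pos l) fun k hk => (hC k hk).inter_pos l,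
      ← key _ ?_ (h0.inter_zero l) fun k hk => (hC k hk).inter_zero l,
      ← key _ ?_ (h0.inter_neg l) fun k hk => (hC k hk).inter_neg l, ← Finset.sum_add_distrib,
      ← Finset.sum_add_distrib]
    · exact Finset.sum_congr rfl fun k hk => (hC k hk).eulerSign_split l
    · intro x hx y hy
      simp only [Set.mem_ofPred_eq] at hx hy
      rw [sign_neg hx, sign_neg hy]
    · intro x hx y hy
      simp only [Set.mem_ofPred_eq] at hx hy
      rw [hx, hy]
    · intro x hx y hy
      simp only [Set.mem_ofPred_eq] at hx hy
      rw [sign_pos hx, sign_pos hy]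

end RelOpen
end PolygonProducts


namespace PolygonProducts
open Module Submodule
open scoped Classical

/-! ### Faces of finitely generated cones and the Euler relation for intervals -/

section ConeFaces
variable {V : Type*} [AddCommGroup V] [Module ℝ V] {ι : Type*}

theorem relOpen_submodule {A : Type*} [AddCommGroup A] [Module ℝ A] (S : Submodule ℝ A) :
    RelOpen (S : Set A) :=
  ⟨S.convex, fun x hx d hd => ⟨1, one_pos, by
    rw [span_eq] at hd; exact add_mem hx (smul_mem _ _ hd)⟩⟩

theorem relOpen_inter_forall_pos {A : Type*} [AddCommGroup A] [Module ℝ A] (S : Submodule ℝ A)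
    (T : List (Dual ℝ A)) : RelOpen {x : A | x ∈ S ∧ ∀ l ∈ T, 0 < l x} ∧
      ({x : A | x ∈ S ∧ ∀ l ∈ T, 0 < l x}.Nonempty →
        span ℝ {x : A | x ∈ S ∧ ∀ l ∈ T, 0 < l x} = S) := by
  induction T with
  | nil =>
    have h : {x : A | x ∈ S ∧ ∀ l ∈ ([] : List (Dual ℝ A)), 0 < l x} = S := by ext; simp
    rw [h]
    exact ⟨relOpen_submodule S, fun _ => span_eq S⟩
  | cons l T ih =>
    have h : {x : A | x ∈ S ∧ ∀ l' ∈ l :: T, 0 < l' x} =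
        {x : A | x ∈ S ∧ ∀ l ∈ T, 0 < l x} ∩ {x | 0 < l x} := by
      ext x; simp; tauto
    rw [h]
    exact ⟨ih.1.inter_pos l, fun hne => (ih.1.span_inter_pos l hne).trans
      (ih.2 (hne.mono Set.inter_subset_left))⟩

/-- `F` is the index set of a face of the cone generated by the vectors `u i`, `i ∈ H`. -/
def IsFaceIn (u : ι → V) (H F : Finset ι) : Prop :=
  F ⊆ H ∧ ∃ φ : Dual ℝ V, (∀ i ∈ F, φ (u i) = 0) ∧ ∀ i ∈ H, i ∉ F → 0 < φ (u i)

/-- The rank of the vectors `u i`, `i ∈ F`. -/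
noncomputable def rk (u : ι → V) (F : Finset ι) : ℕ := finrank ℝ (span ℝ (u '' F))

theorem IsFaceIn.refl (u : ι → V) (H : Finset ι) : IsFaceIn u H H :=
  ⟨subset_rfl, 0, by simp, fun i h h' => absurd h h'⟩

theorem IsFaceIn.mono {u : ι → V} {H K F : Finset ι} (h : IsFaceIn u K F) (hF : F ⊆ H)
    (hH : H ⊆ K) : IsFaceIn u H F := by
  obtain ⟨_, φ, h1, h2⟩ := h
  exact ⟨hF, φ, h1, fun i hi => h2 i (hH hi)⟩

/-- If `φ` cuts `H` out of `K` and `ψ` cuts `F` out of `H`, then `ψ` plus a large multiple of `φ`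
cuts `F` out of `K`: `φ` vanishes on `H` and outweighs `ψ` on `K \ H`. -/
theorem IsFaceIn.trans {u : ι → V} {H K F : Finset ι} (hH : IsFaceIn u K H)
    (hF : IsFaceIn u H F) : IsFaceIn u K F := by
  obtain ⟨hHK, φ, h1, h2⟩ := hH
  obtain ⟨hFH, ψ, h3, h4⟩ := hF
  refine ⟨hFH.trans hHK, ?_⟩
  obtain ⟨M, hM⟩ := ((K \ H).image fun i => -ψ (u i) / φ (u i)).bddAbove
  refine ⟨ψ + (M + 1) • φ, fun i hi => by simp [h3 i hi, h1 i (hFH hi)], fun i hi hiF => ?_⟩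
  by_cases hiH : i ∈ H
  · simp [h1 i hiH, h4 i hiH hiF]
  · have hp := h2 i hi hiH
    have := hM (Finset.mem_coe.2 (Finset.mem_image_of_mem _ (Finset.mem_sdiff.2 ⟨hi, hiH⟩)))
    rw [div_le_iff₀ hp] at this
    simp only [LinearMap.add_apply, LinearMap.smul_apply, smul_eq_mul]
    linarith

theorem rk_empty (u : ι → V) : rk u ∅ = 0 := by
  rw [rk, Finset.coe_empty, Set.image_empty, span_empty, finrank_bot]

section Finrank
variable [FiniteDimensional ℝ V]

theorem rk_mono (u : ι → V) {F H : Finset ι} (h : F ⊆ H) : rk u F ≤ rk u H :=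
  finrank_mono (span_mono (Set.image_mono (Finset.coe_subset.2 h)))

theorem IsFaceIn.rk_lt {u : ι → V} {H F : Finset ι} (h : IsFaceIn u H F) (hne : F ≠ H) :
    rk u F < rk u H := by
  obtain ⟨hFH, φ, h1, h2⟩ := h
  obtain ⟨i, hi, hiF⟩ := Finset.exists_of_ssubset (hFH.ssubset_of_ne hne)
  refine finrank_lt_finrank_of_lt (lt_of_le_of_ne
    (span_mono (Set.image_mono (Finset.coe_subset.2 hFH))) fun heq => ?_)
  have hle : span ℝ (u '' F) ≤ LinearMap.ker φ := by
    rw [span_le]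
    rintro _ ⟨j, hj, rfl⟩
    exact h1 j hj
  have hmem : u i ∈ span ℝ (u '' F) := by
    rw [heq]; exact subset_span ⟨i, hi, rfl⟩
  exact (h2 i hi hiF).ne' (hle hmem)

theorem IsFaceIn.rk_lt_of_ssubset {u : ι → V} {K H F : Finset ι} (h : IsFaceIn u K F)
    (hH : H ⊆ K) (hlt : F ⊂ H) : rk u F < rk u H :=
  (h.mono hlt.1 hH).rk_lt hlt.ne

end Finrank

/-- The linear functionals vanishing on the vectors `u i`, `i ∈ F`. -/
def annih (u : ι → V) (F : Finset ι) : Submodule ℝ (Dual ℝ V) :=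
  (span ℝ (u '' F)).dualAnnihilator

theorem mem_annih {u : ι → V} {F : Finset ι} {φ : Dual ℝ V} :
    φ ∈ annih u F ↔ ∀ i ∈ F, φ (u i) = 0 := by
  rw [annih, mem_dualAnnihilator]
  constructor
  · exact fun h i hi => h _ (subset_span ⟨i, hi, rfl⟩)
  · intro h
    have : span ℝ (u '' F) ≤ LinearMap.ker φ := by
      rw [span_le]
      rintro _ ⟨j, hj, rfl⟩
      exact h j hj
    exact fun w hw => this hw

theorem finrank_annih [FiniteDimensional ℝ V] (u : ι → V) (F : Finset ι) :
    rk u F + finrank ℝ (annih u F) = finrank ℝ V :=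
  Subspace.finrank_add_finrank_dualAnnihilator_eq _

/-- The functionals on `V` vanishing on `G` and constant on the vectors `z i`, `i ∈ F \ G`. -/
def levelSpace (u z : ι → V) (G F : Finset ι) : Submodule ℝ (Dual ℝ V) where
  carrier := {φ | (∀ i ∈ G, φ (u i) = 0) ∧ ∀ i ∈ F \ G, ∀ j ∈ F \ G, φ (z i) = φ (z j)}
  zero_mem' := by simp
  add_mem' := by
    rintro φ ψ ⟨h1, h2⟩ ⟨h3, h4⟩
    exact ⟨fun i hi => by simp [h1 i hi, h3 i hi],
      fun i hi j hj => by simp [h2 i hi j hj, h4 i hi j hj]⟩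
  smul_mem' := by
    rintro c φ ⟨h1, h2⟩
    exact ⟨fun i hi => by simp [h1 i hi], fun i hi j hj => by simp [h2 i hi j hj]⟩

/-- Evaluation at one `z i₀` with `i₀ ∈ F \ G` is not zero on the level space, because `φ₀` takes
the value `1` there, and its kernel is the annihilator of `F`. -/
theorem finrank_levelSpace [FiniteDimensional ℝ V] {u z : ι → V} {G F : Finset ι} (hGF : G ⊂ F) {φ₀ : Dual ℝ V}
    (h0 : ∀ i ∈ G, φ₀ (u i) = 0) (h1 : ∀ i ∈ F, i ∉ G → 0 < φ₀ (u i))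
    (hz : ∀ i, z i = (φ₀ (u i))⁻¹ • u i) :
    rk u F + finrank ℝ (levelSpace u z G F) = finrank ℝ V + 1 := by
  obtain ⟨i₀, hi₀, hi₀G⟩ := Finset.exists_of_ssubset hGF
  have hz1 : ∀ i ∈ F \ G, φ₀ (z i) = 1 := by
    intro i hi
    rw [Finset.mem_sdiff] at hi
    rw [hz, map_smul, smul_eq_mul, inv_mul_cancel₀ (h1 i hi.1 hi.2).ne']
  have hi₀' := Finset.mem_sdiff.2 ⟨hi₀, hi₀G⟩
  have hφ₀ : φ₀ ∈ levelSpace u z G F :=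
    ⟨h0, fun i hi j hj => by rw [hz1 i hi, hz1 j hj]⟩
  have := finrank_inf_ker_add_one (levelSpace u z G F) (Dual.eval ℝ V (z i₀)) hφ₀
    (by simp [hz1 i₀ hi₀'])
  rw [← this, ← finrank_annih u F]
  have heq : levelSpace u z G F ⊓ LinearMap.ker (Dual.eval ℝ V (z i₀)) = annih u F := by
    ext φ
    simp only [mem_inf, LinearMap.mem_ker, Dual.eval_apply, mem_annih]
    constructor
    · rintro ⟨⟨h2, h3⟩, h4⟩ i hi
      by_cases hiG : i ∈ G
      · exact h2 i hiG
      · have h5 := h3 i (Finset.mem_sdiff.2 ⟨hi, hiG⟩) i₀ hi₀'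
        rw [h4, hz, map_smul, smul_eq_mul] at h5
        exact (mul_eq_zero.1 h5).resolve_left (inv_ne_zero (h1 i hi hiG).ne')
    · intro h
      have hz0 : ∀ i ∈ F \ G, φ (z i) = 0 := fun i hi => by
        rw [hz, map_smul, h i (Finset.mem_sdiff.1 hi).1, smul_zero]
      exact ⟨⟨fun i hi => h i (hGF.1 hi), fun i hi j hj => by rw [hz0 i hi, hz0 j hj]⟩,
        hz0 i₀ hi₀'⟩
  rw [heq]; ring

/-- With `c` the common level on `F \ G`, the functional `φ - c φ₀` takes on `u i`, `i ∉ G`, the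
value `φ₀ (u i)` times the height of the normalized vector above that level. -/
theorem exists_isFaceIn_of_functional {u : ι → V} {G H F : Finset ι} {φ₀ φ : Dual ℝ V}
    (h0 : ∀ i ∈ G, φ₀ (u i) = 0) (h1 : ∀ i ∈ H, i ∉ G → 0 < φ₀ (u i)) (hGF : G ⊂ F) (hFH : F ⊆ H)
    (hφ : ∀ i ∈ G, φ (u i) = 0)
    (heq : ∀ i ∈ F \ G, ∀ j ∈ F \ G, φ ((φ₀ (u i))⁻¹ • u i) = φ ((φ₀ (u j))⁻¹ • u j))
    (hlt : ∀ i ∈ F \ G, ∀ j ∈ H \ F, φ ((φ₀ (u i))⁻¹ • u i) < φ ((φ₀ (u j))⁻¹ • u j)) :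
    IsFaceIn u H F := by
  obtain ⟨i₀, hi₀, hi₀G⟩ := Finset.exists_of_ssubset hGF
  have hi₀' := Finset.mem_sdiff.2 ⟨hi₀, hi₀G⟩
  refine ⟨hFH, φ - φ ((φ₀ (u i₀))⁻¹ • u i₀) • φ₀, fun i hi => ?_, fun i hi hiF => ?_⟩
  · by_cases hiG : i ∈ G
    · simp [hφ i hiG, h0 i hiG]
    · have h5 := heq i (Finset.mem_sdiff.2 ⟨hi, hiG⟩) i₀ hi₀'
      have hp := h1 i (hFH hi) hiG
      rw [LinearMap.sub_apply, LinearMap.smul_apply, ← h5, map_smul, smul_eq_mul, smul_eq_mul]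
      field_simp
      ring
  · have hiG : i ∉ G := fun h => hiF (hGF.1 h)
    have hp := h1 i hi hiG
    have h5 := hlt i₀ hi₀' i (Finset.mem_sdiff.2 ⟨hi, hiF⟩)
    rw [LinearMap.sub_apply, LinearMap.smul_apply, smul_eq_mul, sub_pos]
    rw [map_smul φ (φ₀ (u i))⁻¹, smul_eq_mul, inv_mul_eq_div, lt_div_iff₀ hp] at h5
    exact h5

/-- `F` consists of `G` and the minimizers of `f` on `H \ G`. For `f` given by a functional on the
normalized vectors this set is a face. -/
theorem exists_argmin_face {G H : Finset ι} (hGH : G ⊂ H) (f : ι → ℝ) :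
    ∃ F, G ⊂ F ∧ F ⊆ H ∧ (∀ i ∈ F \ G, ∀ j ∈ F \ G, f i = f j) ∧
      ∀ i ∈ F \ G, ∀ j ∈ H \ F, f i < f j := by
  have hne : (H \ G).Nonempty := by
    obtain ⟨i, hi, hiG⟩ := Finset.exists_of_ssubset hGH
    exact ⟨i, Finset.mem_sdiff.2 ⟨hi, hiG⟩⟩
  obtain ⟨i₀, hi₀, hmin⟩ := Finset.exists_min_image (H \ G) f hne
  have hi₀' := Finset.mem_sdiff.1 hi₀
  have hF : ∀ i, i ∈ (G ∪ (H \ G).filter fun i => f i = f i₀) \ G ↔ i ∈ H \ G ∧ f i = f i₀ := by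
    intro i
    simp only [Finset.mem_sdiff, Finset.mem_union, Finset.mem_filter]
    tauto
  refine ⟨G ∪ (H \ G).filter fun i => f i = f i₀, ?_, ?_, ?_, ?_⟩
  · refine Finset.ssubset_iff_of_subset Finset.subset_union_left |>.2 ⟨i₀, ?_, hi₀'.2⟩
    exact Finset.mem_union_right _ (Finset.mem_filter.2 ⟨hi₀, rfl⟩)
  · exact Finset.union_subset hGH.1 ((Finset.filter_subset _ _).trans Finset.sdiff_subset)
  · intro i hi j hj
    rw [((hF i).1 hi).2, ((hF j).1 hj).2]
  · intro i hi j hj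
    rw [((hF i).1 hi).2]
    rw [Finset.mem_sdiff, Finset.mem_union, Finset.mem_filter, not_or] at hj
    have hj' := Finset.mem_sdiff.2 ⟨hj.1, hj.2.1⟩
    exact lt_of_le_of_ne (hmin j hj') fun h => hj.2.2 ⟨hj', h.symm⟩

/-- The face lattice of a cone is graded by rank: a face whose rank is smaller by at least two is
not a facet. -/
theorem IsFaceIn.exists_between [FiniteDimensional ℝ V] {u : ι → V} {G H : Finset ι} (hG : IsFaceIn u H G)
    (hrk : rk u G + 2 ≤ rk u H) : ∃ F, IsFaceIn u H F ∧ G ⊂ F ∧ F ⊂ H := by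
  obtain ⟨hGH, φ₀, h0, h1⟩ := hG
  have hne : G ≠ H := by rintro rfl; omega
  have hlt := hGH.ssubset_of_ne hne
  obtain ⟨i₀, hi₀, hi₀G⟩ := Finset.exists_of_ssubset hlt
  -- The rank gap leaves a vector `u i₁` outside the span of `G` and `u i₀`. A functional vanishing
  -- on that span but not at `u i₁` is not constant on the normalized vectors, so its minimizers
  -- form a proper face.
  have hex : ∃ i ∈ H, u i ∉ span ℝ (u '' (insert i₀ G : Finset ι)) := by
    by_contra! hc
    have h2 : rk u H ≤ rk u (insert i₀ G) := by
      refine finrank_mono (span_le.2 ?_)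
      rintro _ ⟨i, hi, rfl⟩
      exact hc i hi
    have h3 : rk u (insert i₀ G) ≤ rk u G + 1 := by
      unfold rk
      rw [Finset.coe_insert, Set.image_insert_eq, span_insert, add_comm]
      refine (finrank_add_le_finrank_add_finrank _ _).trans ?_
      gcongr
      exact (finrank_span_le_card _).trans (by simp)
    omega
  obtain ⟨i₁, hi₁, hn⟩ := hex
  obtain ⟨φ, hφ1, hφ⟩ := exists_le_ker_of_notMem hn
  have hφ' : ∀ i ∈ insert i₀ G, φ (u i) = 0 := fun i hi =>
    hφ (subset_span ⟨i, hi, rfl⟩)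
  have hi₁G : i₁ ∉ G := fun h => hφ1 (hφ' _ (Finset.mem_insert_of_mem h))
  obtain ⟨F, hGF, hFH, heq, hlt'⟩ := exists_argmin_face hlt
    (fun i => φ ((φ₀ (u i))⁻¹ • u i))
  refine ⟨F, exists_isFaceIn_of_functional h0 h1 hGF hFH
    (fun i hi => hφ' i (Finset.mem_insert_of_mem hi)) heq hlt', hGF, hFH.ssubset_of_ne ?_⟩
  rintro rfl
  have := heq i₀ (Finset.mem_sdiff.2 ⟨hi₀, hi₀G⟩) i₁ (Finset.mem_sdiff.2 ⟨hi₁, hi₁G⟩)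
  simp only [map_smul, hφ' i₀ (Finset.mem_insert_self _ _), smul_eq_mul, mul_zero] at this
  rcases mul_eq_zero.1 this.symm with h | h
  · exact inv_ne_zero (h1 i₁ hi₁ hi₁G).ne' h
  · exact hφ1 h

theorem neg_one_pow_mul_of_add_eq {a b c : ℕ} (h : a + b = c) :
    (-1 : ℤ) ^ c * (-1) ^ b = (-1) ^ a := by
  rw [← h, pow_add, mul_assoc, ← pow_add, ← two_mul, pow_mul]; simp

/-- The Euler relation for intervals in the face lattice of a cone. -/
theorem IsFaceIn.euler [FiniteDimensional ℝ V] [Fintype ι] {u : ι → V} {G H : Finset ι} (hG : IsFaceIn u H G)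
    (hne : G ≠ H) :
    ∑ F with IsFaceIn u H F ∧ G ⊆ F, (-1 : ℤ) ^ rk u F = 0 := by
  have hG' := hG
  obtain ⟨hGH, φ₀, h0, h1⟩ := hG
  have hlt := hGH.ssubset_of_ne hne
  -- The cell `C F` consists of the functionals vanishing on `G` whose minimum over the `z i`, `i ∈
  -- H \ G`, is attained exactly on `F \ G`. When nonempty it has dimension `finrank ℝ V + 1 - rk u
  -- F`, whereas the whole space has dimension `finrank ℝ V - rk u G`; the shift by one provides the
  -- sign that cancels the term of `G`.
  set z : ι → V := fun i => (φ₀ (u i))⁻¹ • u i with hz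
  set K : Finset (Finset ι) := Finset.univ.filter fun F => G ⊂ F ∧ F ⊆ H
  let T : Finset ι → List (Dual ℝ (Dual ℝ V)) := fun F =>
    ((F \ G) ×ˢ (H \ F)).toList.map fun p => Dual.eval ℝ V (z p.2 - z p.1)
  let C : Finset ι → Set (Dual ℝ V) := fun F =>
    {φ | φ ∈ levelSpace u z G F ∧ ∀ l ∈ T F, 0 < l φ}
  have hT : ∀ F φ, (∀ l ∈ T F, 0 < l φ) ↔ ∀ i ∈ F \ G, ∀ j ∈ H \ F, φ (z i) < φ (z j) := by
    intro F φ
    simp only [T, List.mem_map, Finset.mem_toList, Finset.mem_product, forall_exists_index,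
      and_imp, Prod.forall]
    constructor
    · intro h i hi j hj
      have := h _ i j hi hj rfl
      simpa using this
    · rintro h _ i j hi hj rfl
      simpa using h i hi j hj
  have hmemK : ∀ F, F ∈ K ↔ G ⊂ F ∧ F ⊆ H := by simp [K]
  have hface : ∀ F ∈ K, (C F).Nonempty ↔ IsFaceIn u H F := by
    intro F hF
    rw [hmemK] at hF
    constructor
    · rintro ⟨φ, ⟨ha, hb⟩, hc⟩
      exact exists_isFaceIn_of_functional h0 h1 hF.1 hF.2 ha hb ((hT F φ).1 hc)
    · rintro ⟨_, φ, ha, hb⟩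
      have hz0 : ∀ i ∈ F, φ (z i) = 0 := fun i hi => by simp [hz, ha i hi]
      refine ⟨φ, ⟨fun i hi => ha i (hF.1.1 hi), fun i hi j hj => ?_⟩, (hT F φ).2 ?_⟩
      · rw [hz0 i (Finset.mem_sdiff.1 hi).1, hz0 j (Finset.mem_sdiff.1 hj).1]
      · intro i hi j hj
        rw [Finset.mem_sdiff] at hj
        rw [hz0 i (Finset.mem_sdiff.1 hi).1, hz, map_smul, smul_eq_mul]
        exact mul_pos (inv_pos.2 (h1 j hj.1 fun h => hj.2 (hF.1.1 h))) (hb j hj.1 hj.2)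
  -- The signs of the differences `φ (z j) - φ (z i)` determine the minimizers, hence the cell.
  have hsum := sum_eulerSign K
    ((Finset.univ : Finset (ι × ι)).toList.map fun p => Dual.eval ℝ V (z p.2 - z p.1)) C
    (annih u G) (relOpen_submodule _) (fun F _ => (relOpen_inter_forall_pos _ _).1)
    (fun F _ φ hφ => mem_annih.2 hφ.1.1) ?_ ?_
  · have hval : ∀ F ∈ K, eulerSign (C F) =
        if IsFaceIn u H F then (-1) ^ (finrank ℝ V) * (-(-1) ^ rk u F) else 0 := by
      intro F hF
      unfold eulerSign
      by_cases hf : IsFaceIn u H F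
      · have hne' := (hface F hF).2 hf
        have hF' := (hmemK F).1 hF
        rw [if_pos hne', if_pos hf, (relOpen_inter_forall_pos _ _).2 hne']
        have hr := finrank_levelSpace (z := z) hF'.1 h0 (fun i hi => h1 i (hF'.2 hi)) fun i => rfl
        rw [add_comm] at hr
        rw [← neg_one_pow_mul_of_add_eq hr]
        ring
      · rw [if_neg ((hface F hF).not.2 hf), if_neg hf]
    have h0val : eulerSign (annih u G : Set (Dual ℝ V)) =
        (-1) ^ (finrank ℝ V) * (-1) ^ rk u G := by
      unfold eulerSign
      rw [if_pos ⟨0, zero_mem _⟩, span_eq]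
      have hr := finrank_annih u G
      rw [add_comm] at hr
      rw [neg_one_pow_mul_of_add_eq hr]
    rw [Finset.sum_congr rfl hval, h0val, ← Finset.sum_filter, ← Finset.mul_sum,
      Finset.sum_neg_distrib] at hsum
    have hsum' := mul_left_cancel₀ (pow_ne_zero _ (by norm_num)) hsum
    have hset : (Finset.univ.filter fun F => IsFaceIn u H F ∧ G ⊆ F) =
        insert G (K.filter fun F => IsFaceIn u H F) := by
      ext F
      simp only [Finset.mem_filter, Finset.mem_univ, true_and, Finset.mem_insert, hmemK]
      constructor
      · rintro ⟨hf, hGF⟩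
        by_cases h : F = G
        · exact Or.inl h
        · exact Or.inr ⟨⟨hGF.ssubset_of_ne (Ne.symm h), hf.1⟩, hf⟩
      · rintro (rfl | ⟨⟨h, _⟩, hf⟩)
        · exact ⟨hG', subset_rfl⟩
        · exact ⟨hf, h.1⟩
    rw [hset, Finset.sum_insert, ← hsum']
    · ring
    · rw [Finset.mem_filter, hmemK]
      exact fun h => h.1.1.ne rfl
  · intro φ hφ
    have hφ' := mem_annih.1 hφ
    obtain ⟨F, hGF, hFH, heq, hlt'⟩ := exists_argmin_face hlt (fun i => φ (z i))
    refine ⟨F, ⟨(hmemK F).2 ⟨hGF, hFH⟩, ⟨hφ', heq⟩, (hT F φ).2 hlt'⟩, ?_⟩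
    rintro F' ⟨hF', ⟨_, heq'⟩, hlt''⟩
    rw [hT] at hlt''
    rw [hmemK] at hF'
    obtain ⟨i, hi, hiG⟩ := Finset.exists_of_ssubset hGF
    obtain ⟨j, hj, hjG⟩ := Finset.exists_of_ssubset hF'.1
    have hi' := Finset.mem_sdiff.2 ⟨hi, hiG⟩
    have hj' := Finset.mem_sdiff.2 ⟨hj, hjG⟩
    -- Both values are the minimum of `φ` over the normalized vectors.
    have hij : φ (z i) = φ (z j) := by
      refine le_antisymm ?_ ?_
      · by_cases hjF : j ∈ F
        · exact (heq i hi' j (Finset.mem_sdiff.2 ⟨hjF, hjG⟩)).le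
        · exact (hlt' i hi' j (Finset.mem_sdiff.2 ⟨hF'.2 hj, hjF⟩)).le
      · by_cases hiF : i ∈ F'
        · exact (heq' j hj' i (Finset.mem_sdiff.2 ⟨hiF, hiG⟩)).le
        · exact (hlt'' j hj' i (Finset.mem_sdiff.2 ⟨hFH hi, hiF⟩)).le
    ext k
    by_cases hkG : k ∈ G
    · exact ⟨fun _ => hGF.1 hkG, fun _ => hF'.1.1 hkG⟩
    · constructor
      · intro hk
        by_contra hkF
        have h2 := hlt' i hi' k (Finset.mem_sdiff.2 ⟨hF'.2 hk, hkF⟩)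
        have h3 := heq' j hj' k (Finset.mem_sdiff.2 ⟨hk, hkG⟩)
        linarith
      · intro hk
        by_contra hkF
        have h2 := hlt'' j hj' k (Finset.mem_sdiff.2 ⟨hFH hk, hkF⟩)
        have h3 := heq i hi' k (Finset.mem_sdiff.2 ⟨hk, hkG⟩)
        linarith
  · intro φ hφ ψ hψ hs F hF hφF
    have hs' : ∀ i j, SignType.sign (φ (z j - z i)) = SignType.sign (ψ (z j - z i)) := by
      intro i j
      have := hs (Dual.eval ℝ V (z j - z i))
        (List.mem_map.2 ⟨(i, j), Finset.mem_toList.2 (Finset.mem_univ _), rfl⟩)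
      simpa using this
    refine ⟨⟨mem_annih.1 hψ, fun i hi j hj => ?_⟩, (hT F ψ).2 fun i hi j hj => ?_⟩
    · have h2 := hφF.1.2 j hj i hi
      have h3 := hs' i j
      rw [map_sub φ, map_sub ψ, h2, sub_self, sign_zero] at h3
      exact (sub_eq_zero.1 (sign_eq_zero_iff.1 h3.symm)).symm
    · have h2 := (hT F φ).1 hφF.2 i hi j hj
      have h3 := hs' i j
      rw [map_sub φ, map_sub ψ, sign_pos (sub_pos.2 h2)] at h3
      exact sub_pos.1 (sign_eq_one_iff.1 h3.symm)

end ConeFaces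
end PolygonProducts


namespace PolygonProducts
open Module Submodule
open scoped Classical

/-! ### From polytopes to cones: homogenization and vertex sets of faces -/

section Polytopes
variable {E : Type*} [NormedAddCommGroup E] [NormedSpace ℝ E] {ι : Type*}

/-- Homogenization of a family of points. -/
def homog (p : ι → E) (i : ι) : E × ℝ := (p i, 1)

/-- A linear functional on `E × ℝ` restricts to an affine one at height `1`; its vanishing and
positivity become a supporting hyperplane `l ≤ c`. -/
theorem isFaceIn_homog {p : ι → E} {H F : Finset ι} :
    IsFaceIn (homog p) H F ↔ F ⊆ H ∧ ∃ (l : E →ₗ[ℝ] ℝ) (c : ℝ),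
      (∀ i ∈ F, l (p i) = c) ∧ ∀ i ∈ H, i ∉ F → l (p i) < c := by
  have hdec : ∀ (φ : Dual ℝ (E × ℝ)) (i : ι),
      φ (homog p i) = φ (p i, 0) + φ (0, 1) := fun φ i => by rw [← map_add]; simp [homog]
  constructor
  · rintro ⟨hFH, φ, h1, h2⟩
    refine ⟨hFH, -(φ ∘ₗ LinearMap.inl ℝ E ℝ), φ (0, 1), fun i hi => ?_, fun i hi hiF => ?_⟩
    · have := h1 i hi
      rw [hdec] at this
      simp only [LinearMap.neg_apply, LinearMap.comp_apply, LinearMap.inl_apply]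
      linarith
    · have := h2 i hi hiF
      rw [hdec] at this
      simp only [LinearMap.neg_apply, LinearMap.comp_apply, LinearMap.inl_apply]
      linarith
  · rintro ⟨hFH, l, c, h1, h2⟩
    refine ⟨hFH, c • LinearMap.snd ℝ E ℝ - l ∘ₗ LinearMap.fst ℝ E ℝ, fun i hi => ?_,
      fun i hi hiF => ?_⟩
    · simp [homog, h1 i hi]
    · simpa [homog] using h2 i hi hiF

theorem isFaceIn_homog_empty (p : ι → E) (H : Finset ι) : IsFaceIn (homog p) H ∅ :=
  isFaceIn_homog.2 ⟨Finset.empty_subset _, 0, 1, by simp, by simp⟩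

theorem le_and_mem_of_mem_convexHull {p : ι → E} {F : Finset ι} {l : E →ₗ[ℝ] ℝ} {c : ℝ}
    (h1 : ∀ i ∈ F, l (p i) = c) (h2 : ∀ i, i ∉ F → l (p i) < c) {x : E}
    (hx : x ∈ convexHull ℝ (Set.range p)) : l x ≤ c ∧ (l x = c → x ∈ convexHull ℝ (p '' F)) := by
  suffices h : convexHull ℝ (Set.range p) ⊆
      {x | l x ≤ c ∧ (l x = c → x ∈ convexHull ℝ (p '' F))} from h hx
  refine convexHull_min ?_ ?_
  · rintro _ ⟨i, rfl⟩
    by_cases hi : i ∈ F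
    · exact ⟨(h1 i hi).le, fun _ => subset_convexHull _ _ ⟨i, hi, rfl⟩⟩
    · exact ⟨(h2 i hi).le, fun h => absurd h (h2 i hi).ne⟩
  · rintro x ⟨hx1, hx2⟩ y ⟨hy1, hy2⟩ a b ha hb hab
    have hl : l (a • x + b • y) = a * l x + b * l y := by simp
    have hc : c = a * c + b * c := by rw [← add_mul, hab, one_mul]
    refine ⟨?_, fun h => ?_⟩
    · rw [hl, hc]; gcongr
    · rw [hl] at h
      have e1 := mul_le_mul_of_nonneg_left hx1 ha
      have e2 := mul_le_mul_of_nonneg_left hy1 hb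
      rcases ha.eq_or_lt with rfl | ha'
      · obtain rfl : b = 1 := by linarith
        simpa using hy2 (by linarith)
      rcases hb.eq_or_lt with rfl | hb'
      · obtain rfl : a = 1 := by linarith
        simpa using hx2 (by linarith)
      exact convex_convexHull ℝ _
        (hx2 (mul_left_cancel₀ ha'.ne' (by linarith)))
        (hy2 (mul_left_cancel₀ hb'.ne' (by linarith))) ha hb hab

/-- The span of the lifted points meets height `0` exactly in the direction space of the hull, and
the height itself accounts for one more dimension. -/
theorem affDim_convexHull_add_one [FiniteDimensional ℝ E] {p : ι → E} {F : Finset ι}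
    (hne : F.Nonempty) : affDim (convexHull ℝ (p '' F)) + 1 = rk (homog p) F := by
  obtain ⟨i₀, hi₀⟩ := hne
  unfold affDim rk
  rw [← direction_affineSpan, affineSpan_convexHull, direction_affineSpan,
    ← finrank_inf_ker_add_one (span ℝ (homog p '' F)) (LinearMap.snd ℝ E ℝ) (x := homog p i₀)
      (subset_span ⟨i₀, hi₀, rfl⟩) (by simp [homog])]
  congr 1
  have h : span ℝ (homog p '' F) ⊓ LinearMap.ker (LinearMap.snd ℝ E ℝ) =
      (vectorSpan ℝ (p '' F)).map (LinearMap.inl ℝ E ℝ) := by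
    apply le_antisymm
    · have key : ∀ x ∈ span ℝ (homog p '' F), x.1 - x.2 • p i₀ ∈ vectorSpan ℝ (p '' F) := by
        intro x hx
        induction hx using span_induction with
        | mem x hx =>
          obtain ⟨i, hi, rfl⟩ := hx
          simpa [homog] using vsub_mem_vectorSpan ℝ (Set.mem_image_of_mem p hi)
            (Set.mem_image_of_mem p hi₀)
        | zero => simp
        | add x y _ _ hx hy =>
          have := add_mem hx hy
          convert this using 1
          simp only [Prod.fst_add, Prod.snd_add, add_smul]; abel
        | smul a x _ hx =>
          have := smul_mem _ a hx
          convert this using 1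
          simp [smul_sub, smul_smul]
      rintro ⟨x, t⟩ ⟨hx, ht⟩
      have ht : t = 0 := ht
      subst ht
      exact ⟨x, by simpa using key _ hx, rfl⟩
    · rw [map_le_iff_le_comap, vectorSpan, span_le]
      rintro _ ⟨_, ⟨i, hi, rfl⟩, _, ⟨j, hj, rfl⟩, rfl⟩
      refine ⟨?_, by simp⟩
      have : LinearMap.inl ℝ E ℝ (p i -ᵥ p j) = homog p i - homog p j := by simp [homog]
      simp only [this, SetLike.mem_coe]
      exact sub_mem (subset_span ⟨i, hi, rfl⟩) (subset_span ⟨j, hj, rfl⟩)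
  rw [h]
  exact (LinearEquiv.finrank_eq (equivMapOfInjective _ LinearMap.inl_injective _))

variable [Fintype ι]

/-- The indices of the points of a family that lie in a set. -/
noncomputable def idx {E : Type*} (p : ι → E) (X : Set E) : Finset ι := Finset.univ.filter fun i => p i ∈ X

theorem mem_idx {E : Type*} {p : ι → E} {X : Set E} {i : ι} : i ∈ idx p X ↔ p i ∈ X := by simp [idx]

/-- Together with `IsFaceIn.isExposed` this makes exposed faces and index sets of faces correspond
bijectively. The empty face needs its own argument, as its exposedness carries no functional. -/
theorem eq_convexHull_idx {p : ι → E} {X : Set E}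
    (hX : IsExposed ℝ (convexHull ℝ (Set.range p)) X) :
    IsFaceIn (homog p) Finset.univ (idx p X) ∧ X = convexHull ℝ (p '' idx p X) := by
  rcases X.eq_empty_or_nonempty with rfl | hne
  · have : idx p ∅ = ∅ := by ext; simp [mem_idx]
    rw [this]
    exact ⟨isFaceIn_homog_empty _ _, by simp⟩
  obtain ⟨l, hl⟩ := hX hne
  obtain ⟨x, hx⟩ := hne
  have hmem : ∀ i, p i ∈ convexHull ℝ (Set.range p) := fun i => subset_convexHull _ _ ⟨i, rfl⟩
  have h1 : ∀ i ∈ idx p X, (l : E →ₗ[ℝ] ℝ) (p i) = l x := by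
    intro i hi
    rw [mem_idx] at hi
    rw [hl] at hi hx
    exact le_antisymm (hx.2 _ hi.1) (hi.2 _ hx.1)
  have h2 : ∀ i, i ∉ idx p X → (l : E →ₗ[ℝ] ℝ) (p i) < l x := by
    intro i hi
    rw [mem_idx] at hi
    rw [hl] at hx
    refine lt_of_le_of_ne (hx.2 _ (hmem i)) fun h => hi ?_
    rw [hl]
    exact ⟨hmem i, fun y hy => (hx.2 y hy).trans h.ge⟩
  refine ⟨isFaceIn_homog.2 ⟨Finset.subset_univ _, l, l x, h1, fun i _ => h2 i⟩, ?_⟩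
  have hxc : x ∈ convexHull ℝ (Set.range p) := by rw [hl] at hx; exact hx.1
  refine Set.Subset.antisymm (fun y hy => ?_) ?_
  · rw [hl] at hy hx
    exact (le_and_mem_of_mem_convexHull h1 h2 hy.1).2 (le_antisymm (hx.2 _ hy.1) (hy.2 _ hx.1))
  · refine convexHull_min ?_ (hX.convex (convex_convexHull ℝ _))
    rintro _ ⟨i, hi, rfl⟩
    exact mem_idx.1 hi

theorem IsFaceIn.isExposed [FiniteDimensional ℝ E] {p : ι → E} {F : Finset ι}
    (hF : IsFaceIn (homog p) Finset.univ F) :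
    IsExposed ℝ (convexHull ℝ (Set.range p)) (convexHull ℝ (p '' F)) ∧
      idx p (convexHull ℝ (p '' F)) = F := by
  obtain ⟨_, l, c, h1, h2⟩ := isFaceIn_homog.1 hF
  have h2' : ∀ i, i ∉ F → l (p i) < c := fun i => h2 i (Finset.mem_univ _)
  have hsub : convexHull ℝ (p '' F) ⊆ convexHull ℝ (Set.range p) :=
    convexHull_mono (Set.image_subset_range _ _)
  have hval : ∀ x ∈ convexHull ℝ (p '' F), l x = c := by
    intro x hx
    have : convexHull ℝ (p '' F) ⊆ {x | l x = c} := by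
      refine convexHull_min ?_ (convex_hyperplane l.isLinear c)
      rintro _ ⟨i, hi, rfl⟩
      exact h1 i hi
    exact this hx
  constructor
  · rintro ⟨x₀, hx₀⟩
    refine ⟨LinearMap.toContinuousLinearMap l, ?_⟩
    ext x
    simp only [LinearMap.coe_toContinuousLinearMap', Set.mem_ofPred_eq]
    constructor
    · intro hx
      refine ⟨hsub hx, fun y hy => ?_⟩
      rw [hval x hx]
      exact (le_and_mem_of_mem_convexHull h1 h2' hy).1
    · rintro ⟨hx, hy⟩
      refine (le_and_mem_of_mem_convexHull h1 h2' hx).2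
        (le_antisymm (le_and_mem_of_mem_convexHull h1 h2' hx).1 ?_)
      rw [← hval x₀ hx₀]
      exact hy x₀ (hsub hx₀)
  · ext i
    rw [mem_idx]
    constructor
    · intro h
      by_contra hi
      exact (h2' i hi).ne (hval _ h)
    · exact fun h => subset_convexHull _ _ ⟨i, h, rfl⟩

theorem fNumber_convexHull [FiniteDimensional ℝ E] (p : ι → E) (k : ℕ) :
    fNumber (convexHull ℝ (Set.range p)) k = (Finset.univ.filter fun F : Finset ι =>
      IsFaceIn (homog p) Finset.univ F ∧ rk (homog p) F = k + 1).card := by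
  unfold fNumber
  rw [← Set.ncard_coe_finset]
  symm
  have hne : ∀ F : Finset ι, rk (homog p) F = k + 1 → F.Nonempty := by
    intro F hF
    rw [Finset.nonempty_iff_ne_empty]
    rintro rfl
    rw [rk_empty] at hF; omega
  refine Set.ncard_congr (fun F _ => convexHull ℝ (p '' F)) ?_ ?_ ?_
  · intro F hF
    simp only [Finset.coe_filter, Finset.mem_univ, true_and, Set.mem_ofPred_eq] at hF
    have hF' := hne F hF.2
    refine ⟨hF.1.isExposed.1, (hF'.to_set.image p).convexHull, ?_⟩
    have := affDim_convexHull_add_one (p := p) hF'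
    omega
  · intro F G hF hG h
    simp only [Finset.coe_filter, Finset.mem_univ, true_and, Set.mem_ofPred_eq] at hF hG
    rw [← hF.1.isExposed.2, h, hG.1.isExposed.2]
  · rintro X ⟨hX, hX', hk⟩
    obtain ⟨h1, h2⟩ := eq_convexHull_idx hX
    refine ⟨idx p X, ?_, h2.symm⟩
    simp only [Finset.coe_filter, Finset.mem_univ, true_and, Set.mem_ofPred_eq]
    refine ⟨h1, ?_⟩
    rw [← affDim_convexHull_add_one, ← h2, hk]
    rw [Finset.nonempty_iff_ne_empty]
    intro h
    rw [h2, h] at hX'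
    simp at hX'

/-- Krein–Milman gives the hull. Removing an extreme point `v` leaves a convex set, so `v` lies
outside the compact hull of the other extreme points and can be strictly separated from it; the
separating functional exposes `v`. -/
theorem extremePoints_of_isPolytope [FiniteDimensional ℝ E] {P : Set E} (hP : IsPolytope P) :
    (Set.extremePoints ℝ P).Finite ∧ P = convexHull ℝ (Set.extremePoints ℝ P) ∧
    ∀ v ∈ Set.extremePoints ℝ P, IsExposed ℝ P {v} := by
  obtain ⟨s, hs, rfl⟩ := hP
  have hfin : (Set.extremePoints ℝ (convexHull ℝ s)).Finite :=
    hs.subset extremePoints_convexHull_subset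
  have hKM := closure_convexHull_extremePoints (hs.isCompact_convexHull ℝ) (convex_convexHull ℝ s)
  rw [(hfin.isClosed_convexHull ℝ).closure_eq] at hKM
  refine ⟨hfin, hKM.symm, fun v hv => ?_⟩
  set X := Set.extremePoints ℝ (convexHull ℝ s) with hX
  have hv' := (convex_convexHull ℝ s).mem_extremePoints_iff_convex_sdiff.1 hv
  have hsub : convexHull ℝ (X \ {v}) ⊆ convexHull ℝ s \ {v} :=
    convexHull_min (Set.sdiff_subset_sdiff_left fun x hx => hx.1) hv'.2
  have hcl : IsClosed (convexHull ℝ (X \ {v})) := (hfin.subset Set.sdiff_subset).isClosed_convexHull ℝ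
  obtain ⟨f, a, h1, h2⟩ := geometric_hahn_banach_point_closed (convex_convexHull ℝ (X \ {v})) hcl
    (fun h => (hsub h).2 rfl)
  rw [← hKM]
  have := hfin.fintype
  have hr : X = Set.range (Subtype.val : X → E) := Subtype.range_coe.symm
  have hface : IsFaceIn (homog (Subtype.val : X → E)) Finset.univ {⟨v, hv⟩} := by
    refine isFaceIn_homog.2 ⟨Finset.subset_univ _, -f, -f v, by simp, ?_⟩
    rintro ⟨w, hw⟩ _ hwv
    have hwv' : w ≠ v := by simpa using hwv
    have := h2 w (subset_convexHull _ _ ⟨hw, hwv'⟩)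
    simp only [LinearMap.neg_apply, ContinuousLinearMap.coe_coe]
    linarith
  have := hface.isExposed.1
  rw [← hr] at this
  simpa using this

/-- An order isomorphism matches the atoms, which are the vertices, and a face is determined by the
vertices below it. Hence `P` acquires a labelling by the same indices with the same index sets as
faces. -/
theorem exists_family_of_orderIso [FiniteDimensional ℝ E] {E' : Type*} [NormedAddCommGroup E']
    [NormedSpace ℝ E'] [FiniteDimensional ℝ E'] {q : ι → E}
    (hq : ∀ i, IsFaceIn (homog q) Finset.univ {i}) {P : Set E'} (hP : IsPolytope P)
    (Φ : FaceLattice (convexHull ℝ (Set.range q)) ≃o FaceLattice P) :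
    ∃ p : ι → E', P = convexHull ℝ (Set.range p) ∧
      (∀ F : Finset ι, IsFaceIn (homog p) Finset.univ F ↔ IsFaceIn (homog q) Finset.univ F) ∧
      ∀ X, (Φ X).1 = convexHull ℝ (p '' idx q X.1) := by
  obtain ⟨hfin, hPv, hexp⟩ := extremePoints_of_isPolytope hP
  have hempty : ∀ X, (Φ X).1 = ∅ → X.1 = ∅ := by
    intro X hX
    have h : Φ X ≤ Φ ⟨∅, isExposed_empty⟩ := by
      change (Φ X).1 ⊆ _
      rw [hX]; exact Set.empty_subset _
    exact Set.subset_empty_iff.1 (Φ.le_iff_le.1 h)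
  have hvert : ∀ Y : FaceLattice P, Y.1.Nonempty → ∃ v ∈ Set.extremePoints ℝ P, v ∈ Y.1 := by
    rintro ⟨Y, hY⟩ hne
    have hcomp : IsCompact Y := hY.isCompact (by
      rw [hPv]; exact hfin.isCompact_convexHull ℝ)
    obtain ⟨v, hv⟩ := hcomp.extremePoints_nonempty hne
    exact ⟨v, hY.isExtreme.extremePoints_subset_extremePoints hv, hv.1⟩
  have hsing : ∀ i, IsExposed ℝ (convexHull ℝ (Set.range q)) {q i} := fun i => by
    simpa using (hq i).isExposed.1
  have hex : ∀ i, ∃ v, (Φ ⟨{q i}, hsing i⟩).1 = {v} ∧ v ∈ Set.extremePoints ℝ P := by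
    intro i
    obtain ⟨v, hv, hvm⟩ := hvert (Φ ⟨{q i}, hsing i⟩) (Set.nonempty_iff_ne_empty.2 fun h => by
      simpa using hempty _ h)
    refine ⟨v, ?_, hv⟩
    -- A vertex `v` of the image face pulls back to a nonempty face inside a single point, so the
    -- image face is `{v}`.
    have h1 : Φ.symm ⟨{v}, hexp v hv⟩ ≤ ⟨{q i}, hsing i⟩ := by
      rw [← Φ.le_iff_le, Φ.apply_symm_apply]
      exact Set.singleton_subset_iff.2 hvm
    have h2 : (Φ.symm ⟨{v}, hexp v hv⟩).1 ⊆ {q i} := h1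
    rcases Set.subset_singleton_iff_eq.1 h2 with h | h
    · exfalso
      have h3 : Φ.symm ⟨{v}, hexp v hv⟩ ≤ Φ.symm ⟨∅, isExposed_empty⟩ := by
        change (Φ.symm ⟨{v}, hexp v hv⟩).1 ⊆ _
        rw [h]; exact Set.empty_subset _
      have h4 : ({v} : Set E') ⊆ ∅ := Φ.symm.le_iff_le.1 h3
      simp at h4
    · have h5 : Φ.symm ⟨{v}, hexp v hv⟩ = ⟨{q i}, hsing i⟩ := Subtype.ext h
      rw [← h5, Φ.apply_symm_apply]
  choose p hp hpv using hex
  have hmem : ∀ X i, p i ∈ (Φ X).1 ↔ q i ∈ X.1 := by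
    intro X i
    rw [← Set.singleton_subset_iff, ← hp, ← Set.singleton_subset_iff]
    exact Φ.le_iff_le (x := ⟨{q i}, hsing i⟩)
  have hrange : Set.range p = Set.extremePoints ℝ P := by
    ext v
    constructor
    · rintro ⟨i, rfl⟩; exact hpv i
    · intro hv
      set Y := Φ.symm ⟨{v}, hexp v hv⟩ with hY
      have hYne : (idx q Y.1).Nonempty := by
        rw [Finset.nonempty_iff_ne_empty]
        intro h
        have h2 := (eq_convexHull_idx Y.2).2
        rw [h] at h2
        have h3 : Y ≤ Φ.symm ⟨∅, isExposed_empty⟩ := by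
          change Y.1 ⊆ _
          rw [h2]; simp
        have h4 : ({v} : Set E') ⊆ ∅ := Φ.symm.le_iff_le.1 h3
        simp at h4
      obtain ⟨i, hi⟩ := hYne
      have := (hmem Y i).2 (mem_idx.1 hi)
      rw [hY, Φ.apply_symm_apply] at this
      exact ⟨i, this⟩
  have hP' : P = convexHull ℝ (Set.range p) := by rw [hrange]; exact hPv
  have hidx : ∀ X, idx p (Φ X).1 = idx q X.1 := fun X => by
    ext i; rw [mem_idx, mem_idx, hmem]
  have hexp' : ∀ X, IsExposed ℝ (convexHull ℝ (Set.range p)) (Φ X).1 := fun X => by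
    rw [← hP']; exact (Φ X).2
  refine ⟨p, hP', fun F => ⟨fun hF => ?_, fun hF => ?_⟩, fun X => ?_⟩
  · have h1 := hF.isExposed
    have h2 := h1.1
    rw [← hP'] at h2
    have h3 := hidx (Φ.symm ⟨_, h2⟩)
    rw [Φ.apply_symm_apply, h1.2] at h3
    rw [h3]
    exact (eq_convexHull_idx (Φ.symm ⟨_, h2⟩).2).1
  · obtain ⟨h1, h2⟩ := hF.isExposed
    rw [← (hidx ⟨_, h1⟩).trans h2]
    exact (eq_convexHull_idx (hexp' _)).1
  · rw [← hidx]
    exact (eq_convexHull_idx (hexp' X)).2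

end Polytopes
end PolygonProducts


namespace PolygonProducts
open Module Submodule
open scoped Classical

/-! ### Counting faces by rank -/

section FaceCounts
variable {V : Type*} [AddCommGroup V] [Module ℝ V] {ι : Type*}

theorem rk_le_card (u : ι → V) (F : Finset ι) : rk u F ≤ F.card := by
  unfold rk
  rw [← Finset.coe_image]
  exact (finrank_span_finset_le_card _).trans Finset.card_image_le

variable [Fintype ι]

/-- The faces of rank `k` of the cone generated by the vectors `u i`, `i ∈ H`. -/
noncomputable def facesOfRank (u : ι → V) (H : Finset ι) (k : ℕ) : Finset (Finset ι) :=
  Finset.univ.filter fun F => IsFaceIn u H F ∧ rk u F = k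

theorem mem_facesOfRank {u : ι → V} {H F : Finset ι} {k : ℕ} :
    F ∈ facesOfRank u H k ↔ IsFaceIn u H F ∧ rk u F = k := by simp [facesOfRank]

theorem filter_subset_facesOfRank {u : ι → V} {K H : Finset ι} (hH : IsFaceIn u K H) (k : ℕ) :
    (facesOfRank u K k).filter (· ⊆ H) = facesOfRank u H k := by
  ext F
  rw [Finset.mem_filter, mem_facesOfRank, mem_facesOfRank]
  constructor
  · rintro ⟨⟨h1, h2⟩, h3⟩; exact ⟨h1.mono h3 hH.1, h2⟩
  · rintro ⟨h1, h2⟩; exact ⟨⟨hH.trans h1, h2⟩, h1.1⟩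

variable [FiniteDimensional ℝ V]

theorem facesOfRank_self (u : ι → V) (H : Finset ι) : facesOfRank u H (rk u H) = {H} := by
  ext F
  rw [mem_facesOfRank, Finset.mem_singleton]
  constructor
  · rintro ⟨h1, h2⟩
    by_contra hne
    exact (h1.rk_lt hne).ne h2
  · rintro rfl; exact ⟨IsFaceIn.refl _ _, rfl⟩

theorem facesOfRank_filter_superset {u : ι → V} {H G : Finset ι} (hG : IsFaceIn u H G) :
    (facesOfRank u H (rk u G)).filter (G ⊆ ·) = {G} := by
  ext F
  rw [Finset.mem_filter, mem_facesOfRank, Finset.mem_singleton]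
  constructor
  · rintro ⟨⟨h1, h2⟩, h3⟩
    by_contra hne
    exact (hG.rk_lt_of_ssubset h1.1 (h3.ssubset_of_ne (Ne.symm hne))).ne h2.symm
  · rintro rfl; exact ⟨⟨hG, rfl⟩, subset_rfl⟩

theorem facesOfRank_filter_superset_of_lt {u : ι → V} {H G : Finset ι} {k : ℕ} (hk : k < rk u G) :
    (facesOfRank u H k).filter (G ⊆ ·) = ∅ := by
  ext F
  rw [Finset.mem_filter, mem_facesOfRank]
  simp only [Finset.notMem_empty, iff_false]
  rintro ⟨⟨_, h2⟩, h3⟩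
  have := rk_mono u h3
  omega

theorem euler_card {u : ι → V} {G H : Finset ι} (hG : IsFaceIn u H G) (hne : G ≠ H) :
    ∑ k ∈ Finset.range (rk u H + 1),
      (-1 : ℤ) ^ k * (((facesOfRank u H k).filter (G ⊆ ·)).card : ℤ) = 0 := by
  rw [← hG.euler hne, ← Finset.sum_fiberwise_of_maps_to (t := Finset.range (rk u H + 1))
    (g := fun F => rk u F)]
  · refine Finset.sum_congr rfl fun k _ => ?_
    rw [Finset.sum_congr rfl (g := fun _ => (-1 : ℤ) ^ k) fun F hF => by
      rw [(Finset.mem_filter.1 hF).2], Finset.sum_const, nsmul_eq_mul, mul_comm]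
    congr 3
    ext F
    simp only [facesOfRank, Finset.mem_filter, Finset.mem_univ, true_and]
    tauto
  · intro F hF
    rw [Finset.mem_range, Nat.lt_succ_iff]
    exact rk_mono u (Finset.mem_filter.1 hF).2.1.1

/-- An interval of length two in the face lattice has exactly two inner elements. -/
theorem card_facesOfRank_diamond {u : ι → V} {G H : Finset ι} (hG : IsFaceIn u H G)
    (hrk : rk u H = rk u G + 2) :
    ((facesOfRank u H (rk u G + 1)).filter (G ⊆ ·)).card = 2 := by
  have hne : G ≠ H := by rintro rfl; omega
  have h := euler_card hG hne
  rw [hrk, Finset.sum_range_succ, Finset.sum_range_succ, Finset.sum_range_succ,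
    Finset.sum_eq_zero, facesOfRank_filter_superset hG, ← hrk, facesOfRank_self,
    Finset.filter_singleton, if_pos hG.1, Finset.card_singleton, Finset.card_singleton, hrk] at h
  · have h2 : ((-1 : ℤ) ^ rk u G) ≠ 0 := pow_ne_zero _ (by norm_num)
    have h3 : (-1 : ℤ) ^ rk u G *
        (2 - (((facesOfRank u H (rk u G + 1)).filter (G ⊆ ·)).card : ℤ)) = 0 := by
      rw [← h]; push_cast; ring
    rcases mul_eq_zero.1 h3 with h4 | h4
    · exact absurd h4 h2
    · omega
  · intro k hk
    rw [facesOfRank_filter_superset_of_lt (Finset.mem_range.1 hk)]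
    simp

/-- Double counting of flags in an interval of rank two. -/
theorem sum_card_facesOfRank {u : ι → V} {H : Finset ι} {k : ℕ} (hrk : rk u H = k + 2)
    {p : Finset ι → Prop} [DecidablePred p] :
    ∑ F ∈ facesOfRank u H (k + 1), ((facesOfRank u F k).filter p).card =
      2 * ((facesOfRank u H k).filter p).card := by
  have h1 : ∀ F ∈ facesOfRank u H (k + 1), (facesOfRank u F k).filter p =
      ((facesOfRank u H k).filter p).filter (· ⊆ F) := by
    intro F hF
    rw [← filter_subset_facesOfRank (mem_facesOfRank.1 hF).1, Finset.filter_comm]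
  rw [Finset.sum_congr rfl fun F hF => by rw [h1 F hF]]
  have := Finset.sum_card_bipartiteAbove_eq_sum_card_bipartiteBelow (s := facesOfRank u H (k + 1))
    (t := (facesOfRank u H k).filter p) fun F G => G ⊆ F
  simp only [Finset.bipartiteAbove, Finset.bipartiteBelow] at this
  rw [this, mul_comm, ← smul_eq_mul, ← Finset.sum_const]
  refine Finset.sum_congr rfl fun G hG => ?_
  obtain ⟨h2, h3⟩ := mem_facesOfRank.1 (Finset.mem_filter.1 hG).1
  subst h3
  exact card_facesOfRank_diamond h2 hrk

theorem facesOfRank_zero {u : ι → V} {H : Finset ι} (h0 : IsFaceIn u H ∅) :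
    facesOfRank u H 0 = {∅} := by
  have := facesOfRank_filter_superset h0
  rwa [rk_empty, Finset.filter_true_of_mem (by simp)] at this

theorem rk_singleton {u : ι → V} (h0 : IsFaceIn u Finset.univ ∅) (i : ι) : rk u {i} = 1 := by
  have h := h0.rk_lt_of_ssubset (Finset.subset_univ {i}) (by simp)
  have := rk_le_card u {i}
  rw [rk_empty] at h
  rw [Finset.card_singleton] at this
  omega

theorem facesOfRank_one {u : ι → V} (h0 : IsFaceIn u Finset.univ ∅)
    (h1 : ∀ i, IsFaceIn u Finset.univ {i}) (H : Finset ι) :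
    facesOfRank u H 1 = H.map ⟨singleton, Finset.singleton_injective⟩ := by
  ext F
  rw [mem_facesOfRank]
  simp only [Finset.mem_map, Function.Embedding.coeFn_mk]
  constructor
  · rintro ⟨h2, h3⟩
    have hne : F.Nonempty := by
      rw [Finset.nonempty_iff_ne_empty]; rintro rfl
      rw [rk_empty] at h3; omega
    obtain ⟨i, hi⟩ := hne
    refine ⟨i, h2.1 hi, ?_⟩
    by_contra hne
    have := (h1 i).rk_lt_of_ssubset (Finset.subset_univ F)
      ((Finset.singleton_subset_iff.2 hi).ssubset_of_ne hne)
    rw [rk_singleton h0] at this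
    omega
  · rintro ⟨i, hi, rfl⟩
    exact ⟨(h1 i).mono (Finset.singleton_subset_iff.2 hi) (Finset.subset_univ _),
      rk_singleton h0 i⟩

theorem card_facesOfRank_one {u : ι → V} (h0 : IsFaceIn u Finset.univ ∅)
    (h1 : ∀ i, IsFaceIn u Finset.univ {i}) (H : Finset ι) : (facesOfRank u H 1).card = H.card := by
  rw [facesOfRank_one h0 h1, Finset.card_map]

/-- This is the diamond property above the empty face. -/
theorem card_of_rk_eq_two {u : ι → V} (h0 : IsFaceIn u Finset.univ ∅)
    (h1 : ∀ i, IsFaceIn u Finset.univ {i}) {H : Finset ι} (h2 : rk u H = 2) : H.card = 2 := by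
  have h0' := h0.mono (Finset.empty_subset H) (Finset.subset_univ _)
  have := card_facesOfRank_diamond h0' (by rw [h2, rk_empty])
  rw [rk_empty, Finset.filter_true_of_mem (by simp), zero_add, card_facesOfRank_one h0 h1] at this
  exact this

theorem euler_card_empty {u : ι → V} (h0 : IsFaceIn u Finset.univ ∅) {H : Finset ι}
    (hne : H.Nonempty) :
    ∑ k ∈ Finset.range (rk u H + 1), (-1 : ℤ) ^ k * ((facesOfRank u H k).card : ℤ) = 0 := by
  have := euler_card (h0.mono (Finset.empty_subset H) (Finset.subset_univ _)) hne.ne_empty.symm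
  simpa using this

/-- The combinatorics of the faces of a convex polygon, in terms of its vertices: `edges` are the
vertex sets of the edges. -/
structure IsPolygonEdges {ν : Type*} [Fintype ν] (edges : Finset (Finset ν)) : Prop where
  card_edge : ∀ e ∈ edges, e.card = 2
  card_edges_at : ∀ v, (edges.filter (v ∈ ·)).card = 2

/-- Rank three leaves only the ranks one, two and three for nonempty faces, and the diamond property
above a vertex gives its two edges. -/
theorem isPolygonEdges_facesOfRank {u : ι → V} (h0 : IsFaceIn u Finset.univ ∅)
    (h1 : ∀ i, IsFaceIn u Finset.univ {i}) (h3 : rk u Finset.univ = 3) :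
    IsPolygonEdges (facesOfRank u Finset.univ 2) ∧
    ∀ F, F.Nonempty → (IsFaceIn u Finset.univ F ↔
      F.card = 1 ∨ F ∈ facesOfRank u Finset.univ 2 ∨ F = Finset.univ) := by
  refine ⟨⟨fun e he => card_of_rk_eq_two h0 h1 (mem_facesOfRank.1 he).2, fun v => ?_⟩,
    fun F hF => ⟨fun h => ?_, ?_⟩⟩
  · have := card_facesOfRank_diamond (h1 v) (by rw [h3, rk_singleton h0])
    rw [rk_singleton h0] at this
    simpa using this
  · have hle : rk u F ≤ 3 := h3 ▸ rk_mono u (Finset.subset_univ F)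
    have hpos : 0 < rk u F := by
      have := h0.rk_lt_of_ssubset (Finset.subset_univ F)
        ((Finset.empty_subset F).ssubset_of_ne hF.ne_empty.symm)
      omega
    interval_cases hr : rk u F
    · left
      have : F ∈ facesOfRank u Finset.univ 1 := mem_facesOfRank.2 ⟨h, hr⟩
      rw [facesOfRank_one h0 h1, Finset.mem_map] at this
      obtain ⟨i, _, rfl⟩ := this
      simp
    · exact Or.inr (Or.inl (mem_facesOfRank.2 ⟨h, hr⟩))
    · right; right
      have : F ∈ facesOfRank u Finset.univ (rk u Finset.univ) :=
        mem_facesOfRank.2 ⟨h, hr.trans h3.symm⟩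
      rw [facesOfRank_self] at this
      exact Finset.mem_singleton.1 this
  · rintro (h | h | rfl)
    · obtain ⟨i, rfl⟩ := Finset.card_eq_one.1 h
      exact h1 i
    · exact (mem_facesOfRank.1 h).1
    · exact IsFaceIn.refl _ _

end FaceCounts

/-! ### Faces of a power of a polytope -/

section Products
variable {E : Type*} [NormedAddCommGroup E] [NormedSpace ℝ E] {ν : Type*} {r : ℕ}

/-- The `r`-fold power of a family of points. -/
def powFamily (q : ν → E) (r : ℕ) (x : Fin r → ν) : Fin r → E := fun i => q (x i)

theorem convexHull_powFamily_image (q : ν → E) (F : Fin r → Finset ν) :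
    convexHull ℝ (powFamily q r '' (Fintype.piFinset F)) =
      {x | ∀ i, x i ∈ convexHull ℝ (q '' F i)} := by
  have h : powFamily q r '' (Fintype.piFinset F) = Set.univ.pi fun i => q '' F i := by
    ext x
    simp only [Set.mem_image, Finset.mem_coe, Fintype.mem_piFinset, Set.mem_pi, Set.mem_univ,
      true_implies]
    constructor
    · rintro ⟨y, hy, rfl⟩ i; exact ⟨y i, hy i, rfl⟩
    · intro h
      choose y hy hy' using h
      exact ⟨y, hy, funext hy'⟩
  rw [h, convexHull_pi]
  ext x
  simp

variable [Fintype ν]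

theorem convexHull_range_powFamily (q : ν → E) (r : ℕ) :
    convexHull ℝ (Set.range (powFamily q r)) = {x | ∀ i, x i ∈ convexHull ℝ (Set.range q)} := by
  have := convexHull_powFamily_image q fun _ : Fin r => Finset.univ
  simpa using this

/-- A linear functional on a product is a sum of functionals of the factors, and it is maximal
exactly where every summand is. Conversely supporting functionals of the factors add up. -/
theorem isFaceIn_powFamily {q : ν → E} {F : Finset (Fin r → ν)} (hne : F.Nonempty) :
    IsFaceIn (homog (powFamily q r)) Finset.univ F ↔
      ∃ F' : Fin r → Finset ν, (∀ i, IsFaceIn (homog q) Finset.univ (F' i) ∧ (F' i).Nonempty) ∧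
        F = Fintype.piFinset F' := by
  constructor
  · intro hF
    obtain ⟨_, l, c, h1, h2⟩ := isFaceIn_homog.1 hF
    have hsum : ∀ y : Fin r → E, l y = ∑ i, l (Pi.single i (y i)) := by
      intro y
      rw [← map_sum, Finset.univ_sum_single]
    have hle : ∀ x, l (powFamily q r x) ≤ c := fun x => by
      by_cases hx : x ∈ F
      · exact (h1 x hx).le
      · exact (h2 x (Finset.mem_univ _) hx).le
    -- Changing one coordinate of a maximizer cannot increase the sum.
    have hmax : ∀ x ∈ F, ∀ i w, l (Pi.single i (q w)) ≤ l (Pi.single i (q (x i))) := by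
      intro x hx i w
      have h3 := hle (Function.update x i w)
      rw [← h1 x hx, hsum, hsum (powFamily q r x), ← Finset.add_sum_erase _ _ (Finset.mem_univ i),
        ← Finset.add_sum_erase (a := i) _ _ (Finset.mem_univ i)] at h3
      rw [Finset.sum_congr rfl (g := fun j => l (Pi.single j (powFamily q r x j))) fun j hj => by
        simp [powFamily, Function.update_of_ne (Finset.ne_of_mem_erase hj)]] at h3
      simpa only [powFamily, Function.update_self, add_le_add_iff_right] using h3
    obtain ⟨x₀, hx₀⟩ := hne
    refine ⟨fun i => Finset.univ.filter fun v => ∀ w, l (Pi.single i (q w)) ≤ l (Pi.single i (q v)),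
      fun i => ⟨?_, ⟨x₀ i, by simpa using hmax x₀ hx₀ i⟩⟩, ?_⟩
    · refine isFaceIn_homog.2 ⟨Finset.subset_univ _, l ∘ₗ LinearMap.single ℝ (fun _ => E) i,
        l (Pi.single i (q (x₀ i))), fun v hv => ?_, fun v _ hv => ?_⟩
      · exact le_antisymm (hmax x₀ hx₀ i v) ((Finset.mem_filter.1 hv).2 _)
      · refine lt_of_le_of_ne (hmax x₀ hx₀ i v) fun h => hv ?_
        simp only [Finset.mem_filter, Finset.mem_univ, true_and]
        intro w
        exact (hmax x₀ hx₀ i w).trans h.ge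
    · ext x
      simp only [Fintype.mem_piFinset, Finset.mem_filter, Finset.mem_univ, true_and]
      refine ⟨fun hx i => hmax x hx i, fun hx => ?_⟩
      by_contra hxF
      have h3 := h2 x (Finset.mem_univ _) hxF
      rw [← h1 x₀ hx₀, hsum, hsum (powFamily q r x₀)] at h3
      exact absurd h3 (not_lt.2 (Finset.sum_le_sum fun i _ => hx i (x₀ i)))
  · rintro ⟨F', hF', rfl⟩
    have := fun i => (isFaceIn_homog.1 (hF' i).1).2
    choose l c h1 h2 using this
    have hle : ∀ i v, l i (q v) ≤ c i := fun i v => by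
      by_cases hv : v ∈ F' i
      · exact (h1 i v hv).le
      · exact (h2 i v (Finset.mem_univ _) hv).le
    refine isFaceIn_homog.2 ⟨Finset.subset_univ _, ∑ i, l i ∘ₗ LinearMap.proj i, ∑ i, c i,
      fun x hx => ?_, fun x _ hx => ?_⟩
    · rw [Fintype.mem_piFinset] at hx
      simp only [LinearMap.coe_sum, Finset.sum_apply, LinearMap.comp_apply, LinearMap.proj_apply]
      exact Finset.sum_congr rfl fun i _ => h1 i _ (hx i)
    · rw [Fintype.mem_piFinset] at hx
      push Not at hx
      obtain ⟨i, hi⟩ := hx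
      simp only [LinearMap.coe_sum, Finset.sum_apply, LinearMap.comp_apply, LinearMap.proj_apply]
      exact Finset.sum_lt_sum (fun i _ => hle i _) ⟨i, Finset.mem_univ _, h2 i _ (Finset.mem_univ _) hi⟩

end Products
end PolygonProducts


namespace PolygonProducts
open Module Submodule
open scoped Classical

/-! ### Combinatorics of products of vertices, edges and polygons -/

section Combinatorics
variable {ν : Type*} [Fintype ν] {r : ℕ} {edges : Finset (Finset ν)}

/-- `F` is a product of vertices, edges and copies of a polygon. -/
def IsProdFace (edges : Finset (Finset ν)) (F : Fin r → Finset ν) : Prop :=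
  ∀ i, (F i).card = 1 ∨ F i ∈ edges ∨ F i = Finset.univ

/-- The number of polygon factors. -/
noncomputable def numPoly (F : Fin r → Finset ν) : ℕ :=
  (Finset.univ.filter fun i => F i = Finset.univ).card

/-- The number of edge factors. -/
noncomputable def numEdge (edges : Finset (Finset ν)) (F : Fin r → Finset ν) : ℕ :=
  (Finset.univ.filter fun i => F i ∈ edges).card

/-- The product of `E` in the factor `j` with the vertices `x i` in the other factors. -/
noncomputable def line (x : Fin r → ν) (j : Fin r) (E : Finset ν) : Finset (Fin r → ν) :=
  Fintype.piFinset (Function.update (fun i => {x i}) j E)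

theorem mem_line {x y : Fin r → ν} {j : Fin r} {E : Finset ν} :
    y ∈ line x j E ↔ y j ∈ E ∧ ∀ i, i ≠ j → y i = x i := by
  rw [line, Fintype.mem_piFinset]
  constructor
  · intro h
    refine ⟨by simpa using h j, fun i hi => ?_⟩
    have := h i
    rwa [Function.update_of_ne hi, Finset.mem_singleton] at this
  · rintro ⟨h1, h2⟩ i
    by_cases hi : i = j
    · subst hi; simpa using h1
    · rw [Function.update_of_ne hi, Finset.mem_singleton]; exact h2 i hi

theorem update_mem_line {x : Fin r → ν} {j : Fin r} {E : Finset ν} {e : ν} (he : e ∈ E) :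
    Function.update x j e ∈ line x j E :=
  mem_line.2 ⟨by simpa using he, fun i hi => Function.update_of_ne hi _ _⟩

theorem line_subset_piFinset {x : Fin r → ν} {j : Fin r} {E : Finset ν} {H : Fin r → Finset ν}
    (hx : x ∈ Fintype.piFinset H) : line x j E ⊆ Fintype.piFinset H ↔ E ⊆ H j := by
  constructor
  · intro h e he
    have := Fintype.mem_piFinset.1 (h (update_mem_line he)) j
    simpa using this
  · intro h y hy
    rw [mem_line] at hy
    rw [Fintype.mem_piFinset] at hx ⊢
    intro i
    by_cases hi : i = j
    · subst hi; exact h hy.1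
    · rw [hy.2 i hi]; exact hx i

theorem line_inj {x : Fin r → ν} {j k : Fin r} {E E' : Finset ν} (hE : 1 < E.card)
    (h : line x j E = line x k E') : j = k ∧ E = E' := by
  obtain ⟨e, he, hne⟩ := Finset.exists_mem_ne hE (x j)
  have hjk : j = k := by
    by_contra hjk
    have h1 : Function.update x j e ∈ line x k E' := h ▸ update_mem_line he
    have h2 := (mem_line.1 h1).2 j hjk
    rw [Function.update_self] at h2
    exact hne h2
  subst hjk
  refine ⟨rfl, ?_⟩
  ext y
  constructor
  · intro hy
    have h1 : Function.update x j y ∈ line x j E' := h ▸ update_mem_line hy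
    simpa using (mem_line.1 h1).1
  · intro hy
    have h1 : Function.update x j y ∈ line x j E := h ▸ update_mem_line hy
    simpa using (mem_line.1 h1).1

theorem card_line (x : Fin r → ν) (j : Fin r) (E : Finset ν) : (line x j E).card = E.card := by
  rw [line, Fintype.card_piFinset, ← Finset.mul_prod_erase _ _ (Finset.mem_univ j),
    Function.update_self, Finset.prod_eq_one, mul_one]
  intro i hi
  rw [Function.update_of_ne (Finset.ne_of_mem_erase hi), Finset.card_singleton]

theorem IsProdFace.nonempty [Nonempty ν] (he : IsPolygonEdges edges) {F : Fin r → Finset ν}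
    (hF : IsProdFace edges F) : (Fintype.piFinset F).Nonempty := by
  rw [Fintype.piFinset_nonempty]
  intro i
  rcases hF i with h | h | h
  · exact Finset.card_pos.1 (by omega)
  · exact Finset.card_pos.1 (by have := he.card_edge _ h; omega)
  · rw [h]; exact Finset.univ_nonempty

theorem IsPolygonEdges.univ_notMem (he : IsPolygonEdges edges) (hn : 3 ≤ Fintype.card ν) :
    Finset.univ ∉ edges := fun h => by
  have := he.card_edge _ h
  rw [Finset.card_univ] at this
  omega

theorem IsPolygonEdges.notMem_of_card_one (he : IsPolygonEdges edges) {F : Finset ν}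
    (h : F.card = 1) : F ∉ edges := fun h' => by
  have := he.card_edge _ h'
  omega

theorem ne_univ_of_card_one {F : Finset ν} (hn : 3 ≤ Fintype.card ν) (h : F.card = 1) :
    F ≠ Finset.univ := by
  rintro rfl
  rw [Finset.card_univ] at h
  omega

theorem IsProdFace.card_piFinset (he : IsPolygonEdges edges) (hn : 3 ≤ Fintype.card ν)
    {F : Fin r → Finset ν} (hF : IsProdFace edges F) :
    (Fintype.piFinset F).card = Fintype.card ν ^ numPoly F * 2 ^ numEdge edges F := by
  have h : ∀ i, (F i).card = (if F i = Finset.univ then Fintype.card ν else 1) *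
      (if F i ∈ edges then 2 else 1) := by
    intro i
    rcases hF i with h | h | h
    · rw [if_neg (ne_univ_of_card_one hn h), if_neg (he.notMem_of_card_one h), h]
    · have h1 : F i ≠ Finset.univ := fun h' => he.univ_notMem hn (h' ▸ h)
      rw [if_neg h1, if_pos h, he.card_edge _ h]
    · rw [if_pos h, h, if_neg (he.univ_notMem hn), Finset.card_univ, mul_one]
  rw [Fintype.card_piFinset, Finset.prod_congr rfl fun i _ => h i, Finset.prod_mul_distrib,
    Finset.prod_ite, Finset.prod_ite]
  simp [numPoly, numEdge]

theorem IsProdFace.line {E : Finset ν} (hE : E.card = 1 ∨ E ∈ edges ∨ E = Finset.univ)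
    (x : Fin r → ν) (j : Fin r) :
    IsProdFace edges (Function.update (fun i => {x i}) j E) := by
  intro i
  by_cases hi : i = j
  · subst hi; simpa using hE
  · left; rw [Function.update_of_ne hi]; simp

theorem eq_line_of_forall {F : Fin r → Finset ν} {x : Fin r → ν} {j : Fin r}
    (hx : x ∈ Fintype.piFinset F) (h : ∀ i, i ≠ j → (F i).card = 1) :
    Fintype.piFinset F = line x j (F j) := by
  have : F = Function.update (fun i => {x i}) j (F j) := by
    funext i
    by_cases hi : i = j
    · subst hi; simp
    · rw [Function.update_of_ne hi]
      obtain ⟨y, hy⟩ := Finset.card_eq_one.1 (h i hi)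
      have := Fintype.mem_piFinset.1 hx i
      rw [hy, Finset.mem_singleton] at this
      rw [hy, this]
  rw [line, ← this]

theorem IsProdFace.eq_line_edge {F : Fin r → Finset ν} (hF : IsProdFace edges F)
    (h0 : numPoly F = 0) (h1 : numEdge edges F = 1) {x : Fin r → ν}
    (hx : x ∈ Fintype.piFinset F) :
    ∃ j, F j ∈ edges ∧ Fintype.piFinset F = PolygonProducts.line x j (F j) := by
  obtain ⟨j, hj⟩ := Finset.card_eq_one.1 h1
  rw [numPoly, Finset.card_eq_zero, Finset.filter_eq_empty_iff] at h0
  have hmem : ∀ i, F i ∈ edges ↔ i = j := fun i => by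
    have := Finset.ext_iff.1 hj i
    simpa using this
  refine ⟨j, (hmem j).2 rfl, eq_line_of_forall hx fun i hi => ?_⟩
  rcases hF i with h | h | h
  · exact h
  · exact absurd ((hmem i).1 h) hi
  · exact absurd h (h0 (Finset.mem_univ i))

theorem IsProdFace.eq_line_univ {F : Fin r → Finset ν} (hF : IsProdFace edges F)
    (h0 : numPoly F = 1) (h1 : numEdge edges F = 0) {x : Fin r → ν}
    (hx : x ∈ Fintype.piFinset F) :
    ∃ j, Fintype.piFinset F = PolygonProducts.line x j Finset.univ := by
  obtain ⟨j, hj⟩ := Finset.card_eq_one.1 h0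
  rw [numEdge, Finset.card_eq_zero, Finset.filter_eq_empty_iff] at h1
  have hmem : ∀ i, F i = Finset.univ ↔ i = j := fun i => by
    have := Finset.ext_iff.1 hj i
    simpa using this
  refine ⟨j, ?_⟩
  rw [← (hmem j).2 rfl]
  refine eq_line_of_forall hx fun i hi => ?_
  rcases hF i with h | h | h
  · exact h
  · exact absurd h (h1 (Finset.mem_univ i))
  · exact absurd ((hmem i).1 h) hi

theorem sum_card_filter_mem {α : Type*} [DecidableEq α] {H : Finset α} {A : Finset (Finset α)}
    (hA : ∀ e ∈ A, e ⊆ H) : ∑ x ∈ H, (A.filter (x ∈ ·)).card = ∑ e ∈ A, e.card := by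
  have := Finset.sum_card_bipartiteAbove_eq_sum_card_bipartiteBelow (s := H) (t := A)
    fun x e => x ∈ e
  simp only [Finset.bipartiteAbove, Finset.bipartiteBelow] at this
  rw [this]
  refine Finset.sum_congr rfl fun e he => ?_
  rw [Finset.filter_mem_eq_inter, Finset.inter_eq_right.2 (hA e he)]

/-- A polygon factor offers two edges through the given vertex, an edge factor only itself, a vertex
factor none. -/
theorem sum_card_edges_at (he : IsPolygonEdges edges) (hn : 3 ≤ Fintype.card ν)
    {H : Fin r → Finset ν} (hH : IsProdFace edges H) {x : Fin r → ν}
    (hx : x ∈ Fintype.piFinset H) :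
    ∑ j, (edges.filter fun E => x j ∈ E ∧ E ⊆ H j).card = 2 * numPoly H + numEdge edges H := by
  have h : ∀ j, (edges.filter fun E => x j ∈ E ∧ E ⊆ H j).card =
      2 * (if H j = Finset.univ then 1 else 0) + (if H j ∈ edges then 1 else 0) := by
    intro j
    have hxj := Fintype.mem_piFinset.1 hx j
    rcases hH j with h | h | h
    · rw [if_neg (ne_univ_of_card_one hn h), if_neg (he.notMem_of_card_one h),
        Finset.card_eq_zero, Finset.filter_eq_empty_iff]
      rintro E hE ⟨_, h2⟩
      have h3 := Finset.card_le_card h2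
      rw [he.card_edge E hE, h] at h3
      omega
    · have h1 : H j ≠ Finset.univ := fun h' => he.univ_notMem hn (h' ▸ h)
      rw [if_neg h1, if_pos h, mul_zero, zero_add, Finset.card_eq_one]
      refine ⟨H j, ?_⟩
      ext E
      rw [Finset.mem_filter, Finset.mem_singleton]
      constructor
      · rintro ⟨hE, _, h2⟩
        exact Finset.eq_of_subset_of_card_le h2 (by rw [he.card_edge _ h, he.card_edge _ hE])
      · rintro rfl; exact ⟨h, hxj, subset_rfl⟩
    · rw [if_pos h, h, if_neg (he.univ_notMem hn), ← he.card_edges_at (x j)]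
      simp
  rw [Finset.sum_congr rfl fun j _ => h j, Finset.sum_add_distrib, ← Finset.mul_sum,
    numPoly, numEdge, Finset.card_filter, Finset.card_filter]

/-- The second factor on the left must be positive, which for `n ≥ 4` forces `a ≤ 1` and leaves few
`b`. The last two solutions have only four vertices and are discarded in `face_rank_four`. -/
theorem facet_type_of_eq {a b n : ℕ} (hn : 4 ≤ n)
    (h : ((n : ℤ) ^ a * 2 ^ b) * (n * (4 - 3 * a - b) + 4 * a) = 8 * n) :
    (a = 1 ∧ b = 1) ∨ (a = 0 ∧ b = 3) ∨ (a = 0 ∧ b = 2) ∨ (a = 1 ∧ b = 0 ∧ n = 4) := by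
  have hn' : (4 : ℤ) ≤ n := by exact_mod_cast hn
  have hpos : (0 : ℤ) < (n : ℤ) ^ a * 2 ^ b := by positivity
  have hpos2 : 0 < (n : ℤ) * (4 - 3 * a - b) + 4 * a := by
    by_contra hc
    nlinarith
  have ha : a ≤ 1 := by
    by_contra hc
    have : (2 : ℤ) ≤ a := by exact_mod_cast not_le.1 hc
    have hb : (0 : ℤ) ≤ b := by positivity
    nlinarith
  interval_cases a
  · have hb : b < 4 := by
      by_contra hc
      have : (4 : ℤ) ≤ b := by exact_mod_cast not_lt.1 hc
      simp only [Nat.cast_zero] at hpos2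
      nlinarith
    interval_cases b <;> simp at h ⊢ <;> omega
  · have hb : b < 2 := by
      by_contra hc
      have : (2 : ℤ) ≤ b := by exact_mod_cast not_lt.1 hc
      simp only [Nat.cast_one] at hpos2
      nlinarith
    interval_cases b
    · right; right; right
      have : (n : ℤ) * (n + 4 - 8) = 0 := by simp at h; linarith
      rcases mul_eq_zero.1 this with h' | h' <;> simp <;> omega
    · left; simp

end Combinatorics

/-! ### Face numbers of a projected product -/

section SurvivingFamilies
variable {V : Type*} [AddCommGroup V] [Module ℝ V]
variable {ν : Type*} [Fintype ν] {r : ℕ} {edges : Finset (Finset ν)}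

/-- The faces of the cone over a projected product of polygons all of whose polygon `2`-faces
survive the projection. -/
structure IsSurvivingFamily (edges : Finset (Finset ν)) (u : (Fin r → ν) → V) : Prop where
  polygon : IsPolygonEdges edges
  card : 4 ≤ Fintype.card ν
  empty : IsFaceIn u Finset.univ ∅
  prod : ∀ F, IsFaceIn u Finset.univ F → F.Nonempty →
    ∃ F', IsProdFace edges F' ∧ F = Fintype.piFinset F'
  edge : ∀ x j, ∀ E ∈ edges, IsFaceIn u Finset.univ (line x j E)
  poly : ∀ x j, IsFaceIn u Finset.univ (line x j Finset.univ)
  vertex : ∀ x, IsFaceIn u Finset.univ {x}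

/-- `F` is the vertex set of a polygon `2`-face of a product of polygons. -/
def IsPolyLine (F : Finset (Fin r → ν)) : Prop := ∃ x j, F = line x j Finset.univ

namespace IsSurvivingFamily
variable {u : (Fin r → ν) → V} [FiniteDimensional ℝ V]

theorem three_le (h : IsSurvivingFamily edges u) : 3 ≤ Fintype.card ν := by
  have := h.card; omega

theorem rk_edge (h : IsSurvivingFamily edges u) (x : Fin r → ν) (j : Fin r) {E : Finset ν}
    (hE : E ∈ edges) (hxE : x j ∈ E) : rk u (line x j E) = 2 := by
  have hc : (line x j E).card = 2 := by rw [card_line, h.polygon.card_edge E hE]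
  have h1 := rk_le_card u (line x j E)
  have hx : x ∈ line x j E := mem_line.2 ⟨hxE, fun _ _ => rfl⟩
  have h2 := (h.vertex x).rk_lt_of_ssubset (Finset.subset_univ (line x j E))
    ((Finset.singleton_subset_iff.2 hx).ssubset_of_ne (by
      intro h'; rw [← h', Finset.card_singleton] at hc; omega))
  rw [rk_singleton h.empty] at h2
  omega

theorem exists_edge_at (h : IsSurvivingFamily edges u) (v : ν) : ∃ E ∈ edges, v ∈ E := by
  have h1 := h.polygon.card_edges_at v
  obtain ⟨E, hE⟩ := Finset.card_pos.1 (h1 ▸ two_pos)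
  exact ⟨E, (Finset.mem_filter.1 hE).1, (Finset.mem_filter.1 hE).2⟩

/-- The polygon properly contains an edge of rank two. If its rank exceeded three, some face would
lie strictly between the edge and the polygon, but no product of vertices, edges and polygons does.
-/
theorem rk_poly (h : IsSurvivingFamily edges u) (x : Fin r → ν) (j : Fin r) :
    rk u (line x j Finset.univ) = 3 := by
  obtain ⟨E, hE, hxE⟩ := h.exists_edge_at (x j)
  have hsub : line x j E ⊆ line x j Finset.univ := fun y hy =>
    mem_line.2 ⟨Finset.mem_univ _, (mem_line.1 hy).2⟩
  have hne : line x j E ≠ line x j Finset.univ := by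
    intro h'
    have h1 := congrArg Finset.card h'
    rw [card_line, card_line, h.polygon.card_edge E hE, Finset.card_univ] at h1
    have := h.card
    omega
  have hr := h.rk_edge x j hE hxE
  have h1 := (h.edge x j E hE).rk_lt_of_ssubset (Finset.subset_univ _) (hsub.ssubset_of_ne hne)
  by_contra hne3
  obtain ⟨F, hF, h2, h3⟩ := ((h.edge x j E hE).mono hsub (Finset.subset_univ _)).exists_between
    (by omega)
  have hxF : x ∈ F := h2.1 (mem_line.2 ⟨hxE, fun _ _ => rfl⟩)
  obtain ⟨F', hF', rfl⟩ := h.prod F ((h.poly x j).trans hF) ⟨x, hxF⟩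
  have hEF : E ⊆ F' j := (line_subset_piFinset hxF).1 h2.1
  have hF1 : ∀ i, i ≠ j → (F' i).card = 1 := by
    intro i hi
    rw [Finset.card_eq_one]
    refine ⟨x i, Finset.eq_singleton_iff_unique_mem.2 ⟨Fintype.mem_piFinset.1 hxF i, ?_⟩⟩
    intro y hy
    have h5 : Function.update x i y ∈ Fintype.piFinset F' := by
      rw [Fintype.mem_piFinset] at hxF ⊢
      intro k
      by_cases hk : k = i
      · subst hk; simpa using hy
      · rw [Function.update_of_ne hk]; exact hxF k
    simpa using (mem_line.1 (h3.1 h5)).2 i hi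
  have hFl := eq_line_of_forall hxF hF1
  rw [hFl] at h2 h3
  rcases hF' j with h5 | h5 | h5
  · have := Finset.card_le_card hEF
    rw [h.polygon.card_edge E hE] at this
    omega
  · have : E = F' j := Finset.eq_of_subset_of_card_le hEF (by
      rw [h.polygon.card_edge _ h5, h.polygon.card_edge _ hE])
    rw [← this] at h2
    exact h2.ne rfl
  · rw [h5] at h3
    exact h3.ne rfl

/-- Such a face has two vertices, and `n^a 2^b = 2` with `n ≥ 4` forces `a = 0` and `b = 1`. -/
theorem face_rank_two (h : IsSurvivingFamily edges u) {F : Finset (Fin r → ν)}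
    (hF : IsFaceIn u Finset.univ F) (hrk : rk u F = 2) {x : Fin r → ν} (hx : x ∈ F) :
    ∃ j, ∃ E ∈ edges, x j ∈ E ∧ F = line x j E := by
  obtain ⟨F', hF', rfl⟩ := h.prod F hF ⟨x, hx⟩
  have h1 := card_of_rk_eq_two h.empty h.vertex hrk
  rw [hF'.card_piFinset h.polygon h.three_le] at h1
  have h4 := h.card
  have ha : numPoly F' = 0 := by
    by_contra hc
    have h2 : Fintype.card ν ∣ 2 := h1 ▸ (dvd_pow_self _ hc).mul_right _
    have := Nat.le_of_dvd two_pos h2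
    omega
  have hb : numEdge edges F' = 1 := by
    rw [ha, pow_zero, one_mul] at h1
    exact Nat.pow_right_injective le_rfl (by simpa using h1)
  obtain ⟨j, hj, hl⟩ := hF'.eq_line_edge ha hb hx
  exact ⟨j, F' j, hj, Fintype.mem_piFinset.1 hx j, hl⟩

/-- Vertex–edge incidences are counted in two ways. The edges of the projected face at a vertex are
exactly those of the product, as all of these survive. -/
theorem two_mul_card_edges (h : IsSurvivingFamily edges u) {H : Fin r → Finset ν}
    (hH : IsProdFace edges H) (hface : IsFaceIn u Finset.univ (Fintype.piFinset H)) :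
    2 * (facesOfRank u (Fintype.piFinset H) 2).card =
      (Fintype.piFinset H).card * (2 * numPoly H + numEdge edges H) := by
  have h1 := sum_card_filter_mem (H := Fintype.piFinset H)
    (A := facesOfRank u (Fintype.piFinset H) 2) fun e he => (mem_facesOfRank.1 he).1.1
  rw [Finset.sum_congr rfl (g := fun _ => 2) fun e he =>
    card_of_rk_eq_two h.empty h.vertex (mem_facesOfRank.1 he).2, Finset.sum_const, smul_eq_mul,
    mul_comm] at h1
  rw [← h1, ← smul_eq_mul, ← Finset.sum_const]
  refine Finset.sum_congr rfl fun x hx => ?_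
  rw [← sum_card_edges_at h.polygon h.three_le hH hx, ← Finset.card_sigma]
  symm
  refine Finset.card_bij (fun p _ => line x p.1 p.2) ?_ ?_ ?_
  · rintro ⟨j, E⟩ hp
    simp only [Finset.mem_sigma, Finset.mem_univ, true_and, Finset.mem_filter] at hp
    rw [Finset.mem_filter, mem_facesOfRank]
    exact ⟨⟨(h.edge x j E hp.1).mono ((line_subset_piFinset hx).2 hp.2.2) (Finset.subset_univ _),
      h.rk_edge x j hp.1 hp.2.1⟩, mem_line.2 ⟨hp.2.1, fun _ _ => rfl⟩⟩
  · rintro ⟨j, E⟩ hp ⟨k, E'⟩ _ heq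
    simp only [Finset.mem_sigma, Finset.mem_univ, true_and, Finset.mem_filter] at hp
    obtain ⟨rfl, rfl⟩ := line_inj (by rw [h.polygon.card_edge E hp.1]; omega) heq
    rfl
  · intro F hF
    rw [Finset.mem_filter, mem_facesOfRank] at hF
    obtain ⟨j, E, hE, hxE, rfl⟩ := h.face_rank_two (hface.trans hF.1.1) hF.1.2 hF.2
    refine ⟨⟨j, E⟩, ?_, rfl⟩
    simp only [Finset.mem_sigma, Finset.mem_univ, true_and, Finset.mem_filter]
    exact ⟨hE, hxE, (line_subset_piFinset hx).1 hF.1.1.1⟩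

/-- Incidences of vertices and polygon `2`-faces: each vertex lies in one polygon for every polygon
factor of `H`. -/
theorem card_mul_card_polys (h : IsSurvivingFamily edges u) {H : Fin r → Finset ν} :
    Fintype.card ν * ((facesOfRank u (Fintype.piFinset H) 3).filter IsPolyLine).card =
      (Fintype.piFinset H).card * numPoly H := by
  have h1 := sum_card_filter_mem (H := Fintype.piFinset H)
    (A := (facesOfRank u (Fintype.piFinset H) 3).filter IsPolyLine)
    fun e he => (mem_facesOfRank.1 (Finset.mem_filter.1 he).1).1.1
  have h0 : ∀ e ∈ (facesOfRank u (Fintype.piFinset H) 3).filter IsPolyLine,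
      e.card = Fintype.card ν := by
    intro e he
    obtain ⟨x, j, rfl⟩ := (Finset.mem_filter.1 he).2
    rw [card_line, Finset.card_univ]
  rw [Finset.sum_congr rfl h0, Finset.sum_const, smul_eq_mul, mul_comm] at h1
  rw [← h1, ← smul_eq_mul, ← Finset.sum_const]
  refine Finset.sum_congr rfl fun x hx => ?_
  symm
  refine Finset.card_bij (fun j _ => line x j Finset.univ) ?_ ?_ ?_
  · intro j hj
    rw [Finset.mem_filter] at hj
    rw [Finset.mem_filter, Finset.mem_filter, mem_facesOfRank]
    exact ⟨⟨⟨(h.poly x j).mono ((line_subset_piFinset hx).2 (by rw [hj.2]))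
      (Finset.subset_univ _), h.rk_poly x j⟩, x, j, rfl⟩,
      mem_line.2 ⟨Finset.mem_univ _, fun _ _ => rfl⟩⟩
  · intro j _ k _ heq
    exact (line_inj (by rw [Finset.card_univ]; have := h.card; omega) heq).1
  · intro F hF
    rw [Finset.mem_filter, Finset.mem_filter, mem_facesOfRank] at hF
    obtain ⟨⟨⟨hF1, hF2⟩, y, j, rfl⟩, hxF⟩ := hF
    have hl : line y j Finset.univ = line x j Finset.univ := by
      ext z
      rw [mem_line] at hxF
      rw [mem_line, mem_line]
      refine and_congr_right fun _ => forall₂_congr fun i hi => ?_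
      rw [hxF.2 i hi]
    rw [hl] at hF1
    exact ⟨j, Finset.mem_filter.2 ⟨Finset.mem_univ _,
      Finset.univ_subset_iff.1 ((line_subset_piFinset hx).1 hF1.1)⟩, hl.symm⟩

theorem card_edges_of_rk_three (h : IsSurvivingFamily edges u) {F : Finset (Fin r → ν)}
    (hrk : rk u F = 3) : (facesOfRank u F 2).card = F.card := by
  have hne : F.Nonempty := by
    rw [Finset.nonempty_iff_ne_empty]; rintro rfl
    rw [rk_empty] at hrk; omega
  have h1 := euler_card_empty h.empty hne
  have h2 := facesOfRank_self u F
  rw [hrk] at h1 h2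
  rw [Finset.sum_range_succ, Finset.sum_range_succ, Finset.sum_range_succ, Finset.sum_range_one,
    facesOfRank_zero (h.empty.mono (Finset.empty_subset _) (Finset.subset_univ _)),
    card_facesOfRank_one h.empty h.vertex, h2] at h1
  simp at h1
  omega

/-- A two-dimensional face has as many edges as vertices; comparison with the vertex degrees gives
`2a + b = 2`. -/
theorem face_rank_three (h : IsSurvivingFamily edges u) {F : Fin r → Finset ν}
    (hF : IsProdFace edges F) (hface : IsFaceIn u Finset.univ (Fintype.piFinset F))
    (hrk : rk u (Fintype.piFinset F) = 3) :
    (numPoly F = 1 ∧ numEdge edges F = 0) ∨ (numPoly F = 0 ∧ numEdge edges F = 2) := by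
  have : Nonempty ν := Fintype.card_pos_iff.1 (by have := h.card; omega)
  have h1 := h.two_mul_card_edges hF hface
  rw [h.card_edges_of_rk_three hrk, mul_comm] at h1
  have h2 := Nat.eq_of_mul_eq_mul_left (Finset.card_pos.2 (hF.nonempty h.polygon)) h1
  omega

theorem card_face_rank_three (h : IsSurvivingFamily edges u) {F : Finset (Fin r → ν)}
    (hF : IsFaceIn u Finset.univ F) (hrk : rk u F = 3) :
    F.card = if IsPolyLine F then Fintype.card ν else 4 := by
  split_ifs with hp
  · obtain ⟨x, j, rfl⟩ := hp
    rw [card_line, Finset.card_univ]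
  · have hne : F.Nonempty := by
      rw [Finset.nonempty_iff_ne_empty]; rintro rfl
      rw [rk_empty] at hrk; omega
    obtain ⟨x, hx⟩ := hne
    obtain ⟨F', hF', rfl⟩ := h.prod F hF ⟨x, hx⟩
    rcases h.face_rank_three hF' hF hrk with h1 | h1
    · obtain ⟨j, hj⟩ := hF'.eq_line_univ h1.1 h1.2 hx
      exact absurd ⟨x, j, hj⟩ hp
    · rw [hF'.card_piFinset h.polygon h.three_le, h1.1, h1.2]; norm_num

/-- The first equation counts edges of the facet through its `2`-faces, each edge lying in two of
them; the second is Euler's `v - e + f = 2`. -/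
theorem facet_equations (h : IsSurvivingFamily edges u) {H : Finset (Fin r → ν)}
    (hface : IsFaceIn u Finset.univ H) (hrk : rk u H = 4) :
    2 * (facesOfRank u H 2).card =
      Fintype.card ν * ((facesOfRank u H 3).filter IsPolyLine).card +
        4 * ((facesOfRank u H 3).filter fun F => ¬IsPolyLine F).card ∧
    H.card + ((facesOfRank u H 3).filter IsPolyLine).card +
      ((facesOfRank u H 3).filter fun F => ¬IsPolyLine F).card =
        (facesOfRank u H 2).card + 2 := by
  constructor
  · have h1 := sum_card_facesOfRank (k := 2) hrk (p := fun _ => True)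
    rw [Finset.filter_true_of_mem (by simp)] at h1
    rw [← h1, Finset.sum_congr rfl (g := fun F => if IsPolyLine F then Fintype.card ν else 4),
      Finset.sum_ite, Finset.sum_const, Finset.sum_const]
    · simp only [smul_eq_mul]; ring
    · intro F hF
      obtain ⟨h2, h3⟩ := mem_facesOfRank.1 hF
      rw [Finset.filter_true_of_mem (by simp), h.card_edges_of_rk_three h3,
        h.card_face_rank_three (hface.trans h2) h3]
  · have hne : H.Nonempty := by
      rw [Finset.nonempty_iff_ne_empty]; rintro rfl
      rw [rk_empty] at hrk; omega
    have h1 := euler_card_empty h.empty hne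
    have h2 := facesOfRank_self u H
    rw [hrk] at h1 h2
    rw [Finset.sum_range_succ, Finset.sum_range_succ, Finset.sum_range_succ, Finset.sum_range_succ,
      Finset.sum_range_one,
      facesOfRank_zero (h.empty.mono (Finset.empty_subset _) (Finset.subset_univ _)),
      card_facesOfRank_one h.empty h.vertex, h2,
      ← Finset.card_filter_add_card_filter_not (s := facesOfRank u H 3) IsPolyLine] at h1
    simp at h1
    omega

/-- The facets are prisms over polygons, or cubes. -/
theorem face_rank_four (h : IsSurvivingFamily edges u) {H : Fin r → Finset ν}
    (hH : IsProdFace edges H) (hface : IsFaceIn u Finset.univ (Fintype.piFinset H))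
    (hrk : rk u (Fintype.piFinset H) = 4) :
    (numPoly H = 1 ∧ numEdge edges H = 1) ∨ (numPoly H = 0 ∧ numEdge edges H = 3) := by
  obtain ⟨h1, h2⟩ := h.facet_equations hface hrk
  have h3 := h.two_mul_card_edges hH hface
  have h4 := h.card_mul_card_polys (H := H)
  have hv := hH.card_piFinset h.polygon h.three_le
  have hn := h.card
  -- A `2`-face has at least four vertices and is a proper subset, so `v > 4`; this excludes the
  -- spurious solutions of the equation below.
  have hbig : ∀ F ∈ facesOfRank u (Fintype.piFinset H) 3, 4 < (Fintype.piFinset H).card := by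
    intro F hF
    obtain ⟨h5, h6⟩ := mem_facesOfRank.1 hF
    have h7 := h.card_face_rank_three (hface.trans h5) h6
    have h8 : F ≠ Fintype.piFinset H := by rintro rfl; omega
    have h9 := Finset.card_lt_card (h5.1.ssubset_of_ne h8)
    split_ifs at h7 <;> omega
  have hex : 4 < (Fintype.piFinset H).card := by
    by_cases hemp : facesOfRank u (Fintype.piFinset H) 3 = ∅
    · rw [hemp, Finset.filter_empty, Finset.filter_empty, Finset.card_empty] at h1 h2
      have h5 := rk_le_card u (Fintype.piFinset H)
      omega
    · obtain ⟨F, hF⟩ := Finset.nonempty_iff_ne_empty.2 hemp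
      exact hbig F hF
  set e := (facesOfRank u (Fintype.piFinset H) 2).card
  set p := ((facesOfRank u (Fintype.piFinset H) 3).filter IsPolyLine).card
  set q := ((facesOfRank u (Fintype.piFinset H) 3).filter fun F => ¬IsPolyLine F).card
  set v := (Fintype.piFinset H).card
  set n := Fintype.card ν
  set a := numPoly H
  set b := numEdge edges H
  have hvz : (v : ℤ) = (n : ℤ) ^ a * 2 ^ b := by exact_mod_cast hv
  have e1 : (2 * e : ℤ) = n * p + 4 * q := by exact_mod_cast h1
  have e2 : (v + p + q : ℤ) = e + 2 := by exact_mod_cast h2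
  have e3 : (2 * e : ℤ) = v * (2 * a + b) := by exact_mod_cast h3
  have e4 : (n * p : ℤ) = v * a := by exact_mod_cast h4
  -- Elimination of `e`, `p` and `q` from the four linear relations.
  have key : ((n : ℤ) ^ a * 2 ^ b) * (n * (4 - 3 * a - b) + 4 * a) = 8 * n := by
    rw [← hvz]
    linear_combination (4 * n : ℤ) * e2 + (n : ℤ) * e1 + (n : ℤ) * e3 + (n - 4 : ℤ) * e4
  rcases facet_type_of_eq hn key with h5 | h5 | h5 | h5
  · exact Or.inl h5
  · exact Or.inr h5
  · rw [h5.1, h5.2] at hv; norm_num at hv; omega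
  · rw [h5.1, h5.2.1, h5.2.2] at hv; norm_num at hv; omega

theorem isProdFace_univ : IsProdFace edges (fun _ : Fin r => (Finset.univ : Finset ν)) :=
  fun _ => Or.inr (Or.inr rfl)

theorem numPoly_univ : numPoly (fun _ : Fin r => (Finset.univ : Finset ν)) = r := by
  simp [numPoly]

/-- The rank is at least that of a polygon face. Rank three or four would make the whole product a
face with at most one polygon factor, whereas it has `r ≥ 2` of them. -/
theorem rk_univ (h : IsSurvivingFamily edges u) (hr : 2 ≤ r) (hV : finrank ℝ V ≤ 5) :
    rk u Finset.univ = 5 := by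
  have hle : rk u Finset.univ ≤ 5 := (Submodule.finrank_le _).trans hV
  obtain ⟨v⟩ : Nonempty ν := Fintype.card_pos_iff.1 (by have := h.card; omega)
  have hge := rk_mono u (Finset.subset_univ (line (fun _ => v) (⟨0, by omega⟩ : Fin r) Finset.univ))
  rw [h.rk_poly] at hge
  have hu : Fintype.piFinset (fun _ : Fin r => (Finset.univ : Finset ν)) = Finset.univ :=
    Fintype.piFinset_univ
  have hf := IsFaceIn.refl u Finset.univ
  interval_cases hk : rk u Finset.univ
  · have := h.face_rank_three isProdFace_univ (by rw [hu]; exact hf) (by rw [hu]; exact hk)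
    rw [numPoly_univ] at this
    omega
  · have := h.face_rank_four isProdFace_univ (by rw [hu]; exact hf) (by rw [hu]; exact hk)
    rw [numPoly_univ] at this
    rcases this with h1 | h1
    · omega
    · omega
  · rfl

/-- The face numbers of a projected product of `n`-gons. -/
theorem card_facesOfRank_univ (h : IsSurvivingFamily edges u) (hr : 2 ≤ r)
    (hV : finrank ℝ V ≤ 5) :
    (facesOfRank u Finset.univ 1).card = Fintype.card ν ^ r ∧
    (facesOfRank u Finset.univ 2).card = r * Fintype.card ν ^ r ∧
    4 * (facesOfRank u Finset.univ 3).card + 6 * Fintype.card ν ^ r =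
      5 * (r * Fintype.card ν ^ r) + 4 * (r * Fintype.card ν ^ (r - 1)) ∧
    4 * (facesOfRank u Finset.univ 4).card + 2 * Fintype.card ν ^ r =
      r * Fintype.card ν ^ r + 4 * (r * Fintype.card ν ^ (r - 1)) := by
  have hrk := h.rk_univ hr hV
  have hn := h.card
  have hu : Fintype.piFinset (fun _ : Fin r => (Finset.univ : Finset ν)) = Finset.univ :=
    Fintype.piFinset_univ
  have hf := IsFaceIn.refl u Finset.univ
  have hcard : (Finset.univ : Finset (Fin r → ν)).card = Fintype.card ν ^ r := by
    simp
  have f0 : (facesOfRank u Finset.univ 1).card = Fintype.card ν ^ r := by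
    rw [card_facesOfRank_one h.empty h.vertex, hcard]
  have hE0 : numEdge edges (fun _ : Fin r => (Finset.univ : Finset ν)) = 0 := by
    simp [numEdge, h.polygon.univ_notMem h.three_le]
  have f1 : (facesOfRank u Finset.univ 2).card = r * Fintype.card ν ^ r := by
    have := h.two_mul_card_edges isProdFace_univ (by rw [hu]; exact hf)
    rw [hu, numPoly_univ, hE0, hcard] at this
    nlinarith
  have hP := h.card_mul_card_polys (H := fun _ => Finset.univ)
  rw [hu, numPoly_univ, hcard] at hP
  set P := ((facesOfRank u Finset.univ 3).filter IsPolyLine).card 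
  set q := ((facesOfRank u Finset.univ 3).filter fun F => ¬IsPolyLine F).card 
  have hPval : P = r * Fintype.card ν ^ (r - 1) := by
    obtain ⟨s, rfl⟩ : ∃ s, r = s + 1 := ⟨r - 1, by omega⟩
    rw [pow_succ] at hP
    rw [Nat.add_sub_cancel]
    refine Nat.eq_of_mul_eq_mul_left (show 0 < Fintype.card ν by omega) ?_
    rw [hP]; ring
  have hPq : (facesOfRank u Finset.univ 3).card = P + q :=
    (Finset.card_filter_add_card_filter_not _).symm
  -- This predicate separates the prisms, with two polygons and `n` quadrilaterals, from the cubes,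
  -- with six quadrilaterals. For `n = 4` it is the position in the product that tells a polygon
  -- face from a quadrilateral.
  let pr : Finset (Fin r → ν) → Prop := fun H => (facesOfRank u H 3).filter IsPolyLine ≠ ∅
  have hfacet : ∀ H ∈ facesOfRank u Finset.univ 4,
      ((facesOfRank u H 3).filter IsPolyLine).card = (if pr H then 2 else 0) ∧
      ((facesOfRank u H 3).filter fun F => ¬IsPolyLine F).card =
        (if pr H then Fintype.card ν else 6) := by
    intro H hH
    obtain ⟨hH1, hH2⟩ := mem_facesOfRank.1 hH
    have hne : H.Nonempty := by
      rw [Finset.nonempty_iff_ne_empty]; rintro rfl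
      rw [rk_empty] at hH2; omega
    obtain ⟨H', hH', rfl⟩ := h.prod H hH1 hne
    have h1 := (h.facet_equations hH1 hH2).1
    have h2 := h.card_mul_card_polys (H := H')
    have h3 := h.two_mul_card_edges hH' hH1
    have h4 := hH'.card_piFinset h.polygon h.three_le
    have hpr : pr (Fintype.piFinset H') ↔
        ((facesOfRank u (Fintype.piFinset H') 3).filter IsPolyLine).card ≠ 0 := by
      simp only [pr, ne_eq, Finset.card_eq_zero]
    rcases h.face_rank_four hH' hH1 hH2 with ⟨ha, hb⟩ | ⟨ha, hb⟩
    · rw [ha, hb] at h4 h3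
      rw [ha] at h2
      rw [h4] at h2 h3
      have h5 : ((facesOfRank u (Fintype.piFinset H') 3).filter IsPolyLine).card = 2 :=
        Nat.eq_of_mul_eq_mul_left (show 0 < Fintype.card ν by omega) (by rw [h2]; ring)
      have hp : pr (Fintype.piFinset H') := hpr.2 (by rw [h5]; omega)
      rw [h5] at h1
      rw [if_pos hp, if_pos hp]
      rw [pow_one, pow_one] at h3
      refine ⟨h5, ?_⟩
      omega
    · rw [ha, hb] at h4 h3
      rw [ha, mul_zero] at h2
      have h5 := (Nat.mul_eq_zero.1 h2).resolve_left (by omega)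
      have hp : ¬pr (Fintype.piFinset H') := fun h' => hpr.1 h' h5
      rw [h5] at h1
      rw [if_neg hp, if_neg hp]
      refine ⟨h5, ?_⟩
      rw [pow_zero, one_mul] at h4
      omega
  -- Every `2`-face lies in two facets. For the polygons this says that the number `α` of prisms is
  -- `P`, for the quadrilaterals that `2q = nα + 6κ` with `κ` the number of cubes; Euler's relation
  -- then determines `q` and `κ`.
  have s1 : ∑ H ∈ facesOfRank u Finset.univ 4, ((facesOfRank u H 3).filter IsPolyLine).card =
    2 * P := sum_card_facesOfRank hrk
  have s2 : ∑ H ∈ facesOfRank u Finset.univ 4,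
    ((facesOfRank u H 3).filter fun F => ¬IsPolyLine F).card = 2 * q := sum_card_facesOfRank hrk
  rw [Finset.sum_congr rfl fun H hH => (hfacet H hH).1, Finset.sum_ite, Finset.sum_const,
    Finset.sum_const] at s1
  rw [Finset.sum_congr rfl fun H hH => (hfacet H hH).2, Finset.sum_ite, Finset.sum_const,
    Finset.sum_const] at s2
  simp only [smul_eq_mul] at s1 s2
  have h34 := Finset.card_filter_add_card_filter_not (s := facesOfRank u Finset.univ 4) pr
  set α := ((facesOfRank u Finset.univ 4).filter pr).card
  set κ := ((facesOfRank u Finset.univ 4).filter fun H => ¬pr H).card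
  have hα : α = P := by omega
  have hE := euler_card_empty h.empty (H := Finset.univ) (by
    rw [← Finset.card_pos, hcard]; exact pow_pos (by omega) _)
  have hself := facesOfRank_self u Finset.univ
  rw [hrk] at hE hself
  rw [Finset.sum_range_succ, Finset.sum_range_succ, Finset.sum_range_succ, Finset.sum_range_succ,
    Finset.sum_range_succ, Finset.sum_range_one, facesOfRank_zero h.empty, f0, f1, hPq, ← h34,
    hself] at hE
  simp only [Finset.card_singleton] at hE
  rw [f1, f0, hPq, ← h34, ← hPval, hα]
  have hnP : α * Fintype.card ν = r * Fintype.card ν ^ r := by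
    rw [hα, mul_comm, hP, mul_comm]
  rw [hα] at hE
  refine ⟨rfl, rfl, ?_, ?_⟩
  · push_cast at hE
    zify at hnP s2 ⊢
    linarith
  · push_cast at hE
    zify at hnP s2 ⊢
    linarith

end IsSurvivingFamily
end SurvivingFamilies
end PolygonProducts


namespace PolygonProducts
open Module Submodule
open scoped Classical

/-! ### Surviving faces under a linear projection -/

section Projection
variable {E E' : Type*} [NormedAddCommGroup E] [NormedSpace ℝ E] [NormedAddCommGroup E']
  [NormedSpace ℝ E']

theorem exists_smul_sub_of_mem_vectorSpan {C : Set E} (hC : Convex ℝ C) (hne : C.Nonempty) {d : E}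
    (hd : d ∈ vectorSpan ℝ C) : ∃ t : ℝ, 0 < t ∧ ∃ x ∈ C, ∃ y ∈ C, d = t • (x - y) := by
  rw [vectorSpan] at hd
  induction hd using span_induction with
  | mem d hd =>
    obtain ⟨x, hx, y, hy, rfl⟩ := hd
    exact ⟨1, one_pos, x, hx, y, hy, by simp⟩
  | zero =>
    obtain ⟨x, hx⟩ := hne
    exact ⟨1, one_pos, x, hx, x, hx, by simp⟩
  | add a b _ _ ha hb =>
    obtain ⟨t, ht, x, hx, y, hy, rfl⟩ := ha
    obtain ⟨s, hs, x', hx', y', hy', rfl⟩ := hb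
    have hts : t + s ≠ 0 := by positivity
    refine ⟨t + s, by positivity, (t / (t + s)) • x + (s / (t + s)) • x',
      hC hx hx' (by positivity) (by positivity) (by field_simp),
      (t / (t + s)) • y + (s / (t + s)) • y',
      hC hy hy' (by positivity) (by positivity) (by field_simp), ?_⟩
    simp only [smul_sub, smul_add, smul_smul, mul_div_cancel₀ _ hts]
    abel
  | smul c a _ ha =>
    obtain ⟨t, ht, x, hx, y, hy, rfl⟩ := ha
    rcases lt_trichotomy c 0 with hc | rfl | hc
    · refine ⟨-c * t, by nlinarith, y, hy, x, hx, ?_⟩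
      rw [smul_smul, ← neg_sub y x, smul_neg, ← neg_smul]; ring_nf
    · exact ⟨1, one_pos, x, hx, x, hx, by simp⟩
    · exact ⟨c * t, by positivity, x, hx, y, hy, by rw [smul_smul]⟩

/-- A map injective on a convex set is injective on its direction space, whose elements are
multiples of differences of points of the set. A left inverse there transports `l` to the image. -/
theorem exists_comp_eq_of_injOn {C : Set E} (hC : Convex ℝ C) (hne : C.Nonempty) (π : E →ₗ[ℝ] E')
    (hπ : Set.InjOn π C) (l : E →ₗ[ℝ] ℝ) :
    ∃ l' : E' →ₗ[ℝ] ℝ, ∀ x ∈ C, ∀ y ∈ C, l' (π x) - l' (π y) = l x - l y := by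
  have hker : LinearMap.ker (π.domRestrict (vectorSpan ℝ C)) = ⊥ := by
    rw [LinearMap.ker_eq_bot']
    rintro ⟨d, hd⟩ h0
    obtain ⟨t, ht, x, hx, y, hy, rfl⟩ := exists_smul_sub_of_mem_vectorSpan hC hne hd
    have h1 : π (t • (x - y)) = 0 := h0
    rw [map_smul, map_sub, smul_eq_zero, sub_eq_zero] at h1
    have := hπ hx hy (h1.resolve_left ht.ne')
    simp [this]
  obtain ⟨g, hg⟩ := LinearMap.exists_leftInverse_of_injective _ hker
  refine ⟨l ∘ₗ (vectorSpan ℝ C).subtype ∘ₗ g, fun x hx y hy => ?_⟩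
  have h1 : g (π (x - y)) = ⟨x - y, vsub_mem_vectorSpan ℝ hx hy⟩ :=
    LinearMap.congr_fun hg ⟨x -ᵥ y, vsub_mem_vectorSpan ℝ hx hy⟩
  rw [← map_sub, ← map_sub, ← map_sub]
  change l ((vectorSpan ℝ C).subtype (g (π (x - y)))) = l (x - y)
  rw [h1]
  rfl

variable {ι : Type*}

theorem IsFaceIn.of_comp {p : ι → E} {π : E →ₗ[ℝ] E'} {H F : Finset ι}
    (h : IsFaceIn (homog (π ∘ p)) H F) : IsFaceIn (homog p) H F := by
  obtain ⟨h1, l, c, h2, h3⟩ := isFaceIn_homog.1 h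
  exact isFaceIn_homog.2 ⟨h1, l ∘ₗ π, c, h2, h3⟩

variable [Fintype ι]

/-- A supporting functional of `F` descends to the image of `L` by injectivity, so `F` becomes a
face of a face. Thus edges and vertices survive together with their polygon. -/
theorem IsFaceIn.comp_of_injOn {p : ι → E} {π : E →ₗ[ℝ] E'} {L F : Finset ι}
    (hinj : Set.InjOn π (convexHull ℝ (p '' L)))
    (hL : IsFaceIn (homog (π ∘ p)) Finset.univ L) (hF : IsFaceIn (homog p) Finset.univ F)
    (hne : F.Nonempty) (hFL : F ⊆ L) : IsFaceIn (homog (π ∘ p)) Finset.univ F := by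
  obtain ⟨i₀, hi₀⟩ := hne
  obtain ⟨_, l, c, h2, h3⟩ := isFaceIn_homog.1 hF
  have hmem : ∀ i ∈ L, p i ∈ convexHull ℝ (p '' L) := fun i hi =>
    subset_convexHull _ _ ⟨i, hi, rfl⟩
  obtain ⟨l', hl'⟩ := exists_comp_eq_of_injOn (convex_convexHull ℝ (p '' L))
    ⟨_, hmem i₀ (hFL hi₀)⟩ π hinj l
  refine hL.trans (isFaceIn_homog.2 ⟨hFL, l', l' (π (p i₀)), fun i hi => ?_, fun i hi hiF => ?_⟩)
  · have h4 := hl' _ (hmem i (hFL hi)) _ (hmem i₀ (hFL hi₀))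
    rw [h2 i hi, h2 i₀ hi₀] at h4
    simp only [Function.comp_apply]
    linarith
  · have h4 := hl' _ (hmem i hi) _ (hmem i₀ (hFL hi₀))
    have h5 := h3 i (Finset.mem_univ _) hiF
    rw [h2 i₀ hi₀] at h4
    simp only [Function.comp_apply]
    linarith

/-- The last clause of survival ensures that no further vertex is mapped into the image of the face,
so the index set does not grow. -/
theorem isFaceIn_of_survives [FiniteDimensional ℝ E] {p : ι → E} {π : E →ₗ[ℝ] E'} {L : Finset ι}
    (hL : IsFaceIn (homog p) Finset.univ L)
    (h : Survives π (convexHull ℝ (Set.range p)) (convexHull ℝ (p '' L))) :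
    IsFaceIn (homog (π ∘ p)) Finset.univ L := by
  obtain ⟨h1, _, h3⟩ := h
  have h1' := h1
  rw [π.image_convexHull, π.image_convexHull, ← Set.range_comp, ← Set.image_comp] at h1
  have := (eq_convexHull_idx h1).1
  convert this
  ext i
  rw [mem_idx, Set.image_comp, ← π.image_convexHull]
  conv_lhs => rw [← hL.isExposed.2, mem_idx, ← h3]
  have : p i ∈ convexHull ℝ (Set.range p) := subset_convexHull _ _ ⟨i, rfl⟩
  simp [this]

end Projection

/-! ### The `f`-vector and the fatness -/

section SurvivingProducts

theorem exists_family_of_isPolygon {n : ℕ} (hn : 1 ≤ n) {Q : Set (Fin 2 → ℝ)}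
    (hQ : IsPolygon n Q) :
    ∃ (ν : Type) (_ : Fintype ν) (q : ν → Fin 2 → ℝ), Q = convexHull ℝ (Set.range q) ∧
      (∀ v, IsFaceIn (homog q) Finset.univ {v}) ∧ rk (homog q) Finset.univ = 3 ∧
      Fintype.card ν = n := by
  obtain ⟨h1, h2, h3⟩ := hQ
  obtain ⟨hfin, hQv, hexp⟩ := extremePoints_of_isPolytope h1
  have := hfin.fintype
  have hr : Set.range (Subtype.val : Set.extremePoints ℝ Q → Fin 2 → ℝ) =
      Set.extremePoints ℝ Q := Subtype.range_coe
  have hQ' : Q = convexHull ℝ (Set.range (Subtype.val : Set.extremePoints ℝ Q → Fin 2 → ℝ)) := by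
    rw [hr]; exact hQv
  have hsing : ∀ v, IsFaceIn (homog (Subtype.val : Set.extremePoints ℝ Q → Fin 2 → ℝ))
      Finset.univ {v} := by
    rintro ⟨v, hv⟩
    have h4 := hexp v hv
    rw [hQ'] at h4
    convert (eq_convexHull_idx h4).1
    ext w
    rw [mem_idx, Finset.mem_singleton, Set.mem_singleton_iff, Subtype.ext_iff]
  have hcard : Fintype.card (Set.extremePoints ℝ Q) = n := by
    rw [← h3]
    conv_rhs => rw [hQ']
    rw [fNumber_convexHull, ← Finset.card_univ,
      ← card_facesOfRank_one (isFaceIn_homog_empty _ _) hsing]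
    rfl
  refine ⟨Set.extremePoints ℝ Q, this, Subtype.val, hQ', hsing, ?_, hcard⟩
  rw [← affDim_convexHull_add_one, Finset.coe_univ, Set.image_univ, ← hQ', h2]
  rw [Finset.univ_nonempty_iff, ← Fintype.card_pos_iff]
  omega

/-- Functionals on the image pull back, so faces of the image are faces of the product. In the other
direction the polygons survive by hypothesis, and all edges and vertices lie in polygons. -/
theorem exists_isSurvivingFamily {r n : ℕ} (hr : 2 ≤ r) (hn : 4 ≤ n) {P : Set (Fin (2 * r) → ℝ)}
    (hP : IsSurvivingPolygonProduct r n hr P) :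
    ∃ (ν : Type) (_ : Fintype ν) (edges : Finset (Finset ν)) (w : (Fin r → ν) → Fin 4 → ℝ),
      Fintype.card ν = n ∧ lastFour r hr '' P = convexHull ℝ (Set.range w) ∧
      IsSurvivingFamily edges (homog w) := by
  obtain ⟨hPp, Q, hQ, Φ, hsurv⟩ := hP
  obtain ⟨ν, _, q, rfl, hsing, hrk, hcard⟩ := exists_family_of_isPolygon (by omega) hQ
  obtain ⟨hE, hface⟩ := isPolygonEdges_facesOfRank (isFaceIn_homog_empty q _) hsing hrk
  have hν : Nonempty ν := Fintype.card_pos_iff.1 (by omega)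
  have hr0 : 0 < r := by omega
  have hS : polygonPower (convexHull ℝ (Set.range q)) r =
      convexHull ℝ (Set.range (powFamily q r)) := (convexHull_range_powFamily q r).symm
  revert Φ
  rw [hS]
  intro Φ hsurv
  have hprod : ∀ F : Fin r → Finset ν, IsProdFace (facesOfRank (homog q) Finset.univ 2) F →
      IsFaceIn (homog (powFamily q r)) Finset.univ (Fintype.piFinset F) := by
    intro F hF
    have hne := hF.nonempty hE
    refine (isFaceIn_powFamily hne).2 ⟨F, fun i => ?_, rfl⟩
    have hi := Fintype.piFinset_nonempty.1 hne i
    exact ⟨(hface _ hi).2 (hF i), hi⟩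
  have hvert : ∀ x : Fin r → ν, IsFaceIn (homog (powFamily q r)) Finset.univ {x} := by
    intro x
    have := hprod (fun i => {x i}) fun i => Or.inl (by simp)
    rwa [Fintype.piFinset_singleton] at this
  obtain ⟨p, rfl, hpface, hΦ⟩ := exists_family_of_orderIso hvert hPp Φ
  have hline : ∀ x j, IsFaceIn (homog p) Finset.univ (line x j (Finset.univ : Finset ν)) ∧
      Survives (lastFour r hr) (convexHull ℝ (Set.range p))
        (convexHull ℝ (p '' (line x j (Finset.univ : Finset ν)))) := by
    intro x j
    have h1 := hprod _ (IsProdFace.line (Or.inr (Or.inr rfl)) x j)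
    obtain ⟨h2, h3⟩ := h1.isExposed
    refine ⟨(hpface _).2 h1, ?_⟩
    have h4 := hsurv ⟨_, h2⟩ ⟨j, fun i => q (x i), fun i => ?_, ?_⟩
    · rw [hΦ] at h4
      simp only [h3] at h4
      exact h4
    · have := (hsing (x i)).isExposed.1
      rw [Finset.coe_singleton, Set.image_singleton, convexHull_singleton] at this
      exact exposedPoints_subset_extremePoints (mem_exposedPoints_iff_exposed_singleton.2 this)
    · simp only
      rw [convexHull_powFamily_image]
      ext y
      simp only [Set.mem_ofPred_eq]
      constructor
      · intro h
        refine ⟨by simpa using h j, fun i hi => ?_⟩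
        have := h i
        rw [Function.update_of_ne hi] at this
        simpa using this
      · rintro ⟨h5, h6⟩ i
        by_cases hi : i = j
        · subst hi; simpa using h5
        · rw [Function.update_of_ne hi]; simp [h6 i hi]
  have hpoly : ∀ x j, IsFaceIn (homog (lastFour r hr ∘ p)) Finset.univ
      (line x j (Finset.univ : Finset ν)) := fun x j =>
    isFaceIn_of_survives (hline x j).1 (hline x j).2
  have hsub : ∀ (x : Fin r → ν) (j : Fin r) (E : Finset ν), E.card = 1 ∨
      E ∈ facesOfRank (homog q) Finset.univ 2 → IsFaceIn (homog (lastFour r hr ∘ p)) Finset.univ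
        (line x j E) := by
    intro x j E hE'
    have h5 : IsProdFace (facesOfRank (homog q) Finset.univ 2)
      (Function.update (fun i => {x i}) j E) := IsProdFace.line (hE'.imp_right Or.inl) x j
    exact IsFaceIn.comp_of_injOn (hline x j).2.2.1 (hpoly x j) ((hpface _).2 (hprod _ h5))
      (h5.nonempty hE) fun y hy => mem_line.2 ⟨Finset.mem_univ _, (mem_line.1 hy).2⟩
  refine ⟨ν, inferInstance, facesOfRank (homog q) Finset.univ 2, lastFour r hr ∘ p, hcard, ?_, hE,
    by omega, isFaceIn_homog_empty _ _, ?_, fun x j E hE' => hsub x j E (Or.inr hE'), hpoly, ?_⟩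
  · rw [LinearMap.image_convexHull, ← Set.range_comp]
  · intro F hF hne
    obtain ⟨F', hF', rfl⟩ := (isFaceIn_powFamily hne).1 ((hpface F).1 hF.of_comp)
    exact ⟨F', fun i => (hface _ (hF' i).2).1 (hF' i).1, rfl⟩
  · intro x
    convert hsub x ⟨0, hr0⟩ {x ⟨0, hr0⟩} (Or.inl (by simp))
    ext y
    rw [mem_line, Finset.mem_singleton, Finset.mem_singleton]
    constructor
    · rintro rfl; exact ⟨rfl, fun _ _ => rfl⟩
    · rintro ⟨h1, h2⟩
      funext i
      by_cases hi : i = ⟨0, hr0⟩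
      · rw [hi, h1]
      · exact h2 i hi

/-- The `f`-vector of a projected product of polygons. -/
theorem fVector_of_isSurvivingPolygonProduct {r n : ℕ} (hr : 2 ≤ r) (hn : 4 ≤ n)
    {P : Set (Fin (2 * r) → ℝ)} (hP : IsSurvivingPolygonProduct r n hr P) :
    IsFourPolytope (lastFour r hr '' P) ∧
      (fNumber (lastFour r hr '' P) 0 : ℝ) = (n : ℝ) ^ r ∧
      (fNumber (lastFour r hr '' P) 1 : ℝ) = (r : ℝ) * (n : ℝ) ^ r ∧
      (fNumber (lastFour r hr '' P) 2 : ℝ) =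
        5 / 4 * (r : ℝ) * (n : ℝ) ^ r - 3 / 2 * (n : ℝ) ^ r + (r : ℝ) * (n : ℝ) ^ (r - 1) ∧
      (fNumber (lastFour r hr '' P) 3 : ℝ) =
        1 / 4 * (r : ℝ) * (n : ℝ) ^ r - 1 / 2 * (n : ℝ) ^ r + (r : ℝ) * (n : ℝ) ^ (r - 1) := by
  obtain ⟨ν, _, edges, w, hcard, himg, hw⟩ := exists_isSurvivingFamily hr hn hP
  have hfin : finrank ℝ ((Fin 4 → ℝ) × ℝ) ≤ 5 := by simp
  obtain ⟨v⟩ : Nonempty ν := Fintype.card_pos_iff.1 (by omega)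
  have hrk := hw.rk_univ hr hfin
  obtain ⟨h0, h1, h2, h3⟩ := hw.card_facesOfRank_univ hr hfin
  rw [hcard] at h0 h1 h2 h3
  have hf : ∀ k, fNumber (lastFour r hr '' P) k =
      (facesOfRank (homog w) Finset.univ (k + 1)).card := by
    intro k
    rw [himg, fNumber_convexHull]
    rfl
  refine ⟨⟨⟨_, Set.finite_range w, himg.symm⟩, ?_⟩, ?_, ?_, ?_, ?_⟩
  · have := affDim_convexHull_add_one (p := w) (F := Finset.univ) ⟨fun _ => v, Finset.mem_univ _⟩
    rw [hrk, Finset.coe_univ, Set.image_univ, ← himg] at this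
    omega
  · rw [hf, h0]; push_cast; rfl
  · rw [hf, h1]; push_cast; rfl
  · rw [hf]
    have : (4 * (facesOfRank (homog w) Finset.univ 3).card + 6 * (n : ℝ) ^ r : ℝ) =
      5 * (r * (n : ℝ) ^ r) + 4 * (r * (n : ℝ) ^ (r - 1)) := by exact_mod_cast h2
    linarith
  · rw [hf]
    have : (4 * (facesOfRank (homog w) Finset.univ 4).card + 2 * (n : ℝ) ^ r : ℝ) =
      r * (n : ℝ) ^ r + 4 * (r * (n : ℝ) ^ (r - 1)) := by exact_mod_cast h3
    linarith

theorem abs_fatness_sub_nine_le {r n : ℕ} (hr : 2 ≤ r) (hn : 4 ≤ n)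
    {P : Set (Fin (2 * r) → ℝ)} (hP : IsSurvivingPolygonProduct r n hr P) :
    |fatness (lastFour r hr '' P) - 9| ≤ 24 / r + 32 / n := by
  obtain ⟨_, h0, h1, h2, h3⟩ := fVector_of_isSurvivingPolygonProduct hr hn hP
  unfold fatness
  rw [h0, h1, h2, h3]
  obtain ⟨s, rfl⟩ : ∃ s, r = s + 2 := ⟨r - 2, by omega⟩
  have hn' : (4 : ℝ) ≤ n := by exact_mod_cast hn
  have hr' : (2 : ℝ) ≤ ((s + 2 : ℕ) : ℝ) := by exact_mod_cast hr
  have hB : (4 : ℝ) ≤ (n : ℝ) ^ (s + 1) := by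
    calc (4 : ℝ) ≤ n := hn'
      _ ≤ (n : ℝ) ^ (s + 1) := le_self_pow₀ (by linarith) (by omega)
  rw [show s + 2 - 1 = s + 1 from rfl, show (n : ℝ) ^ (s + 2) = n * (n : ℝ) ^ (s + 1) by ring]
  generalize (n : ℝ) ^ (s + 1) = B at *
  generalize ((s + 2 : ℕ) : ℝ) = R at *
  generalize (n : ℝ) = m at *
  have hA : 16 ≤ m * B := by nlinarith
  have hRB : 8 ≤ R * B := by nlinarith
  have hden : R * (m * B) / 4 ≤ m * B + (1 / 4 * R * (m * B) - 1 / 2 * (m * B) + R * B) - 10 := by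
    linarith
  have hpos : 0 < R * (m * B) / 4 := by positivity
  have hden' := hpos.trans_le hden
  rw [div_sub' hden'.ne', abs_div, abs_of_pos hden', div_le_iff₀ hden']
  -- The main terms cancel: `f₁ + f₂ - 20 - 9 (f₀ + f₃ - 10) = 70 - 6mB - 8RB`, and the constant is
  -- absorbed by `hA` and `hRB`.
  calc |_| ≤ 6 * (m * B) + 8 * (R * B) := by
        rw [abs_le]; constructor <;> linarith
    _ = (24 / R + 32 / m) * (R * (m * B) / 4) := by field_simp; ring
    _ ≤ _ := mul_le_mul_of_nonneg_left hden (by positivity)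

end SurvivingProducts
end PolygonProducts


namespace PolygonProducts
open Module Submodule
open scoped Classical Topology

/-! ### Polyhedra through their sets of tight inequalities -/

section Polyhedra
variable {E : Type*} [NormedAddCommGroup E] [NormedSpace ℝ E]
  {M : Type*} [Fintype M]

/-- The polyhedron `a m x ≤ b m`. -/
def polyhedron (a : M → E →ₗ[ℝ] ℝ) (b : M → ℝ) : Set E := {x | ∀ m, a m x ≤ b m}

/-- The set of inequalities that are tight at `x`. -/
noncomputable def active (a : M → E →ₗ[ℝ] ℝ) (b : M → ℝ) (x : E) : Finset M :=
  Finset.univ.filter fun m => a m x = b m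

/-- The points of a polyhedron at which the inequalities in `I` are tight. -/
def tightFace (a : M → E →ₗ[ℝ] ℝ) (b : M → ℝ) (I : Finset M) : Set E :=
  {x | x ∈ polyhedron a b ∧ I ⊆ active a b x}

variable {a : M → E →ₗ[ℝ] ℝ} {b : M → ℝ}

theorem mem_active {x : E} {m : M} : m ∈ active a b x ↔ a m x = b m := by simp [active]

theorem convex_polyhedron (a : M → E →ₗ[ℝ] ℝ) (b : M → ℝ) : Convex ℝ (polyhedron a b) := by
  have : polyhedron a b = ⋂ m, {x | a m x ≤ b m} := by ext; simp [polyhedron]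
  rw [this]
  exact convex_iInter fun m => convex_halfSpace_le (a m).isLinear _

theorem midpoint_mem_polyhedron [DecidableEq M] {x y : E} (hx : x ∈ polyhedron a b) (hy : y ∈ polyhedron a b) :
    (2⁻¹ : ℝ) • x + (2⁻¹ : ℝ) • y ∈ polyhedron a b ∧
      active a b ((2⁻¹ : ℝ) • x + (2⁻¹ : ℝ) • y) = active a b x ∩ active a b y := by
  refine ⟨convex_polyhedron a b hx hy (by norm_num) (by norm_num) (by norm_num), ?_⟩
  ext m
  rw [Finset.mem_inter, mem_active, mem_active, mem_active]
  have h1 := hx m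
  have h2 := hy m
  simp only [map_add, map_smul, smul_eq_mul]
  constructor
  · intro h; constructor <;> linarith
  · rintro ⟨h3, h4⟩; linarith

/-- The midpoint of two points has the intersection of their tight sets, so a minimal tight set is
contained in all others. -/
theorem exists_min_active {X : Set E} (hX : X ⊆ polyhedron a b) (hconv : Convex ℝ X)
    (hne : X.Nonempty) : ∃ x ∈ X, ∀ y ∈ X, active a b x ⊆ active a b y := by
  obtain ⟨I, ⟨x, hx, rfl⟩, hmin⟩ := exists_minimal_of_wellFoundedLT
    (fun I => ∃ x ∈ X, active a b x = I) ⟨_, hne.some, hne.some_mem, rfl⟩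
  refine ⟨x, hx, fun y hy => ?_⟩
  have hz := (midpoint_mem_polyhedron (hX hx) (hX hy)).2
  have := hmin ⟨_, hconv hx hy (by norm_num) (by norm_num) (by norm_num), hz⟩
    Finset.inter_subset_left
  exact this.trans Finset.inter_subset_right

/-- The segment from `y` can be prolonged beyond `x`: inequalities tight at `x` are tight all along
the line, and the others have slack at `x`. -/
theorem exists_add_smul_sub_mem {x y : E} (hx : x ∈ polyhedron a b)
    (hxy : active a b x ⊆ active a b y) : ∃ t : ℝ, 0 < t ∧ x + t • (x - y) ∈ polyhedron a b := by
  have h : ∀ᶠ t : ℝ in 𝓝[>] 0, ∀ m, a m (x + t • (x - y)) ≤ b m := by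
    rw [Filter.eventually_all]
    intro m
    have hval : ∀ t : ℝ, a m (x + t • (x - y)) = a m x + t * (a m x - a m y) := fun t => by simp
    simp only [hval]
    by_cases hm : m ∈ active a b x
    · rw [mem_active.1 hm, mem_active.1 (hxy hm)]
      simp
    · have hlt : a m x < b m := lt_of_le_of_ne (hx m) fun h => hm (mem_active.2 h)
      have hc : Filter.Tendsto (fun t : ℝ => a m x + t * (a m x - a m y)) (𝓝[>] 0)
          (𝓝 (a m x + 0 * (a m x - a m y))) :=
        (Continuous.tendsto (by fun_prop) 0).mono_left nhdsWithin_le_nhds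
      rw [zero_mul, add_zero] at hc
      exact (hc.eventually (eventually_lt_nhds hlt)).mono fun _ => le_of_lt
  obtain ⟨t, ht, h0⟩ := (h.and self_mem_nhdsWithin).exists
  exact ⟨t, h0, ht⟩

/-- `x` is interior to a segment of the polyhedron ending in `y`, and a linear functional maximal at
such a point is constant on the segment. -/
theorem mem_of_active_subset {X : Set E} (hX : IsExposed ℝ (polyhedron a b) X) {x y : E}
    (hx : x ∈ X) (hy : y ∈ polyhedron a b) (hxy : active a b x ⊆ active a b y) : y ∈ X := by
  obtain ⟨l, rfl⟩ := hX ⟨x, hx⟩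
  obtain ⟨t, ht, hm⟩ := exists_add_smul_sub_mem hx.1 hxy
  refine ⟨hy, fun z hz => (hx.2 z hz).trans ?_⟩
  have := hx.2 _ hm
  simp only [map_add, map_smul, map_sub, smul_eq_mul] at this
  nlinarith

theorem eq_of_active_subset {x y : E} (hx : x ∈ Set.extremePoints ℝ (polyhedron a b))
    (hy : y ∈ polyhedron a b) (hxy : active a b x ⊆ active a b y) : x = y := by
  rw [mem_extremePoints] at hx
  obtain ⟨t, ht, hm⟩ := exists_add_smul_sub_mem hx.1 hxy
  refine (hx.2 _ hm y hy ⟨1 / (1 + t), t / (1 + t), by positivity, by positivity,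
    by field_simp, ?_⟩).2.symm
  rw [smul_add, smul_smul, smul_sub]
  have h1 : (1 / (1 + t)) • x + ((1 / (1 + t) * t) • x - (1 / (1 + t) * t) • y) +
      (t / (1 + t)) • y = (1 / (1 + t) + 1 / (1 + t) * t) • x +
        (t / (1 + t) - 1 / (1 + t) * t) • y := by
    simp only [add_smul, sub_smul]; abel
  rw [h1]
  have h2 : 1 / (1 + t) + 1 / (1 + t) * t = 1 := by field_simp
  have h3 : t / (1 + t) - 1 / (1 + t) * t = 0 := by field_simp; ring
  rw [h2, h3]; simp

/-- Extreme points are determined by their tight sets, so there are finitely many of them, and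
Krein–Milman applies. -/
theorem isPolytope_polyhedron [FiniteDimensional ℝ E] (hb : Bornology.IsBounded (polyhedron a b)) :
    IsPolytope (polyhedron a b) := by
  have hcl : IsClosed (polyhedron a b) := by
    have : polyhedron a b = ⋂ m, {x | a m x ≤ b m} := by ext; simp [polyhedron]
    rw [this]
    exact isClosed_iInter fun m =>
      isClosed_le (LinearMap.continuous_of_finiteDimensional (a m)) continuous_const
  have := FiniteDimensional.proper ℝ E
  have hfin : (Set.extremePoints ℝ (polyhedron a b)).Finite := by
    refine Set.Finite.of_finite_image (f := active a b) (Set.toFinite _) ?_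
    intro x hx y hy hxy
    exact eq_of_active_subset hx hy.1 hxy.le
  have hKM := closure_convexHull_extremePoints (Metric.isCompact_of_isClosed_isBounded hcl hb)
    (convex_polyhedron a b)
  rw [(hfin.isClosed_convexHull ℝ).closure_eq] at hKM
  exact ⟨_, hfin, hKM⟩

theorem isExposed_tightFace [FiniteDimensional ℝ E] {x : E} (hx : x ∈ polyhedron a b) :
    IsExposed ℝ (polyhedron a b) (tightFace a b (active a b x)) := by
  intro _
  refine ⟨LinearMap.toContinuousLinearMap (∑ m ∈ active a b x, a m), ?_⟩
  ext y
  simp only [LinearMap.coe_toContinuousLinearMap', Set.mem_ofPred_eq, tightFace,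
    LinearMap.coe_sum, Finset.sum_apply]
  refine and_congr_right fun hy => ⟨fun h z hz => ?_, fun h m hm => ?_⟩
  · refine Finset.sum_le_sum fun m hm => ?_
    rw [mem_active.1 (h hm)]
    exact hz m
  · rw [mem_active]
    by_contra hne
    have := Finset.sum_lt_sum (fun m _ => hy m) ⟨m, hm, lt_of_le_of_ne (hy m) hne⟩
    refine absurd (h x hx) (not_le.2 (this.trans_le (Finset.sum_le_sum fun m hm => ?_)))
    rw [mem_active.1 hm]

theorem exists_eq_tightFace {X : Set E} (hX : IsExposed ℝ (polyhedron a b) X) (hne : X.Nonempty) :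
    ∃ x ∈ X, X = tightFace a b (active a b x) := by
  obtain ⟨x, hx, hmin⟩ := exists_min_active hX.subset (hX.convex (convex_polyhedron a b)) hne
  refine ⟨x, hx, Set.Subset.antisymm (fun y hy => ⟨hX.subset hy, hmin y hy⟩) ?_⟩
  rintro y ⟨hy, hxy⟩
  exact mem_of_active_subset hX hx hy hxy

section FaceLatticeIso
variable {E' : Type*} [NormedAddCommGroup E'] [NormedSpace ℝ E'] [FiniteDimensional ℝ E]
  [FiniteDimensional ℝ E'] {a' : M → E' →ₗ[ℝ] ℝ} {b' : M → ℝ}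

/-- The map of face lattices between polyhedra with the same sets of tight inequalities. -/
def faceMap (h : ∀ x ∈ polyhedron a b, ∃ x' ∈ polyhedron a' b', active a' b' x' = active a b x)
    (X : FaceLattice (polyhedron a b)) : FaceLattice (polyhedron a' b') :=
  ⟨{x' | x' ∈ polyhedron a' b' ∧ ∃ x ∈ X.1, active a b x ⊆ active a' b' x'}, by
    rcases X.1.eq_empty_or_nonempty with h0 | hne
    · simp only [h0, Set.mem_empty_iff_false, false_and, exists_false, and_false]
      exact isExposed_empty
    · obtain ⟨x, hx, hX⟩ := exists_eq_tightFace X.2 hne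
      obtain ⟨x', hx', hxx'⟩ := h x (X.2.subset hx)
      convert isExposed_tightFace hx' using 1
      ext y
      refine and_congr_right fun hy => ⟨?_, fun hy' => ⟨x, hx, hxx' ▸ hy'⟩⟩
      rintro ⟨z, hz, hzy⟩
      rw [hX] at hz
      rw [hxx']
      exact hz.2.trans hzy⟩

theorem faceMap_mono
    (h : ∀ x ∈ polyhedron a b, ∃ x' ∈ polyhedron a' b', active a' b' x' = active a b x)
    {X Y : FaceLattice (polyhedron a b)} (hXY : X ≤ Y) : faceMap h X ≤ faceMap h Y := by
  rintro x' ⟨hx', x, hx, hxx'⟩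
  exact ⟨hx', x, hXY hx, hxx'⟩

theorem faceMap_faceMap
    (h : ∀ x ∈ polyhedron a b, ∃ x' ∈ polyhedron a' b', active a' b' x' = active a b x)
    (h' : ∀ x' ∈ polyhedron a' b', ∃ x ∈ polyhedron a b, active a b x = active a' b' x')
    (X : FaceLattice (polyhedron a b)) : faceMap h' (faceMap h X) = X := by
  refine Subtype.ext (Set.Subset.antisymm ?_ fun x hx => ?_)
  · rintro y ⟨hy, x', ⟨hx', x, hx, hxx'⟩, hy'⟩
    exact mem_of_active_subset X.2 hx hy (hxx'.trans hy')
  · obtain ⟨x', hx', hxx'⟩ := h x (X.2.subset hx)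
    exact ⟨X.2.subset hx, x', ⟨hx', x, hx, hxx'.ge⟩, hxx'.le⟩

/-- Polyhedra with the same sets of tight inequalities have isomorphic face lattices. -/
def faceLatticeIso
    (h : ∀ x ∈ polyhedron a b, ∃ x' ∈ polyhedron a' b', active a' b' x' = active a b x)
    (h' : ∀ x' ∈ polyhedron a' b', ∃ x ∈ polyhedron a b, active a b x = active a' b' x') :
    FaceLattice (polyhedron a b) ≃o FaceLattice (polyhedron a' b') where
  toFun := faceMap h
  invFun := faceMap h'
  left_inv := faceMap_faceMap h h'
  right_inv := faceMap_faceMap h' h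
  map_rel_iff' := by
    intro X Y
    refine ⟨fun hXY => ?_, faceMap_mono h⟩
    have := faceMap_mono h' hXY
    change faceMap h' (faceMap h X) ≤ faceMap h' (faceMap h Y) at this
    rwa [faceMap_faceMap h h', faceMap_faceMap h h'] at this

theorem faceLatticeIso_tightFace
    (h : ∀ x ∈ polyhedron a b, ∃ x' ∈ polyhedron a' b', active a' b' x' = active a b x)
    (h' : ∀ x' ∈ polyhedron a' b', ∃ x ∈ polyhedron a b, active a b x = active a' b' x')
    {x : E} (hx : x ∈ polyhedron a b) {X : FaceLattice (polyhedron a b)}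
    (hX : X.1 = tightFace a b (active a b x)) :
    (faceLatticeIso h h' X).1 = tightFace a' b' (active a b x) := by
  ext y
  refine and_congr_right fun hy => ⟨?_, fun hy' => ⟨x, ?_, hy'⟩⟩
  · rintro ⟨z, hz, hzy⟩
    rw [hX] at hz
    exact hz.2.trans hzy
  · rw [hX]
    exact ⟨hx, subset_rfl⟩

/-- A face survives a projection if the normal vectors of the facets that contain it positively
span the dual of the kernel. -/
theorem survives_tightFace {π : E →ₗ[ℝ] E'} {x₀ : E} (hx₀ : x₀ ∈ polyhedron a b) {I : Finset M}
    (hI : active a b x₀ = I) {w : M → ℝ} (hw : ∀ m ∈ I, 0 < w m) {ψ : E' →ₗ[ℝ] ℝ}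
    (hψ : ∀ x, ∑ m ∈ I, w m * a m x = ψ (π x))
    (hinj : ∀ d, π d = 0 → (∀ m ∈ I, a m d = 0) → d = 0) :
    Survives π (polyhedron a b) (tightFace a b I) := by
  -- The positive combination of the tight inequalities has maximum `c`, attained exactly on the
  -- face. It factors through `π`, so `ψ` exposes the image of the face and only the face lies above
  -- it.
  set c := ∑ m ∈ I, w m * b m with hc
  have hle : ∀ x ∈ polyhedron a b, ψ (π x) ≤ c := by
    intro x hx
    rw [← hψ]
    exact Finset.sum_le_sum fun m hm => mul_le_mul_of_nonneg_left (hx m) (hw m hm).le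
  have heq : ∀ x ∈ polyhedron a b, ψ (π x) = c ↔ x ∈ tightFace a b I := by
    intro x hx
    rw [← hψ]
    constructor
    · intro h
      refine ⟨hx, fun m hm => mem_active.2 ?_⟩
      by_contra hne
      have := Finset.sum_lt_sum (fun m hm => mul_le_mul_of_nonneg_left (hx m) (hw m hm).le)
        ⟨m, hm, mul_lt_mul_of_pos_left (lt_of_le_of_ne (hx m) hne) (hw m hm)⟩
      rw [h] at this
      exact lt_irrefl _ this
    · rintro ⟨_, h⟩
      exact Finset.sum_congr rfl fun m hm => by rw [mem_active.1 (h hm)]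
  have h0 : x₀ ∈ tightFace a b I := ⟨hx₀, hI.ge⟩
  refine ⟨fun _ => ⟨LinearMap.toContinuousLinearMap ψ, ?_⟩, ?_, ?_⟩
  · ext y
    simp only [LinearMap.coe_toContinuousLinearMap', Set.mem_ofPred_eq]
    constructor
    · rintro ⟨x, hx, rfl⟩
      refine ⟨⟨x, hx.1, rfl⟩, ?_⟩
      rintro _ ⟨z, hz, rfl⟩
      rw [(heq x hx.1).2 hx]
      exact hle z hz
    · rintro ⟨⟨x, hx, rfl⟩, hmax⟩
      refine ⟨x, (heq x hx).1 (le_antisymm (hle x hx) ?_), rfl⟩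
      rw [← (heq x₀ hx₀).2 h0]
      exact hmax _ ⟨x₀, hx₀, rfl⟩
  · intro x hx y hy hxy
    refine sub_eq_zero.1 (hinj _ (by rw [map_sub, hxy, sub_self]) fun m hm => ?_)
    rw [map_sub, mem_active.1 (hx.2 hm), mem_active.1 (hy.2 hm), sub_self]
  · ext x
    constructor
    · rintro ⟨hx, y, hy, hxy⟩
      rw [← heq x hx, ← hxy]
      exact (heq y hy.1).2 hy
    · intro hx
      exact ⟨hx.1, x, hx, rfl⟩

end FaceLatticeIso
end Polyhedra
end PolygonProducts


namespace PolygonProducts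
open Module Submodule
open scoped Classical

/-! ### A polygon with `2 h + 2` edges that is stable under perturbation -/

section Polygon
variable {h : ℕ}

/-- The facet normals of a polygon with `2 h + 2` edges. -/
def polyMat (h : ℕ) : Matrix (Fin (2 * h + 2)) (Fin 2) ℝ := fun k =>
  if k.1 = 2 * h + 1 then ![-1, 0] else ![1, 2 * ((k.1 : ℝ) - h)]

/-- The right hand sides of a polygon with `2 h + 2` edges. -/
def polyRhs (h : ℕ) : Fin (2 * h + 2) → ℝ := fun k =>
  if k.1 = 2 * h + 1 then ((h : ℝ) + 1) ^ 2 else ((k.1 : ℝ) - h) ^ 2 + 1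

/-- The linear forms given by the rows of a matrix. -/
def rowForm {ι κ : Type*} [Fintype κ] (V : Matrix ι κ ℝ) (k : ι) : (κ → ℝ) →ₗ[ℝ] ℝ :=
  LinearMap.proj k ∘ₗ V.mulVecLin

theorem rowForm_apply {ι κ : Type*} [Fintype κ] (V : Matrix ι κ ℝ) (k : ι) (y : κ → ℝ) :
    rowForm V k y = V.mulVec y k := rfl

theorem polyMat_mulVec_last {k : Fin (2 * h + 2)} (hk : k.1 = 2 * h + 1) (y : Fin 2 → ℝ) :
    (polyMat h).mulVec y k = -y 0 := by
  simp [Matrix.mulVec, dotProduct, polyMat, hk, Fin.sum_univ_two]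

theorem polyMat_mulVec_of_ne {k : Fin (2 * h + 2)} (hk : k.1 ≠ 2 * h + 1) (y : Fin 2 → ℝ) :
    (polyMat h).mulVec y k = y 0 + 2 * ((k.1 : ℝ) - h) * y 1 := by
  simp [Matrix.mulVec, dotProduct, polyMat, hk, Fin.sum_univ_two]

theorem val_add_one_polygon (k : Fin (2 * h + 2)) :
    (k + 1).1 = if k.1 = 2 * h + 1 then 0 else k.1 + 1 := by
  rw [Fin.val_add_one]
  simp [Fin.ext_iff]

/-- A right hand side close to that of the polygon. -/
def NearRhs (h : ℕ) (b : Fin (2 * h + 2) → ℝ) : Prop := ∀ k, |b k - polyRhs h k| ≤ 1 / 4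

theorem nearRhs_polyRhs (h : ℕ) : NearRhs h (polyRhs h) := fun k => by norm_num

variable {b : Fin (2 * h + 2) → ℝ}

theorem NearRhs.bounds_of_ne (hb : NearRhs h b) {k : Fin (2 * h + 2)} (hk : k.1 ≠ 2 * h + 1) :
    ((k.1 : ℝ) - h) ^ 2 + 3 / 4 ≤ b k ∧ b k ≤ ((k.1 : ℝ) - h) ^ 2 + 5 / 4 := by
  have := abs_le.1 (hb k)
  simp only [polyRhs, hk, if_false] at this
  constructor <;> linarith [this.1, this.2]

theorem NearRhs.bounds_last (hb : NearRhs h b) {k : Fin (2 * h + 2)} (hk : k.1 = 2 * h + 1) :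
    ((h : ℝ) + 1) ^ 2 - 1 / 4 ≤ b k ∧ b k ≤ ((h : ℝ) + 1) ^ 2 + 1 / 4 := by
  have := abs_le.1 (hb k)
  simp only [polyRhs, hk, if_true] at this
  constructor <;> linarith [this.1, this.2]

/-- The slack of an inequality at a point. -/
def slack (b : Fin (2 * h + 2) → ℝ) (y : Fin 2 → ℝ) (k : Fin (2 * h + 2)) : ℝ :=
  b k - (polyMat h).mulVec y k

/-- The edges `k ≤ 2h` lie on tangents of the parabola `y₀ = 1 - y₁²` at `y₁ = k - h`, so the
unperturbed slack is quadratic in `k` with leading coefficient `1`. The expression then equals `(k -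
i)(k - j)(j - i) ≥ k - i`, and the perturbation changes it by at most `(k - i) / 2`. -/
theorem slack_three (hb : NearRhs h b) (y : Fin 2 → ℝ) {i j k : Fin (2 * h + 2)} (hij : i < j)
    (hjk : j < k) (hk : k.1 ≠ 2 * h + 1) :
    0 < ((k.1 : ℝ) - j.1) * slack b y i + ((j.1 : ℝ) - i.1) * slack b y k -
      ((k.1 : ℝ) - i.1) * slack b y j := by
  have hj : j.1 ≠ 2 * h + 1 := by omega
  have hi : i.1 ≠ 2 * h + 1 := by omega
  obtain ⟨i1, i2⟩ := hb.bounds_of_ne hi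
  obtain ⟨j1, j2⟩ := hb.bounds_of_ne hj
  obtain ⟨k1, k2⟩ := hb.bounds_of_ne hk
  have h1 : (i.1 : ℝ) + 1 ≤ j.1 := by exact_mod_cast hij
  have h2 : (j.1 : ℝ) + 1 ≤ k.1 := by exact_mod_cast hjk
  simp only [slack, polyMat_mulVec_of_ne hi, polyMat_mulVec_of_ne hj, polyMat_mulVec_of_ne hk]
  generalize (i.1 : ℝ) = a at *
  generalize (j.1 : ℝ) = c at *
  generalize (k.1 : ℝ) = d at *
  have e1 := mul_le_mul_of_nonneg_left i1 (by linarith : 0 ≤ d - c)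
  have e2 := mul_le_mul_of_nonneg_left k1 (by linarith : 0 ≤ c - a)
  have e3 := mul_le_mul_of_nonneg_left j2 (by linarith : 0 ≤ d - a)
  have e4 : 0 ≤ (d - c - 1) * (c - a) + (c - a - 1) := by
    have := mul_nonneg (by linarith : 0 ≤ d - c - 1) (by linarith : 0 ≤ c - a)
    linarith
  have e5 := mul_nonneg (by linarith : 0 ≤ d - a) e4
  nlinarith

/-- The coefficients form a linear dependence of the three normals, so `y` drops out. With `a = i -
h` and `c = j - h` the unperturbed value is `(c - a)(1 - ac + (h + 1)²)`, at least `(c - a)(2h + 2)`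
because `ac ≤ h²`. -/
theorem slack_two (hb : NearRhs h b) (y : Fin 2 → ℝ) {i j k : Fin (2 * h + 2)} (hij : i < j)
    (hj : j.1 ≠ 2 * h + 1) (hk : k.1 = 2 * h + 1) :
    0 < ((j.1 : ℝ) - h) * slack b y i - ((i.1 : ℝ) - h) * slack b y j +
      ((j.1 : ℝ) - i.1) * slack b y k := by
  have hi : i.1 ≠ 2 * h + 1 := by omega
  have hi' := hb i
  have hj' := hb j
  obtain ⟨k1, k2⟩ := hb.bounds_last hk
  have h1 : (i.1 : ℝ) + 1 ≤ j.1 := by exact_mod_cast hij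
  have h2 : (j.1 : ℝ) ≤ 2 * h := by
    have : j.1 ≤ 2 * h := by omega
    exact_mod_cast this
  have h0 : (0 : ℝ) ≤ i.1 := by positivity
  simp only [polyRhs, hi, hj, if_false] at hi' hj'
  simp only [slack, polyMat_mulVec_of_ne hi, polyMat_mulVec_of_ne hj, polyMat_mulVec_last hk]
  obtain ⟨a, ha⟩ : ∃ a, a = (i.1 : ℝ) - h := ⟨_, rfl⟩
  obtain ⟨c, hc⟩ : ∃ c, c = (j.1 : ℝ) - h := ⟨_, rfl⟩
  have hd : (j.1 : ℝ) - i.1 = c - a := by rw [ha, hc]; ring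
  rw [hd, ← ha, ← hc]
  rw [← ha] at hi'
  rw [← hc] at hj'
  have ha1 : |a| ≤ h := abs_le.2 ⟨by linarith, by linarith⟩
  have hc1 : |c| ≤ h := abs_le.2 ⟨by linarith, by linarith⟩
  have e1 : |c * (b i - (a ^ 2 + 1))| ≤ (h : ℝ) * (1 / 4) := by
    rw [abs_mul]; exact mul_le_mul hc1 hi' (abs_nonneg _) (by positivity)
  have e2 : |a * (b j - (c ^ 2 + 1))| ≤ (h : ℝ) * (1 / 4) := by
    rw [abs_mul]; exact mul_le_mul ha1 hj' (abs_nonneg _) (by positivity)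
  have e3 : a * c ≤ (h : ℝ) * h := by
    refine (le_abs_self _).trans ?_
    rw [abs_mul]; exact mul_le_mul ha1 hc1 (abs_nonneg _) (by positivity)
  have hca : 1 ≤ c - a := by rw [ha, hc]; linarith
  have e4 : 0 ≤ (c - a) * (b k + 1 - a * c - 2 * h - 7 / 4) :=
    mul_nonneg (by linarith) (by nlinarith)
  have e5 : 0 ≤ (c - a - 1) * (2 * (h : ℝ) + 7 / 4) := mul_nonneg (by linarith) (by positivity)
  have f1 := (abs_le.1 e1).1
  have f2 := (abs_le.1 e2).2
  have hh : (0 : ℝ) ≤ h := by positivity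
  nlinarith

theorem mem_polyhedron_iff_slack {y : Fin 2 → ℝ} :
    y ∈ polyhedron (rowForm (polyMat h)) b ↔ ∀ k, 0 ≤ slack b y k := by
  simp only [polyhedron, Set.mem_ofPred_eq, slack, sub_nonneg, rowForm_apply]

theorem mem_active_iff_slack {y : Fin 2 → ℝ} {k : Fin (2 * h + 2)} :
    k ∈ active (rowForm (polyMat h)) b y ↔ slack b y k = 0 := by
  rw [mem_active, slack, sub_eq_zero, rowForm_apply, eq_comm]

/-- If two edges that are not neighbours were tight, a third inequality would be violated. -/
theorem active_adjacent (hb : NearRhs h b) {y : Fin 2 → ℝ} (hy : ∀ k, 0 ≤ slack b y k)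
    {i k : Fin (2 * h + 2)} (hi : slack b y i = 0) (hk : slack b y k = 0) (hik : i.1 + 2 ≤ k.1) :
    i.1 = 0 ∧ k.1 = 2 * h + 1 := by
  by_cases hk' : k.1 = 2 * h + 1
  · refine ⟨?_, hk'⟩
    by_contra hi0
    -- The comparison edge is `2h` or `0` according to the sign of `i - h`, so that its slack enters
    -- with a coefficient that is not positive.
    by_cases hih : h ≤ i.1
    · have := slack_two hb y (i := i) (j := ⟨2 * h, by omega⟩) (k := k)
        (Fin.lt_def.2 (by simp only []; omega)) (by simp) hk'
      rw [hi, hk] at this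
      have h1 : (0 : ℝ) ≤ (i.1 : ℝ) - h := sub_nonneg.2 (by exact_mod_cast hih)
      have := mul_nonneg h1 (hy ⟨2 * h, by omega⟩)
      linarith
    · have := slack_two hb y (i := ⟨0, by omega⟩) (j := i) (k := k)
        (Fin.lt_def.2 (by simp only []; omega)) (by omega) hk'
      rw [hi, hk] at this
      have h1 : (0 : ℝ) ≤ h - (i.1 : ℝ) := sub_nonneg.2 (by exact_mod_cast (not_le.1 hih).le)
      have := mul_nonneg h1 (hy ⟨0, by omega⟩)
      linarith
  · exfalso
    have := slack_three hb y (i := i) (j := ⟨i.1 + 1, by omega⟩) (k := k)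
      (Fin.lt_def.2 (by simp only []; omega)) (Fin.lt_def.2 (by simp only []; omega)) hk'
    rw [hi, hk] at this
    have h1 : (0 : ℝ) ≤ (k.1 : ℝ) - i.1 := sub_nonneg.2 (by exact_mod_cast (by omega : i.1 ≤ k.1))
    have := mul_nonneg h1 (hy ⟨i.1 + 1, by omega⟩)
    linarith

theorem exists_active_subset_pair (hb : NearRhs h b) {y : Fin 2 → ℝ}
    (hy : y ∈ polyhedron (rowForm (polyMat h)) b) :
    ∃ k, active (rowForm (polyMat h)) b y ⊆ {k, k + 1} := by
  rw [mem_polyhedron_iff_slack] at hy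
  rcases (active (rowForm (polyMat h)) b y).eq_empty_or_nonempty with h0 | hne
  · exact ⟨0, by simp [h0]⟩
  obtain ⟨i, hi, hmin⟩ := Finset.exists_min_image _ id hne
  obtain ⟨k, hk, hmax⟩ := Finset.exists_max_image _ id hne
  simp only [id] at hmin hmax
  by_cases hik : i.1 + 2 ≤ k.1
  · obtain ⟨h1, h2⟩ := active_adjacent hb hy (mem_active_iff_slack.1 hi)
      (mem_active_iff_slack.1 hk) hik
    refine ⟨k, fun m hm => ?_⟩
    have e1 := fun h' => active_adjacent hb hy (mem_active_iff_slack.1 hi)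
      (mem_active_iff_slack.1 hm) h'
    have e2 := fun h' => active_adjacent hb hy (mem_active_iff_slack.1 hm)
      (mem_active_iff_slack.1 hk) h'
    have e3 := val_add_one_polygon k
    rw [if_pos h2] at e3
    simp only [Finset.mem_insert, Finset.mem_singleton, Fin.ext_iff]
    omega
  · refine ⟨i, fun m hm => ?_⟩
    have e1 := Fin.le_def.1 (hmin m hm)
    have e2 := Fin.le_def.1 (hmax m hm)
    have e3 := val_add_one_polygon i
    simp only [Finset.mem_insert, Finset.mem_singleton, Fin.ext_iff]
    split_ifs at e3 <;> omega

theorem polyMat_injective (hh : 1 ≤ h) {d : Fin 2 → ℝ} {k : Fin (2 * h + 2)}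
    (h1 : (polyMat h).mulVec d k = 0) (h2 : (polyMat h).mulVec d (k + 1) = 0) : d = 0 := by
  have hh' : (1 : ℝ) ≤ h := by exact_mod_cast hh
  have e3 := val_add_one_polygon k
  suffices d 0 = 0 ∧ d 1 = 0 by
    ext c; fin_cases c
    · exact this.1
    · exact this.2
  by_cases hk : k.1 = 2 * h + 1
  · rw [if_pos hk] at e3
    rw [polyMat_mulVec_last hk] at h1
    rw [polyMat_mulVec_of_ne (by omega), e3] at h2
    have h0 : d 0 = 0 := by linarith
    rw [h0] at h2
    refine ⟨h0, ?_⟩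
    have : (h : ℝ) * d 1 = 0 := by push_cast at h2; linarith
    exact (mul_eq_zero.1 this).resolve_left (by positivity)
  · rw [if_neg hk] at e3
    rw [polyMat_mulVec_of_ne hk] at h1
    by_cases hk' : k.1 = 2 * h
    · rw [polyMat_mulVec_last (by omega)] at h2
      have h0 : d 0 = 0 := by linarith
      rw [h0, hk'] at h1
      refine ⟨h0, ?_⟩
      have : (h : ℝ) * d 1 = 0 := by push_cast at h1; linarith
      exact (mul_eq_zero.1 this).resolve_left (by positivity)
    · rw [polyMat_mulVec_of_ne (by omega), e3] at h2
      push_cast at h2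
      have : d 1 = 0 := by linarith
      refine ⟨?_, this⟩
      rw [this] at h1; linarith

/-- The two equations are solved explicitly; the other slacks are then positive by `slack_three` and
`slack_two`. The cases are two tangents and the two ends of the last edge. -/
theorem exists_vertex (hh : 1 ≤ h) (hb : NearRhs h b) (k : Fin (2 * h + 2)) :
    ∃ y ∈ polyhedron (rowForm (polyMat h)) b,
      active (rowForm (polyMat h)) b y = {k, k + 1} := by
  suffices ∃ y, slack b y k = 0 ∧ slack b y (k + 1) = 0 ∧
      ∀ m, m ≠ k → m ≠ k + 1 → 0 < slack b y m by
    obtain ⟨y, h1, h2, h3⟩ := this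
    refine ⟨y, mem_polyhedron_iff_slack.2 fun m => ?_, ?_⟩
    · by_cases hm : m = k
      · rw [hm, h1]
      by_cases hm' : m = k + 1
      · rw [hm', h2]
      exact (h3 m hm hm').le
    · ext m
      rw [mem_active_iff_slack, Finset.mem_insert, Finset.mem_singleton]
      constructor
      · intro h0
        by_contra! hc
        exact (h3 m hc.1 hc.2).ne' h0
      · rintro (rfl | rfl) <;> assumption
  have hh' : (1 : ℝ) ≤ h := by exact_mod_cast hh
  have hh0 : (h : ℝ) ≠ 0 := by positivity
  have e3 := val_add_one_polygon k
  by_cases hk : k.1 = 2 * h + 1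
  · rw [if_pos hk] at e3
    obtain ⟨y, hy⟩ : ∃ y : Fin 2 → ℝ, y = ![-b k, -(b (k + 1) + b k) / (2 * h)] := ⟨_, rfl⟩
    have h1 : slack b y k = 0 := by rw [slack, polyMat_mulVec_last hk, hy]; simp
    have h2 : slack b y (k + 1) = 0 := by
      rw [slack, polyMat_mulVec_of_ne (by omega), e3, hy]; simp; field_simp; ring
    refine ⟨y, h1, h2, fun m hm hm' => ?_⟩
    have hm1 : m.1 ≠ 2 * h + 1 := fun h => hm (Fin.ext (by omega))
    have hm2 : m.1 ≠ 0 := fun h => hm' (Fin.ext (by omega))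
    have := slack_two hb y (i := k + 1) (j := m) (k := k) (Fin.lt_def.2 (by omega)) hm1 hk
    rw [h1, h2, e3] at this
    push_cast at this
    refine pos_of_mul_pos_right (a := (h : ℝ)) ?_ (by positivity)
    linarith
  · rw [if_neg hk] at e3
    by_cases hk' : k.1 = 2 * h
    · obtain ⟨y, hy⟩ : ∃ y : Fin 2 → ℝ, y = ![-b (k + 1), (b k + b (k + 1)) / (2 * h)] := ⟨_, rfl⟩
      have h1 : slack b y k = 0 := by
        rw [slack, polyMat_mulVec_of_ne hk, hk', hy]; simp; field_simp; ring
      have h2 : slack b y (k + 1) = 0 := by rw [slack, polyMat_mulVec_last (by omega), hy]; simp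
      refine ⟨y, h1, h2, fun m hm hm' => ?_⟩
      have hm1 : m.1 ≠ 2 * h := fun h => hm (Fin.ext (by omega))
      have hm2 : m.1 ≠ 2 * h + 1 := fun h => hm' (Fin.ext (by omega))
      have := slack_two hb y (i := m) (j := k) (k := k + 1) (Fin.lt_def.2 (by omega)) hk
        (by omega)
      rw [h1, h2, hk'] at this
      push_cast at this
      refine pos_of_mul_pos_right (a := (h : ℝ)) ?_ (by positivity)
      linarith
    · obtain ⟨y, hy⟩ : ∃ y : Fin 2 → ℝ, y = ![b k - ((k.1 : ℝ) - h) * (b (k + 1) - b k),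
        (b (k + 1) - b k) / 2] := ⟨_, rfl⟩
      have h1 : slack b y k = 0 := by
        rw [slack, polyMat_mulVec_of_ne hk, hy]; simp; ring
      have h2 : slack b y (k + 1) = 0 := by
        rw [slack, polyMat_mulVec_of_ne (by omega), e3, hy]; simp; ring
      have e4 : (((k + 1 : Fin (2 * h + 2)).1 : ℕ) : ℝ) = k.1 + 1 := by rw [e3]; push_cast; ring
      refine ⟨y, h1, h2, fun m hm hm' => ?_⟩
      have hm1 : m.1 ≠ k.1 := fun h => hm (Fin.ext h)
      have hm2 : m.1 ≠ k.1 + 1 := fun h => hm' (Fin.ext (by omega))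
      by_cases hm3 : m.1 = 2 * h + 1
      · have := slack_two hb y (i := k) (j := k + 1) (k := m) (Fin.lt_def.2 (by omega))
          (by omega) hm3
        rw [h1, h2, e4] at this
        linarith
      · rcases lt_or_gt_of_ne hm1 with hlt | hgt
        · have := slack_three hb y (i := m) (j := k) (k := k + 1) (Fin.lt_def.2 (by omega))
            (Fin.lt_def.2 (by omega)) (by omega)
          rw [h1, h2, e4] at this
          linarith
        · have := slack_three hb y (i := k) (j := k + 1) (k := m) (Fin.lt_def.2 (by omega))
            (Fin.lt_def.2 (by omega)) (by omega)
          rw [h1, h2, e4] at this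
          linarith

theorem pair_inter_pair (hh : 1 ≤ h) (k : Fin (2 * h + 2)) :
    ({k, k + 1} ∩ {k + 1, k + 1 + 1} : Finset (Fin (2 * h + 2))) = {k + 1} ∧
    ({k, k + 1} ∩ {k + 1 + 1, k + 1 + 1 + 1} : Finset (Fin (2 * h + 2))) = ∅ := by
  have e1 := val_add_one_polygon k
  have e2 := val_add_one_polygon (k + 1)
  have e3 := val_add_one_polygon (k + 1 + 1)
  constructor
  · ext m
    simp only [Finset.mem_inter, Finset.mem_insert, Finset.mem_singleton, Fin.ext_iff]
    split_ifs at * <;> omega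
  · ext m
    simp only [Finset.mem_inter, Finset.mem_insert, Finset.mem_singleton, Fin.ext_iff,
      Finset.notMem_empty, iff_false]
    split_ifs at * <;> omega

/-- Smaller tight sets arise at midpoints of vertices: adjacent vertices share one edge, and the
vertices at `k` and `k + 2` share none as there are at least four edges. -/
theorem exists_active_eq (hh : 1 ≤ h) (hb : NearRhs h b) {k : Fin (2 * h + 2)}
    {I : Finset (Fin (2 * h + 2))} (hI : I ⊆ {k, k + 1}) :
    ∃ y ∈ polyhedron (rowForm (polyMat h)) b, active (rowForm (polyMat h)) b y = I := by
  have hmid : ∀ J J' : Finset (Fin (2 * h + 2)),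
      (∃ y ∈ polyhedron (rowForm (polyMat h)) b, active (rowForm (polyMat h)) b y = J) →
      (∃ y ∈ polyhedron (rowForm (polyMat h)) b, active (rowForm (polyMat h)) b y = J') →
      ∃ y ∈ polyhedron (rowForm (polyMat h)) b, active (rowForm (polyMat h)) b y = J ∩ J' := by
    rintro _ _ ⟨y, hy, rfl⟩ ⟨z, hz, rfl⟩
    exact ⟨_, midpoint_mem_polyhedron hy hz⟩
  have hsing : ∀ k : Fin (2 * h + 2), ∃ y ∈ polyhedron (rowForm (polyMat h)) b,
      active (rowForm (polyMat h)) b y = {k} := by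
    intro k
    have := hmid _ _ (exists_vertex hh hb (k - 1)) (exists_vertex hh hb (k - 1 + 1))
    rw [(pair_inter_pair hh (k - 1)).1, sub_add_cancel] at this
    exact this
  have hemp := hmid _ _ (exists_vertex hh hb k) (exists_vertex hh hb (k + 1 + 1))
  rw [(pair_inter_pair hh k).2] at hemp
  have : I = ∅ ∨ I = {k} ∨ I = {k + 1} ∨ I = {k, k + 1} := by
    by_cases h1 : k ∈ I <;> by_cases h2 : k + 1 ∈ I
    · right; right; right
      refine hI.antisymm ?_
      simp [Finset.insert_subset_iff, h1, h2]
    · right; left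
      ext m; have := @hI m; simp only [Finset.mem_insert, Finset.mem_singleton] at this ⊢; grind
    · right; right; left
      ext m; have := @hI m; simp only [Finset.mem_insert, Finset.mem_singleton] at this ⊢; grind
    · left
      ext m; have := @hI m; simp only [Finset.mem_insert, Finset.mem_singleton] at this; grind
  rcases this with rfl | rfl | rfl | rfl
  · exact hemp
  · exact hsing k
  · exact hsing (k + 1)
  · exact exists_vertex hh hb k

/-- The triangle bounded by the edges `0`, `2h` and `2h + 1` already satisfies the bound. -/
theorem abs_apply_le_of_mem (hh : 1 ≤ h) (hb : NearRhs h b) {y : Fin 2 → ℝ}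
    (hy : y ∈ polyhedron (rowForm (polyMat h)) b) (c : Fin 2) :
    |y c| ≤ 2 * ((h : ℝ) + 1) ^ 2 := by
  have hh' : (1 : ℝ) ≤ h := by exact_mod_cast hh
  have h0 := hy ⟨0, by omega⟩
  have h1 := hy ⟨2 * h, by omega⟩
  have h2 := hy ⟨2 * h + 1, by omega⟩
  rw [rowForm_apply, polyMat_mulVec_of_ne (by simp)] at h0 h1
  rw [rowForm_apply, polyMat_mulVec_last (by simp)] at h2
  have b0 := (hb.bounds_of_ne (k := ⟨0, by omega⟩) (by simp)).2
  have b1 := (hb.bounds_of_ne (k := ⟨2 * h, by omega⟩) (by simp)).2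
  have b2 := (hb.bounds_last (k := ⟨2 * h + 1, by omega⟩) (by simp)).2
  push_cast at *
  have e1 : |2 * h * y 1| ≤ 2 * (2 * ((h : ℝ) + 1) ^ 2) := by
    rw [abs_le]; constructor <;> nlinarith
  rw [abs_mul, abs_of_pos (by positivity : (0 : ℝ) < 2 * h)] at e1
  fin_cases c
  · simp only [Fin.zero_eta, abs_le]
    constructor <;> nlinarith
  · simp only [Fin.mk_one]
    nlinarith [abs_nonneg (y 1)]

theorem isBounded_of_abs_le {ι : Type*} [Fintype ι] {S : Set (ι → ℝ)} {R : ℝ}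
    (hS : ∀ x ∈ S, ∀ i, |x i| ≤ R) : Bornology.IsBounded S := by
  refine (Metric.isBounded_closedBall (x := (0 : ι → ℝ)) (r := max R 0)).subset fun x hx => ?_
  rw [Metric.mem_closedBall, dist_pi_le_iff (le_max_right _ _)]
  intro i
  rw [Pi.zero_apply, Real.dist_eq, sub_zero]
  exact (hS x hx i).trans (le_max_left _ _)

theorem polyRhs_pos (h : ℕ) (k : Fin (2 * h + 2)) : 0 < polyRhs h k := by
  unfold polyRhs; split_ifs <;> positivity

theorem polyhedron_rowForm {ι κ : Type*} [Fintype κ] (V : Matrix ι κ ℝ) (b : ι → ℝ) :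
    polyhedron (rowForm V) b = {y | V.mulVec y ≤ b} := rfl

theorem affDim_polygon (h : ℕ) : affDim (polyhedron (rowForm (polyMat h)) (polyRhs h)) = 2 := by
  have key : ∀ y : Fin 2 → ℝ, 0 ≤ y 0 → y 0 ≤ 1 → (y 0 = 0 ∨ y 1 = 0) → |y 1| ≤ 1 →
      y ∈ polyhedron (rowForm (polyMat h)) (polyRhs h) := by
    intro y h0 h1 h2 h3 k
    rw [rowForm_apply, polyRhs]
    by_cases hk : k.1 = 2 * h + 1
    · rw [if_pos hk, polyMat_mulVec_last hk]
      have : (0 : ℝ) ≤ ((h : ℝ) + 1) ^ 2 := by positivity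
      linarith
    · rw [if_neg hk, polyMat_mulVec_of_ne hk]
      have h4 := abs_le.1 h3
      rcases h2 with h2 | h2 <;> rw [h2]
      · nlinarith [sq_nonneg ((k.1 : ℝ) - h - y 1)]
      · nlinarith [sq_nonneg ((k.1 : ℝ) - h)]
  have hspan : vectorSpan ℝ (polyhedron (rowForm (polyMat h)) (polyRhs h)) = ⊤ := by
    refine eq_top_iff.2 fun y _ => ?_
    have z0 : (0 : Fin 2 → ℝ) ∈ polyhedron (rowForm (polyMat h)) (polyRhs h) :=
      key 0 (by simp) (by simp) (by simp) (by simp)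
    have z1 : (![1, 0] : Fin 2 → ℝ) ∈ polyhedron (rowForm (polyMat h)) (polyRhs h) :=
      key _ (by simp) (by simp) (by simp) (by simp)
    have z2 : (![0, 1] : Fin 2 → ℝ) ∈ polyhedron (rowForm (polyMat h)) (polyRhs h) :=
      key _ (by simp) (by simp) (by simp) (by simp)
    have hy : y = y 0 • ((![1, 0] : Fin 2 → ℝ) -ᵥ (0 : Fin 2 → ℝ)) +
        y 1 • ((![0, 1] : Fin 2 → ℝ) -ᵥ (0 : Fin 2 → ℝ)) := by
      ext c; fin_cases c <;> simp
    rw [hy]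
    exact add_mem (smul_mem _ _ (vsub_mem_vectorSpan ℝ z1 z0))
      (smul_mem _ _ (vsub_mem_vectorSpan ℝ z2 z0))
  rw [affDim, hspan, finrank_top]
  simp

theorem affDim_eq_zero_iff {E : Type*} [AddCommGroup E] [Module ℝ E] [FiniteDimensional ℝ E]
    {S : Set E} : affDim S = 0 ↔ S.Subsingleton := by
  rw [affDim, Submodule.finrank_eq_zero, vectorSpan_eq_bot_iff_subsingleton]

theorem isPolygon_polyMat (hh : 1 ≤ h) :
    IsPolygon (2 * h + 2) {y | (polyMat h).mulVec y ≤ polyRhs h} := by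
  rw [← polyhedron_rowForm]
  have hb := nearRhs_polyRhs h
  refine ⟨isPolytope_polyhedron (isBounded_of_abs_le fun y hy => abs_apply_le_of_mem hh hb hy),
    affDim_polygon h, ?_⟩
  choose z hz hact using exists_vertex hh hb
  have huniq : ∀ k, tightFace (rowForm (polyMat h)) (polyRhs h)
      (active (rowForm (polyMat h)) (polyRhs h) (z k)) = {z k} := by
    intro k
    refine Set.eq_singleton_iff_unique_mem.2 ⟨⟨hz k, subset_rfl⟩, ?_⟩
    rintro y ⟨hy, hky⟩
    refine sub_eq_zero.1 (polyMat_injective hh (k := k) ?_ ?_)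
    all_goals
      rw [Matrix.mulVec_sub, Pi.sub_apply, sub_eq_zero, ← rowForm_apply, ← rowForm_apply,
        mem_active.1 (hky (by rw [hact]; simp)),
        mem_active.1 (show _ ∈ active _ _ (z k) by rw [hact]; simp)]
  have hinj : Function.Injective fun k => ({z k} : Set (Fin 2 → ℝ)) := by
    intro k l hkl
    have h1 : ({k, k + 1} : Finset (Fin (2 * h + 2))) = {l, l + 1} := by
      rw [← hact k, ← hact l, Set.singleton_injective hkl]
    have e1 := val_add_one_polygon k
    have e2 := val_add_one_polygon l
    have h2 : k ∈ ({l, l + 1} : Finset (Fin (2 * h + 2))) := h1 ▸ by simp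
    have h3 : l ∈ ({k, k + 1} : Finset (Fin (2 * h + 2))) := h1 ▸ by simp
    simp only [Finset.mem_insert, Finset.mem_singleton, Fin.ext_iff] at h2 h3 ⊢
    split_ifs at * <;> omega
  have hset : {F : Set (Fin 2 → ℝ) | IsExposed ℝ (polyhedron (rowForm (polyMat h)) (polyRhs h)) F ∧
      F.Nonempty ∧ affDim F = 0} = Set.range fun k => ({z k} : Set (Fin 2 → ℝ)) := by
    ext F
    simp only [affDim_eq_zero_iff, Set.mem_range, Set.mem_ofPred_eq]
    constructor
    · rintro ⟨hF, hne, hsub⟩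
      obtain ⟨x, hx, hFx⟩ := exists_eq_tightFace hF hne
      obtain ⟨k, hk⟩ := exists_active_subset_pair hb (hF.subset hx)
      refine ⟨k, (hsub.eq_singleton_of_mem ?_).symm⟩
      rw [hFx]
      exact ⟨hz k, by rw [hact]; exact hk⟩
    · rintro ⟨k, rfl⟩
      refine ⟨?_, Set.singleton_nonempty _, Set.subsingleton_singleton⟩
      rw [← huniq]
      exact isExposed_tightFace (hz k)
  rw [fNumber, hset, ← Set.image_univ, Set.ncard_image_of_injective _ hinj, Set.ncard_univ]
  simp

end Polygon
end PolygonProducts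


namespace PolygonProducts
open Module Submodule
open scoped Classical

/-! ### Deformed products with small lower blocks -/

section DeformedProduct
variable {h r : ℕ}

/-- The decomposition of `ℝ²ʳ` into blocks of two coordinates. -/
def blockEquiv (r : ℕ) : (Fin (2 * r) → ℝ) ≃ₗ[ℝ] (Fin r → Fin 2 → ℝ) where
  toFun x i := coordBlock x i
  map_add' _ _ := rfl
  map_smul' _ _ := rfl
  invFun y s := y ⟨s.1 / 2, by omega⟩ ⟨s.1 % 2, by omega⟩
  left_inv x := by
    ext s
    simp only [coordBlock]
    congr 1
    exact Fin.ext (by simp only []; omega)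
  right_inv y := by
    ext i c
    have e1 : (⟨(2 * i.1 + c.1) / 2, by omega⟩ : Fin r) = i :=
      Fin.ext (by change (2 * i.1 + c.1) / 2 = i.1; omega)
    have e2 : (⟨(2 * i.1 + c.1) % 2, by omega⟩ : Fin 2) = c :=
      Fin.ext (by change (2 * i.1 + c.1) % 2 = c.1; omega)
    change y ⟨(2 * i.1 + c.1) / 2, _⟩ ⟨(2 * i.1 + c.1) % 2, _⟩ = y i c
    rw [e1, e2]

theorem blockEquiv_apply (x : Fin (2 * r) → ℝ) (i : Fin r) : blockEquiv r x i = coordBlock x i := rfl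

/-- The left hand sides of the inequalities of a deformed product of polygons. -/
def defForm (L : Fin r → Fin r → Matrix (Fin (2 * h + 2)) (Fin 2) ℝ) (m : Fin r × Fin (2 * h + 2)) :
    (Fin r → Fin 2 → ℝ) →ₗ[ℝ] ℝ :=
  (∑ j ∈ Finset.univ.filter (fun j => j < m.1), rowForm (L m.1 j) m.2 ∘ₗ LinearMap.proj j) +
    rowForm (polyMat h) m.2 ∘ₗ LinearMap.proj m.1

variable {L : Fin r → Fin r → Matrix (Fin (2 * h + 2)) (Fin 2) ℝ}

theorem defForm_apply (m : Fin r × Fin (2 * h + 2)) (y : Fin r → Fin 2 → ℝ) :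
    defForm L m y = (∑ j ∈ Finset.univ.filter (fun j => j < m.1), (L m.1 j).mulVec (y j) m.2) +
      (polyMat h).mulVec (y m.1) m.2 := by
  simp [defForm, rowForm_apply]

/-- The right hand side of the `i`-th block of inequalities once the earlier blocks are fixed. -/
def shiftRhs (L : Fin r → Fin r → Matrix (Fin (2 * h + 2)) (Fin 2) ℝ) (y : Fin r → Fin 2 → ℝ)
    (i : Fin r) : Fin (2 * h + 2) → ℝ := fun k =>
  polyRhs h k - ∑ j ∈ Finset.univ.filter (fun j => j < i), (L i j).mulVec (y j) k

/-- By triangularity the earlier blocks of `y` only shift the right hand side of the polygon in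
which `y i` has to lie. -/
theorem mem_polyhedron_defForm {y : Fin r → Fin 2 → ℝ} :
    y ∈ polyhedron (defForm L) (fun m => polyRhs h m.2) ↔
      ∀ i, y i ∈ polyhedron (rowForm (polyMat h)) (shiftRhs L y i) := by
  simp only [polyhedron, Set.mem_ofPred_eq, defForm_apply, shiftRhs, rowForm_apply, Prod.forall,
    le_sub_iff_add_le']

theorem mem_active_defForm {y : Fin r → Fin 2 → ℝ} {m : Fin r × Fin (2 * h + 2)} :
    m ∈ active (defForm L) (fun m => polyRhs h m.2) y ↔
      m.2 ∈ active (rowForm (polyMat h)) (shiftRhs L y m.1) (y m.1) := by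
  simp only [mem_active, defForm_apply, shiftRhs, rowForm_apply, eq_sub_iff_add_eq']

/-- The blocks below the diagonal are so small that they do not change the combinatorics. -/
def SmallBlocks (L : Fin r → Fin r → Matrix (Fin (2 * h + 2)) (Fin 2) ℝ) : Prop :=
  ∀ i j k c, |L i j k c| * (16 * r * ((h : ℝ) + 1) ^ 2) ≤ 1

/-- The constant in `SmallBlocks` makes each product of an entry and a coordinate at most `1 /
(8r)`; there are two per block and at most `r` blocks, which gives the tolerance `1 / 4`. -/
theorem nearRhs_shiftRhs (hL : SmallBlocks L) {y : Fin r → Fin 2 → ℝ} {i : Fin r}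
    (hy : ∀ j < i, ∀ c, |y j c| ≤ 2 * ((h : ℝ) + 1) ^ 2) : NearRhs h (shiftRhs L y i) := by
  intro k
  have hr : (0 : ℝ) < r := by exact_mod_cast i.pos
  have hterm : ∀ j ∈ Finset.univ.filter (fun j => j < i), |(L i j).mulVec (y j) k| ≤ 1 / (4 * r) := by
    intro j hj
    have hj := hy j (Finset.mem_filter.1 hj).2
    have hc : ∀ c, |L i j k c * y j c| ≤ 1 / (8 * r) := by
      intro c
      rw [abs_mul, le_div_iff₀ (by positivity)]
      have h1 := mul_le_mul_of_nonneg_left (hj c) (abs_nonneg (L i j k c))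
      have h2 := hL i j k c
      nlinarith
    simp only [Matrix.mulVec, dotProduct, Fin.sum_univ_two]
    refine (abs_add_le _ _).trans ((add_le_add (hc 0) (hc 1)).trans (le_of_eq ?_))
    field_simp; norm_num
  rw [shiftRhs, sub_sub_cancel_left, abs_neg]
  refine (Finset.abs_sum_le_sum_abs _ _).trans ((Finset.sum_le_card_nsmul _ _ _ hterm).trans ?_)
  rw [nsmul_eq_mul]
  have hcard : ((Finset.univ.filter (fun j => j < i)).card : ℝ) ≤ r := by
    exact_mod_cast (Finset.card_le_univ _).trans (by simp)
  calc _ ≤ (r : ℝ) * (1 / (4 * r)) := mul_le_mul_of_nonneg_right hcard (by positivity)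
    _ = 1 / 4 := by field_simp

theorem nearRhs_of_mem (hh : 1 ≤ h) (hL : SmallBlocks L) {y : Fin r → Fin 2 → ℝ}
    (hy : y ∈ polyhedron (defForm L) (fun m => polyRhs h m.2)) (i : Fin r) :
    NearRhs h (shiftRhs L y i) ∧ ∀ c, |y i c| ≤ 2 * ((h : ℝ) + 1) ^ 2 := by
  induction i using WellFoundedLT.induction with
  | ind i ih =>
    have h1 := nearRhs_shiftRhs hL fun j hj => (ih j hj).2
    exact ⟨h1, fun c => abs_apply_le_of_mem hh h1 (mem_polyhedron_defForm.1 hy i) c⟩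

/-- The sets of inequalities that can be tight simultaneously. -/
def IsProductActive (I : Finset (Fin r × Fin (2 * h + 2))) : Prop :=
  ∀ i, ∃ k, ∀ l, (i, l) ∈ I → l ∈ ({k, k + 1} : Finset _)

theorem isProductActive_of_mem (hh : 1 ≤ h) (hL : SmallBlocks L) {y : Fin r → Fin 2 → ℝ}
    (hy : y ∈ polyhedron (defForm L) (fun m => polyRhs h m.2)) :
    IsProductActive (active (defForm L) (fun m => polyRhs h m.2) y) := by
  intro i
  have hyi := mem_polyhedron_defForm.1 hy i
  obtain ⟨k, hk⟩ := exists_active_subset_pair (nearRhs_of_mem hh hL hy i).1 hyi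
  refine ⟨k, fun l hl => ?_⟩
  rw [mem_active_defForm] at hl
  exact hk hl

theorem shiftRhs_congr {y z : Fin r → Fin 2 → ℝ} {i : Fin r} (hyz : ∀ j < i, y j = z j) :
    shiftRhs L y i = shiftRhs L z i := by
  ext k
  simp only [shiftRhs]
  congr 1
  exact Finset.sum_congr rfl fun j hj => by rw [hyz j (Finset.mem_filter.1 hj).2]

/-- The point is built block by block: whatever the earlier blocks are, the next one ranges over a
perturbed polygon, in which every admissible tight set occurs. The answer does not depend on `L`. -/
theorem exists_active_eq_of_isProductActive (hh : 1 ≤ h) (hL : SmallBlocks L)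
    {I : Finset (Fin r × Fin (2 * h + 2))} (hI : IsProductActive I) :
    ∃ y ∈ polyhedron (defForm L) (fun m => polyRhs h m.2),
      active (defForm L) (fun m => polyRhs h m.2) y = I := by
  have key : ∀ s ≤ r, ∃ y : Fin r → Fin 2 → ℝ, ∀ i : Fin r, i.1 < s →
      y i ∈ polyhedron (rowForm (polyMat h)) (shiftRhs L y i) ∧
      active (rowForm (polyMat h)) (shiftRhs L y i) (y i) =
        Finset.univ.filter (fun l => (i, l) ∈ I) ∧
      NearRhs h (shiftRhs L y i) := by
    intro s
    induction s with
    | zero => exact fun _ => ⟨0, fun i hi => absurd hi (Nat.not_lt_zero _)⟩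
    | succ s ih =>
      intro hs
      obtain ⟨y, hy⟩ := ih (Nat.le_of_succ_le hs)
      have hnear : NearRhs h (shiftRhs L y ⟨s, hs⟩) := nearRhs_shiftRhs hL fun j hj c =>
        abs_apply_le_of_mem hh (hy j hj).2.2 (hy j hj).1 c
      obtain ⟨k, hk⟩ := hI ⟨s, hs⟩
      obtain ⟨z, hz, hact⟩ := exists_active_eq hh hnear
        (I := Finset.univ.filter fun l => ((⟨s, hs⟩ : Fin r), l) ∈ I) (k := k)
        (fun l hl => hk l (Finset.mem_filter.1 hl).2)
      have hne : ∀ i : Fin r, i.1 < s → i ≠ ⟨s, hs⟩ := fun i hi h => by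
        rw [h] at hi; exact lt_irrefl _ hi
      have hcongr : ∀ i : Fin r, i.1 ≤ s →
          shiftRhs L (Function.update y ⟨s, hs⟩ z) i = shiftRhs L y i := fun i hi =>
        shiftRhs_congr fun j hj => Function.update_of_ne (hne j (lt_of_lt_of_le hj hi)) _ _
      refine ⟨Function.update y ⟨s, hs⟩ z, fun i hi => ?_⟩
      rw [hcongr i (Nat.lt_succ_iff.1 hi)]
      rcases Nat.lt_succ_iff_lt_or_eq.1 hi with hlt | heq
      · rw [Function.update_of_ne (hne i hlt)]
        exact hy i hlt
      · obtain rfl : i = ⟨s, hs⟩ := Fin.ext heq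
        rw [Function.update_self]
        exact ⟨hz, hact, hnear⟩
  obtain ⟨y, hy⟩ := key r le_rfl
  refine ⟨y, mem_polyhedron_defForm.2 fun i => (hy i i.2).1, ?_⟩
  ext m
  rw [mem_active_defForm, (hy m.1 m.1.2).2.1]
  simp

theorem smallBlocks_zero : SmallBlocks (0 : Fin r → Fin r → Matrix (Fin (2 * h + 2)) (Fin 2) ℝ) :=
  fun i j k c => by simp

theorem shiftRhs_zero (y : Fin r → Fin 2 → ℝ) (i : Fin r) :
    shiftRhs (0 : Fin r → Fin r → Matrix (Fin (2 * h + 2)) (Fin 2) ℝ) y i = polyRhs h := by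
  ext k; simp [shiftRhs]

theorem polygonPower_eq (h r : ℕ) :
    polygonPower {y | (polyMat h).mulVec y ≤ polyRhs h} r =
      polyhedron (defForm (0 : Fin r → Fin r → Matrix (Fin (2 * h + 2)) (Fin 2) ℝ))
        (fun m => polyRhs h m.2) := by
  ext y
  rw [mem_polyhedron_defForm]
  simp only [shiftRhs_zero]
  rfl

/-- The inequalities that are tight on a polygon `2`-face. -/
def twoFaceActive (j : Fin r) (κ : Fin r → Fin (2 * h + 2)) : Finset (Fin r × Fin (2 * h + 2)) :=
  Finset.univ.filter fun m => m.1 ≠ j ∧ (m.2 = κ m.1 ∨ m.2 = κ m.1 + 1)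

theorem mem_twoFaceActive {j : Fin r} {κ : Fin r → Fin (2 * h + 2)}
    {m : Fin r × Fin (2 * h + 2)} :
    m ∈ twoFaceActive j κ ↔ m.1 ≠ j ∧ (m.2 = κ m.1 ∨ m.2 = κ m.1 + 1) := by
  simp [twoFaceActive]

theorem isProductActive_twoFaceActive (j : Fin r) (κ : Fin r → Fin (2 * h + 2)) :
    IsProductActive (twoFaceActive j κ) := fun i =>
  ⟨κ i, fun l hl => by simpa using (mem_twoFaceActive.1 hl).2⟩

theorem active_of_extreme (hh : 1 ≤ h) {v : Fin 2 → ℝ}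
    (hv : v ∈ Set.extremePoints ℝ (polyhedron (rowForm (polyMat h)) (polyRhs h))) :
    ∃ k, active (rowForm (polyMat h)) (polyRhs h) v = {k, k + 1} := by
  obtain ⟨k, hk⟩ := exists_active_subset_pair (nearRhs_polyRhs h) hv.1
  obtain ⟨z, hz, hact⟩ := exists_vertex hh (nearRhs_polyRhs h) k
  refine ⟨k, ?_⟩
  rw [eq_of_active_subset hv hz (hk.trans hact.ge), hact]

/-- A vertex is the only point of the polygon at which both of its edges are tight. -/
theorem twoFace_eq_tightFace (hh : 1 ≤ h) {G : Set (Fin r → Fin 2 → ℝ)}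
    (hG : IsPolygonTwoFace {y | (polyMat h).mulVec y ≤ polyRhs h} r G) :
    ∃ j κ, G = tightFace (defForm (0 : Fin r → Fin r → Matrix (Fin (2 * h + 2)) (Fin 2) ℝ))
      (fun m => polyRhs h m.2) (twoFaceActive j κ) := by
  obtain ⟨j, v, hv, rfl⟩ := hG
  choose κ hκ using fun i => active_of_extreme hh (hv i)
  refine ⟨j, κ, ?_⟩
  ext y
  simp only [tightFace, Set.mem_ofPred_eq, mem_polyhedron_defForm, shiftRhs_zero]
  constructor
  · rintro ⟨h1, h2⟩
    refine ⟨fun i => ?_, fun m hm => ?_⟩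
    · by_cases hi : i = j
      · exact hi ▸ h1
      · rw [h2 i hi]; exact (hv i).1
    · obtain ⟨hm1, hm2⟩ := mem_twoFaceActive.1 hm
      rw [mem_active_defForm, shiftRhs_zero, h2 _ hm1, hκ]
      simpa using hm2
  · rintro ⟨h1, h2⟩
    refine ⟨h1 j, fun i hi => (eq_of_active_subset (hv i) (h1 i) fun k hk => ?_).symm⟩
    rw [hκ, Finset.mem_insert, Finset.mem_singleton] at hk
    have := h2 (mem_twoFaceActive.2 (⟨hi, hk⟩ : (i, k).1 ≠ j ∧ _))
    rwa [mem_active_defForm, shiftRhs_zero] at this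

/-- The forms of a deformed product in the coordinates of `ℝ²ʳ`. -/
def coordForm (L : Fin r → Fin r → Matrix (Fin (2 * h + 2)) (Fin 2) ℝ)
    (m : Fin r × Fin (2 * h + 2)) : (Fin (2 * r) → ℝ) →ₗ[ℝ] ℝ :=
  defForm L m ∘ₗ (blockEquiv r).toLinearMap

theorem mem_polyhedron_coordForm {b : Fin r × Fin (2 * h + 2) → ℝ} {x : Fin (2 * r) → ℝ} :
    x ∈ polyhedron (coordForm L) b ↔ blockEquiv r x ∈ polyhedron (defForm L) b := Iff.rfl

theorem active_coordForm {b : Fin r × Fin (2 * h + 2) → ℝ} {x : Fin (2 * r) → ℝ} :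
    active (coordForm L) b x = active (defForm L) b (blockEquiv r x) := rfl

theorem isDeformedProductSystem_coordForm (hh : 1 ≤ h) :
    IsDeformedProductSystem r (2 * h + 2)
      (polyhedron (coordForm L) (fun m => polyRhs h m.2)) := by
  refine ⟨polyMat h, L, fun _ => polyRhs h, ⟨polyRhs h, polyRhs_pos h, isPolygon_polyMat hh⟩, ?_⟩
  ext x
  simp only [polyhedron, Set.mem_ofPred_eq, coordForm, LinearMap.comp_apply, defForm_apply,
    Prod.forall, Pi.le_def, Pi.add_apply, Finset.sum_apply]
  rfl

theorem isPolytope_coordForm (hh : 1 ≤ h) (hL : SmallBlocks L) :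
    IsPolytope (polyhedron (coordForm L) (fun m => polyRhs h m.2)) := by
  refine isPolytope_polyhedron (isBounded_of_abs_le (R := 2 * ((h : ℝ) + 1) ^ 2) fun x hx s => ?_)
  have := (nearRhs_of_mem hh hL (mem_polyhedron_coordForm.1 hx) ⟨s.1 / 2, by omega⟩).2
    ⟨s.1 % 2, by omega⟩
  rw [blockEquiv_apply, coordBlock] at this
  convert this using 3
  exact Fin.ext (by simp only []; omega)

/-- The orthogonal product is the case `L = 0`. Both polyhedra realize exactly the tight sets
satisfying `IsProductActive`. -/
theorem exists_iso_coordForm (hh : 1 ≤ h) (hL : SmallBlocks L) :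
    ∃ Φ : FaceLattice (polygonPower {y | (polyMat h).mulVec y ≤ polyRhs h} r) ≃o
        FaceLattice (polyhedron (coordForm L) (fun m => polyRhs h m.2)),
      ∀ G, IsPolygonTwoFace {y | (polyMat h).mulVec y ≤ polyRhs h} r G.1 → ∃ j κ,
        (Φ G).1 = tightFace (coordForm L) (fun m => polyRhs h m.2) (twoFaceActive j κ) ∧
        ∃ x ∈ polyhedron (coordForm L) (fun m => polyRhs h m.2),
          active (coordForm L) (fun m => polyRhs h m.2) x = twoFaceActive j κ := by
  have hreal : ∀ I, IsProductActive I → ∃ x ∈ polyhedron (coordForm L) (fun m => polyRhs h m.2),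
      active (coordForm L) (fun m => polyRhs h m.2) x = I := by
    intro I hI
    obtain ⟨y, hy, hact⟩ := exists_active_eq_of_isProductActive hh hL hI
    refine ⟨(blockEquiv r).symm y, ?_, ?_⟩
    · rwa [mem_polyhedron_coordForm, LinearEquiv.apply_symm_apply]
    · rwa [active_coordForm, LinearEquiv.apply_symm_apply]
  rw [polygonPower_eq]
  refine ⟨faceLatticeIso
    (fun y hy => hreal _ (isProductActive_of_mem hh smallBlocks_zero hy))
    (fun x hx => exists_active_eq_of_isProductActive hh smallBlocks_zero
      (isProductActive_of_mem hh hL (mem_polyhedron_coordForm.1 hx))), fun G hG => ?_⟩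
  obtain ⟨j, κ, hGJ⟩ := twoFace_eq_tightFace hh hG
  refine ⟨j, κ, ?_, hreal _ (isProductActive_twoFaceActive j κ)⟩
  obtain ⟨y, hy, hact⟩ := exists_active_eq_of_isProductActive hh
    (smallBlocks_zero (h := h) (r := r)) (isProductActive_twoFaceActive j κ)
  rw [← hact] at hGJ ⊢
  exact faceLatticeIso_tightFace _ _ hy hGJ

end DeformedProduct
end PolygonProducts


namespace PolygonProducts
open Module Submodule
open scoped Classical Topology

/-! ### Positively spanning families of rows -/

section PosSpan
variable {ρ γ : Type*} [Fintype ρ] [Fintype γ]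

/-- The rows of the matrix positively span the space of row vectors. -/
def PosSpan (M : Matrix ρ γ ℝ) : Prop :=
  (∃ w : ρ → ℝ, (∀ i, 0 < w i) ∧ Matrix.vecMul w M = 0) ∧ ∀ d : γ → ℝ, M.mulVec d = 0 → d = 0

/-- Injectivity is nonvanishing of the Gram determinant, an open condition, and under it the
positive dependence can be followed continuously. -/
theorem PosSpan.eventually {M : ℝ → Matrix ρ γ ℝ} (hM : Continuous M) (h0 : PosSpan (M 0)) :
    ∀ᶠ t in 𝓝 0, PosSpan (M t) := by
  obtain ⟨⟨w, hw, hwM⟩, hinj⟩ := h0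
  set K : ℝ → Matrix γ γ ℝ := fun t => (M t).transpose * M t with hK
  have hKc : Continuous K := hM.matrix_transpose.matrix_mul hM
  have hker : ∀ t, (K t).det ≠ 0 ↔ ∀ d, (M t).mulVec d = 0 → d = 0 := by
    intro t
    constructor
    · intro hdet d hd
      refine Matrix.eq_zero_of_mulVec_eq_zero hdet ?_
      rw [hK, ← Matrix.mulVec_mulVec, hd, Matrix.mulVec_zero]
    · intro hi hdet
      obtain ⟨d, hd0, hd⟩ := Matrix.exists_mulVec_eq_zero_iff.2 hdet
      refine hd0 (hi d ?_)
      have : dotProduct ((M t).mulVec d) ((M t).mulVec d) = 0 := by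
        rw [Matrix.dotProduct_mulVec, ← Matrix.mulVec_transpose, Matrix.mulVec_mulVec]
        change dotProduct ((K t).mulVec d) d = 0
        rw [hd, zero_dotProduct]
      exact dotProduct_self_eq_zero.1 this
  -- The orthogonal projection of `w` to the left kernel of `M t`, multiplied by the square of the
  -- Gram determinant: no inverse appears, so it is continuous, and at `0` it is a positive multiple
  -- of `w`.
  set v : ℝ → ρ → ℝ := fun t => (K t).det • ((K t).det • w -
    (M t).mulVec ((K t).adjugate.mulVec ((M t).transpose.mulVec w))) with hv
  have hvc : Continuous v := by
    have := hKc.matrix_det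
    have := hKc.matrix_adjugate
    have := hM.matrix_transpose
    fun_prop
  have hv0 : ∀ i, 0 < v 0 i := by
    intro i
    have h1 : (M 0).transpose.mulVec w = 0 := by rw [Matrix.mulVec_transpose, hwM]
    have h2 := (hker 0).2 hinj
    simp only [hv, h1, Matrix.mulVec_zero, sub_zero, Pi.smul_apply, smul_eq_mul]
    have := mul_pos (mul_self_pos.2 h2) (hw i)
    linarith
  have e1 : ∀ᶠ t in 𝓝 (0 : ℝ), (K t).det ≠ 0 :=
    hKc.matrix_det.continuousAt.eventually_ne ((hker 0).2 hinj)
  have e2 : ∀ᶠ t in 𝓝 (0 : ℝ), ∀ i, 0 < v t i := Filter.eventually_all.2 fun i =>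
    ((continuous_apply i).comp hvc).continuousAt.eventually (lt_mem_nhds (hv0 i))
  filter_upwards [e1, e2] with t h1 h2
  refine ⟨⟨v t, h2, ?_⟩, (hker t).1 h1⟩
  rw [← Matrix.mulVec_transpose, hv, Matrix.mulVec_smul, Matrix.mulVec_sub, Matrix.mulVec_smul,
    Matrix.mulVec_mulVec, Matrix.mulVec_mulVec]
  change (K t).det • ((K t).det • _ - (K t * (K t).adjugate).mulVec _) = 0
  rw [Matrix.mul_adjugate, Matrix.smul_mulVec, Matrix.one_mulVec, sub_self, smul_zero]

theorem PosSpan.scale {M N : Matrix ρ γ ℝ} (hM : PosSpan M) {a : ρ → ℝ} {b : γ → ℝ}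
    (ha : ∀ i, 0 < a i) (hb : ∀ c, b c ≠ 0) (hN : ∀ i c, N i c = a i * M i c * b c) :
    PosSpan N := by
  obtain ⟨⟨w, hw, hwM⟩, hinj⟩ := hM
  refine ⟨⟨fun i => w i / a i, fun i => div_pos (hw i) (ha i), ?_⟩, fun d hd => ?_⟩
  · ext c
    have := congrFun hwM c
    simp only [Matrix.vecMul, dotProduct, Pi.zero_apply, hN] at this ⊢
    rw [← zero_mul (b c), ← this, Finset.sum_mul]
    refine Finset.sum_congr rfl fun i _ => ?_
    have := (ha i).ne'
    field_simp
  · have h1 := hinj (fun c => b c * d c) (by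
      ext i
      have := congrFun hd i
      simp only [Matrix.mulVec, dotProduct, Pi.zero_apply, hN] at this ⊢
      refine (mul_eq_zero.1 (?_ : a i * _ = 0)).resolve_left (ha i).ne'
      rw [← this, Finset.mul_sum]
      exact Finset.sum_congr rfl fun c _ => by ring)
    ext c
    exact (mul_eq_zero.1 (congrFun h1 c)).resolve_left (hb c)

theorem eq_zero_of_sum_mul_eq_zero {A d : γ → ℝ} (h : ∑ x, A x * d x = 0) (x₀ : γ)
    (h' : ∀ x, x ≠ x₀ → A x = 0 ∨ d x = 0) (h₀ : A x₀ ≠ 0) : d x₀ = 0 := by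
  rw [Finset.sum_eq_single x₀ (fun x _ hx => mul_eq_zero.2 (h' x hx)) (by simp)] at h
  exact (mul_eq_zero.1 h).resolve_left h₀

end PosSpan

/-! ### The explicit limit matrix -/

section LimitMatrix

/-- The sign of the parity of a row. -/
def parSign (s : Fin 2) : ℝ := if s = 0 then 1 else -1

/-- The entries below the diagonal of the deformed product, before scaling. -/
def lowEntry (m i c : ℕ) (σ : ℝ) (e : Fin 2) : ℝ :=
  if e = 0 then
    if i = m then -(((c : ℝ) + 1) ^ 2 - 2 * ((c : ℝ) + 1) * (m + 2) * σ)
    else if i = m + 1 then -1 else 0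
  else if i < m then (if i = c + 1 then 3 * σ - 1 else 0)
  else if c + 1 < m then (if i = m then ((m : ℝ) + 2) * σ - (c + 2) else 0)
  else σ

/-- An entry of a lower block triangular matrix. -/
def blockEntry (i c : ℕ) (l v : ℝ) : ℝ := if c < i then l else if c = i then v else 0

/-- The limit of the matrices formed by the normal vectors of the facets at a polygon `2`-face. -/
def limitMatrix (m : ℕ) (j : Fin (m + 2)) (θ : Fin (m + 2) → ℝ) :
    Matrix ({i : Fin (m + 2) // i ≠ j} × Fin 2) (Fin m × Fin 2) ℝ := fun x y =>
  blockEntry x.1.1.1 y.1.1 (lowEntry m x.1.1.1 y.1.1 (parSign x.2) y.2)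
    (if y.2 = 0 then (if x.2 = 0 then 1 else θ x.1.1) else 0)

variable {m : ℕ} {j : Fin (m + 2)} {θ : Fin (m + 2) → ℝ}

/-- The blocks below `m` eliminate all columns except those that relied on the missing block `j`,
and column `(m - 1, 1)`. The blocks `m` and `m + 1` take care of these. -/
theorem limitMatrix_injective (hθ : ∀ i, θ i = 1 ∨ θ i = -1) {d : Fin m × Fin 2 → ℝ}
    (hd : (limitMatrix m j θ).mulVec d = 0) : d = 0 := by
  have hrow : ∀ (i : Fin (m + 2)) (hi : i ≠ j) (s : Fin 2),
      ∑ y, limitMatrix m j θ (⟨i, hi⟩, s) y * d y = 0 := fun i hi s => congrFun hd (⟨i, hi⟩, s)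
  have hcomb : ∀ (i : Fin (m + 2)) (hi : i ≠ j) (α β : ℝ),
      ∑ y, (α * limitMatrix m j θ (⟨i, hi⟩, 0) y + β * limitMatrix m j θ (⟨i, hi⟩, 1) y) * d y
        = 0 := by
    intro i hi α β
    simp only [add_mul, mul_assoc, Finset.sum_add_distrib, ← Finset.mul_sum, hrow i hi]
    simp
  have hA0 : ∀ (c : Fin m), c.1 ≠ j.1 → d (c, 0) = 0 := by
    intro c hc
    -- The entries `3σ - 1` are `2` and `-4`, so twice the first row plus the second cancels them
    -- and leaves `2 + θ ≠ 0` in column `(c, 0)`.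
    refine eq_zero_of_sum_mul_eq_zero
      (hcomb ⟨c.1, by omega⟩ (fun h => hc (by rw [← h])) 2 1) (c, 0) ?_ ?_
    · rintro ⟨c', e⟩ hne
      left
      fin_cases e
      · have : c'.1 ≠ c.1 := fun h => hne (by rw [Fin.ext h]; rfl)
        have h1 := c.2
        simp [limitMatrix, blockEntry, lowEntry, this, h1.ne, (show c.1 ≠ m + 1 by omega)]
      · have h1 := c.2
        simp only [limitMatrix, blockEntry, lowEntry, parSign]
        by_cases h2 : c.1 = c'.1 + 1
        · rw [h2] at h1
          simp [h1, h2]; norm_num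
        · simp [h1, h2]
    · rcases hθ ⟨c.1, by omega⟩ with h | h <;> simp [limitMatrix, blockEntry, h] <;> norm_num
  have hA1 : ∀ (c : Fin m), c.1 + 1 < m → c.1 + 1 ≠ j.1 → d (c, 1) = 0 := by
    intro c hc hcj
    refine eq_zero_of_sum_mul_eq_zero
      (hrow ⟨c.1 + 1, by omega⟩ (fun h => hcj (by rw [← h])) 0) (c, 1) ?_ ?_
    · rintro ⟨c', e⟩ hne
      fin_cases e
      · by_cases h : c'.1 = c.1 + 1
        · right
          exact hA0 c' (h ▸ hcj)
        · left
          simp [limitMatrix, blockEntry, lowEntry, h, hc.ne, (show c.1 ≠ m by omega)]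
      · left
        have : c.1 ≠ c'.1 := fun h => hne (by rw [Fin.ext h]; rfl)
        simp [limitMatrix, blockEntry, lowEntry, hc, this]
    · simp [limitMatrix, blockEntry, lowEntry, hc, parSign]; norm_num
  -- The sum of the two rows of block `m + 1` retains only the columns `(c, 0)`, their difference
  -- only the column `(m - 1, 1)`.
  have hlast : j.1 ≠ m + 1 → (∀ c : Fin m, d (c, 0) = 0) ∧ ∀ c : Fin m, c.1 + 1 = m → d (c, 1) = 0 := by
    intro hj
    have hj' : (⟨m + 1, by omega⟩ : Fin (m + 2)) ≠ j := fun h => hj (by rw [← h])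
    constructor
    · intro c
      by_cases hc : c.1 = j.1
      · refine eq_zero_of_sum_mul_eq_zero (hcomb _ hj' 1 1) (c, 0) ?_ ?_
        · rintro ⟨c', e⟩ hne
          fin_cases e
          · right
            exact hA0 c' fun h => hne (by rw [Fin.ext (h.trans hc.symm)]; rfl)
          · left
            have := c'.2
            by_cases h : c'.1 + 1 < m <;>
            simp [limitMatrix, blockEntry, lowEntry, parSign, h]
        · have := c.2
          simp [limitMatrix, blockEntry, lowEntry, (show c.1 < m + 1 by omega)]
      · exact hA0 c hc
    · intro c hc
      refine eq_zero_of_sum_mul_eq_zero (hcomb _ hj' 1 (-1)) (c, 1) ?_ ?_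
      · rintro ⟨c', e⟩ hne
        left
        fin_cases e
        · have := c'.2
          simp [limitMatrix, blockEntry, lowEntry, (show c'.1 < m + 1 by omega)]
        · have : c'.1 + 1 < m := by
            have : c'.1 ≠ c.1 := fun h => hne (by rw [Fin.ext h]; rfl)
            omega
          simp [limitMatrix, blockEntry, lowEntry, this]
      · simp [limitMatrix, blockEntry, lowEntry, parSign, (show c.1 < m + 1 by omega),
          (show ¬ c.1 + 1 < m by omega)]
  -- The even row of block `m` has the entry `m - c₀ > 0`, or `1` if `c₀ = m - 1`, at the last
  -- unknown.
  have hmid : j.1 ≠ m → ∀ c₀ : Fin m, (∀ x, x ≠ (c₀, 1) → d x = 0) →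
      (c₀.1 + 1 < m → c₀.1 + 1 = j.1) → d (c₀, 1) = 0 := by
    intro hj c₀ hx hc₀
    have hj' : (⟨m, by omega⟩ : Fin (m + 2)) ≠ j := fun h => hj (by rw [← h])
    refine eq_zero_of_sum_mul_eq_zero (hrow _ hj' 0) (c₀, 1) (fun x hne => .inr (hx x hne)) ?_
    by_cases h : c₀.1 + 1 < m
    · have h1 : (c₀.1 : ℝ) + 1 < m := by exact_mod_cast h
      simp [limitMatrix, blockEntry, lowEntry, parSign, h]
      linarith
    · simp [limitMatrix, blockEntry, lowEntry, parSign, h]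
  ext ⟨c, e⟩
  change d (c, e) = 0
  by_cases hj1 : j.1 = m + 1
  · have h0 : ∀ c : Fin m, d (c, 0) = 0 := fun c => hA0 c (by omega)
    fin_cases e
    · exact h0 c
    · by_cases hc : c.1 + 1 < m
      · exact hA1 c hc (by omega)
      · refine hmid (by omega) c ?_ (fun h => absurd h hc)
        rintro ⟨c', e⟩ hne
        fin_cases e
        · exact h0 c'
        · have : c'.1 ≠ c.1 := fun h => hne (by rw [Fin.ext h]; rfl)
          exact hA1 c' (by omega) (by omega)
  · obtain ⟨h0, h1⟩ := hlast hj1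
    fin_cases e
    · exact h0 c
    · change d (c, 1) = 0
      by_cases hc : c.1 + 1 < m
      · by_cases hcj : c.1 + 1 = j.1
        · refine hmid (by omega) c ?_ (fun _ => hcj)
          rintro ⟨c', e⟩ hne
          fin_cases e
          · exact h0 c'
          · have : c'.1 ≠ c.1 := fun h => hne (by rw [Fin.ext h]; rfl)
            by_cases hc' : c'.1 + 1 < m
            · exact hA1 c' hc' (by omega)
            · exact h1 c' (by omega)
        · exact hA1 c hc hcj
      · exact h1 c (by omega)

theorem sum_subtype_ne {ι : Type*} [Fintype ι] [DecidableEq ι] (j : ι) {F : ι → ℝ} (hF : F j = 0) :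
    ∑ i : {i // i ≠ j}, F i = ∑ i, F i := by
  rw [← Finset.sum_erase (a := j) Finset.univ hF]
  exact (Finset.sum_subtype (Finset.univ.erase j) (by simp) F).symm

/-- The sum of the coefficients of two rows in the positive dependence of the limit matrix. -/
noncomputable def depSum (m j : ℕ) (p q t : ℝ) (θ : ℝ) (i : ℕ) : ℝ :=
  if i = m then p else if i = m + 1 then t else if i = j then 0 else
    if θ = 1 then t - 2 * (i + 1) * (m + 2) * q + (i + 1) ^ 2 * p
    else 3 * (t - 2 * (i + 1) * (m + 2) * q + (i + 1) ^ 2 * p) + ((m + 2) * q - (i + 1) * p)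

/-- The difference of the coefficients of two rows in the positive dependence of the limit
matrix. -/
noncomputable def depDiff (m j : ℕ) (p q t : ℝ) (θ : ℝ) (i : ℕ) : ℝ :=
  if i = m then q else if i = m + 1 then -q else if i = j then 0 else
    if θ = 1 then
      ((t - 2 * (i + 1) * (m + 2) * q + (i + 1) ^ 2 * p) - ((m + 2) * q - (i + 1) * p)) / 3
    else t - 2 * (i + 1) * (m + 2) * q + (i + 1) ^ 2 * p

/-- The weights of a pair of rows are `(S ± D) / 2`; against an entry `A + Bσ` they contribute `A S
+ B D`. Put `f i = t - 2(i+1)(m+2)q + (i+1)² p` and `g i = (m+2)q - (i+1)p`. Column `(i, 0)`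
requires `S = f i` if `θ = 1` and `D = f i` if `θ = -1`; column `(i - 1, 1)` requires `3D - S = -g
i`. Positivity `|D| < S` then follows from `|g i| < 2 f i`, and block `j` can be absent because `f`
and `g` vanish at `j`, or because its weights are zero when `j ≥ m`. -/
theorem limitMatrix_dependence (hθ : ∀ i, θ i = 1 ∨ θ i = -1) {p q t : ℝ}
    (hf : ∀ i : ℕ, i < m → i = j.1 → t - 2 * ((i : ℝ) + 1) * (m + 2) * q + (i + 1) ^ 2 * p = 0 ∧
      ((m : ℝ) + 2) * q - (i + 1) * p = 0)
    (hpos : ∀ i : ℕ, i < m → i ≠ j.1 →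
      |((m : ℝ) + 2) * q - (i + 1) * p| <
        2 * (t - 2 * ((i : ℝ) + 1) * (m + 2) * q + (i + 1) ^ 2 * p))
    (hp : j.1 ≠ m → |q| < p) (hp' : j.1 = m → p = 0 ∧ q = 0)
    (ht : j.1 ≠ m + 1 → |q| < t) (ht' : j.1 = m + 1 → t = 0 ∧ q = 0) :
    ∃ w, (∀ i, 0 < w i) ∧ Matrix.vecMul w (limitMatrix m j θ) = 0 := by
  have hm1 : m + 1 ≠ m := by omega
  refine ⟨fun x => (depSum m j p q t (θ x.1) x.1.1.1 +
    parSign x.2 * depDiff m j p q t (θ x.1) x.1.1.1) / 2, ?_, ?_⟩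
  · rintro ⟨⟨i, hi⟩, s⟩
    have hij : i.1 ≠ j.1 := fun h => hi (Fin.ext h)
    refine div_pos ?_ two_pos
    suffices |depDiff m j p q t (θ i) i.1| < depSum m j p q t (θ i) i.1 by
      have := abs_lt.1 this
      fin_cases s <;> simp [parSign] <;> linarith
    by_cases h1 : i.1 = m
    · simp only [depDiff, depSum, h1, if_true]
      exact hp (by omega)
    by_cases h2 : i.1 = m + 1
    · simp only [depDiff, depSum, h2, if_true, hm1, if_false, abs_neg]
      exact ht (by omega)
    have := abs_lt.1 (hpos i.1 (by omega) hij)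
    simp only [depDiff, depSum, h1, h2, hij, if_false]
    split_ifs
    · rw [abs_lt]; constructor <;> linarith
    · rw [abs_lt]; constructor <;> linarith
  · ext ⟨c, e⟩
    have hcm := c.2
    simp only [Matrix.vecMul, dotProduct, Pi.zero_apply, Fintype.sum_prod_type, Fin.sum_univ_two]
    set F : Fin (m + 2) → ℝ := fun i =>
      (depSum m j p q t (θ i) i.1 + parSign 0 * depDiff m j p q t (θ i) i.1) / 2 *
        blockEntry i.1 c.1 (lowEntry m i.1 c.1 (parSign 0) e) (if e = 0 then 1 else 0) +
      (depSum m j p q t (θ i) i.1 + parSign 1 * depDiff m j p q t (θ i) i.1) / 2 *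
        blockEntry i.1 c.1 (lowEntry m i.1 c.1 (parSign 1) e) (if e = 0 then θ i else 0) with hF
    have hFj : F j = 0 := by
      simp only [hF, depSum, depDiff]
      by_cases h1 : j.1 = m
      · simp [h1, hp' h1]
      by_cases h2 : j.1 = m + 1
      · simp [h2, ht' h2]
      simp [h1, h2]
    have hgoal := sum_subtype_ne j hFj
    refine Eq.trans ?_ (hgoal.trans ?_)
    · refine Finset.sum_congr rfl fun i _ => ?_
      simp [hF, limitMatrix]
    rw [Fin.sum_univ_castSucc, Fin.sum_univ_castSucc]
    have hFm : ∀ i : Fin (m + 2), i.1 = m → F i =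
        if e = 0 then -(((c.1 : ℝ) + 1) ^ 2 * p - 2 * ((c.1 : ℝ) + 1) * (m + 2) * q)
        else if c.1 + 1 < m then ((m : ℝ) + 2) * q - (c.1 + 2) * p else q := by
      intro i hi
      simp only [hF, depSum, depDiff, blockEntry, lowEntry, hi, if_true, hcm, parSign]
      fin_cases e
      · simp; ring
      · by_cases h : c.1 + 1 < m <;> simp [h] <;> ring
    have hFm1 : ∀ i : Fin (m + 2), i.1 = m + 1 → F i =
        if e = 0 then -t else if c.1 + 1 < m then 0 else -q := by
      intro i hi
      have : c.1 < m + 1 := by omega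
      simp only [hF, depSum, depDiff, blockEntry, lowEntry, hi, if_true, this, parSign, hm1,
        if_false]
      fin_cases e
      · simp; ring
      · by_cases h : c.1 + 1 < m <;> simp [h] <;> ring
    have hFi : ∀ i : Fin (m + 2), i.1 < m → F i =
        if e = 0 then
          if i.1 = c.1 then t - 2 * ((c.1 : ℝ) + 1) * (m + 2) * q + (c.1 + 1) ^ 2 * p else 0
        else if i.1 = c.1 + 1 then -(((m : ℝ) + 2) * q - (c.1 + 2) * p) else 0 := by
      intro i hi
      have n1 : i.1 ≠ m := by omega
      have n2 : i.1 ≠ m + 1 := by omega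
      by_cases hij : i.1 = j.1
      · obtain ⟨f0, g0⟩ := hf i.1 hi hij
        rw [Fin.ext hij, hFj]
        rw [hij] at f0 g0
        by_cases he : e = 0
        · by_cases h : j.1 = c.1
          · rw [h] at f0; simp [he, h, f0]
          · simp [he, h]
        · by_cases h : j.1 = c.1 + 1
          · rw [h] at g0; push_cast at g0
            simp only [he, h, if_true, if_false]; linarith
          · simp [he, h]
      · simp only [hF, depSum, depDiff, blockEntry, lowEntry, n1, n2, hij, if_false, parSign, hi,
          if_true]
        fin_cases e
        · by_cases h : i.1 = c.1
          · rcases hθ i with h3 | h3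
            · simp [h, h3]; ring
            · simp [h, h3, (show (-1 : ℝ) ≠ 1 by norm_num)]; ring
          · have : c.1 ≠ i.1 := fun h' => h h'.symm
            simp [h, this]
        · by_cases h : i.1 = c.1 + 1
          · rcases hθ i with h3 | h3
            · simp [h, h3]; ring
            · simp [h, h3, (show (-1 : ℝ) ≠ 1 by norm_num)]; ring
          · simp [h]
    rw [hFm _ (by simp), hFm1 _ (by simp)]
    have hsum : ∑ i : Fin m, F i.castSucc.castSucc = ∑ i : Fin m,
        if e = 0 then
          if i.1 = c.1 then t - 2 * ((c.1 : ℝ) + 1) * (m + 2) * q + (c.1 + 1) ^ 2 * p else 0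
        else if i.1 = c.1 + 1 then -(((m : ℝ) + 2) * q - (c.1 + 2) * p) else 0 :=
      Finset.sum_congr rfl fun i _ => hFi _ (by simp)
    rw [hsum]
    by_cases he : e = 0
    · simp only [he, if_true]
      rw [Finset.sum_eq_single c (fun i _ hi => if_neg fun h => hi (Fin.ext h)) (by simp)]
      simp
    · simp only [he, if_false]
      by_cases hc : c.1 + 1 < m
      · rw [Finset.sum_eq_single ⟨c.1 + 1, hc⟩ (fun i _ hi => if_neg fun h => hi (Fin.ext h))
          (by simp)]
        simp [hc]
      · rw [Finset.sum_eq_zero fun i _ => if_neg (by omega)]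
        simp [hc]

theorem posSpan_limitMatrix (j : Fin (m + 2)) (hθ : ∀ i, θ i = 1 ∨ θ i = -1) :
    PosSpan (limitMatrix m j θ) := by
  refine ⟨?_, fun d hd => limitMatrix_injective hθ hd⟩
  have hm : (0 : ℝ) < (m : ℝ) + 2 := by positivity
  by_cases h1 : j.1 = m
  · refine limitMatrix_dependence hθ (p := 0) (q := 0) (t := 1) ?_ ?_ ?_ ?_ ?_ ?_
    · intro i hi hij; omega
    · intro i hi hij; simp
    · intro h; exact absurd h1 h
    · intro; simp
    · intro; simp
    · intro; omega
  by_cases h2 : j.1 = m + 1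
  · refine limitMatrix_dependence hθ (p := 1) (q := 0) (t := 0) ?_ ?_ ?_ ?_ ?_ ?_
    · intro i hi hij; omega
    · intro i hi hij
      have : (0 : ℝ) ≤ i := by positivity
      rw [abs_lt]; constructor <;> nlinarith
    · intro; simp
    · intro; omega
    · intro h; exact absurd h2 h
    · intro; simp
  have h3 : (j.1 : ℝ) + 1 < m + 2 := by
    have : j.1 + 1 < m + 2 := by omega
    exact_mod_cast this
  have h4 : ((j.1 : ℝ) + 1) / (m + 2) < 1 := (div_lt_one hm).2 h3
  have h5 : 0 < ((j.1 : ℝ) + 1) / (m + 2) := by positivity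
  have h6 : ((m : ℝ) + 2) * (((j.1 : ℝ) + 1) / (m + 2)) = j.1 + 1 := by field_simp
  -- This choice gives `f i = (j - i)²` and `g i = j - i`, which vanish exactly at the missing
  -- block.
  refine limitMatrix_dependence hθ (p := 1) (q := ((j.1 : ℝ) + 1) / (m + 2))
    (t := ((j.1 : ℝ) + 1) ^ 2) ?_ ?_ ?_ ?_ ?_ ?_
  · intro i hi hij
    rw [mul_assoc _ ((m : ℝ) + 2), h6, hij]
    constructor <;> ring
  · intro i hi hij
    rw [mul_assoc _ ((m : ℝ) + 2), h6]
    have h7 : (1 : ℝ) ≤ ((j.1 : ℝ) - i) ^ 2 := by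
      have : (1 : ℤ) ≤ ((j.1 : ℤ) - i) ^ 2 := by
        have : (0 : ℤ) < ((j.1 : ℤ) - i) ^ 2 := by
          have : ((j.1 : ℤ) - i) ≠ 0 := by omega
          positivity
        omega
      exact_mod_cast this
    rw [abs_lt]; constructor <;> nlinarith [sq_nonneg ((j.1 : ℝ) - i - 1), sq_nonneg ((j.1 : ℝ) - i + 1)]
  · intro; rw [abs_of_pos h5]; exact h4
  · intro h; exact absurd h h1
  · intro
    rw [abs_of_pos h5]
    refine h4.trans_le ?_
    have : (0 : ℝ) ≤ j.1 := by positivity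
    nlinarith
  · intro h; exact absurd h h2

end LimitMatrix
end PolygonProducts


namespace PolygonProducts
open Module Submodule
open scoped Classical Topology

/-! ### Survival of the polygon faces of the deformed product -/

section Survival
variable {m h : ℕ}

/-- The parity of the index of an edge. -/
def parity (k : Fin (2 * h + 2)) : Fin 2 := ⟨k.1 % 2, by omega⟩

/-- The member of the pair `k, k + 1` of adjacent edges with a given parity. -/
def pairMember (k : Fin (2 * h + 2)) (s : Fin 2) : Fin (2 * h + 2) :=
  if parity k = s then k else k + 1

/-- The evenness of the number of edges enters here: the parity also changes from the edge `2h + 1`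
to the edge `0`. -/
theorem parity_add_one (k : Fin (2 * h + 2)) : parity (k + 1) ≠ parity k := by
  have := val_add_one_polygon k
  simp only [parity, ne_eq, Fin.mk.injEq]
  split_ifs at this <;> omega

theorem parity_pairMember (k : Fin (2 * h + 2)) (s : Fin 2) : parity (pairMember k s) = s := by
  have := parity_add_one k
  unfold pairMember
  split_ifs with h
  · exact h
  · omega

theorem pairMember_eq_or (k : Fin (2 * h + 2)) (s : Fin 2) :
    pairMember k s = k ∨ pairMember k s = k + 1 := by
  unfold pairMember; split_ifs <;> simp

theorem exists_pairMember {k l : Fin (2 * h + 2)} (hl : l = k ∨ l = k + 1) :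
    pairMember k (parity l) = l := by
  rcases hl with rfl | rfl
  · simp [pairMember]
  · simp [pairMember, (parity_add_one k).symm]

/-- The only edge whose normal has first coordinate `-1` is `2h + 1`, which is odd. Hence the sign
`θ` occurs only in odd rows. -/
theorem polyMat_pairMember_zero (k : Fin (2 * h + 2)) : polyMat h (pairMember k 0) 0 = 1 := by
  have h1 := parity_pairMember k 0
  simp only [parity, Fin.ext_iff] at h1
  have h2 : (pairMember k 0).1 ≠ 2 * h + 1 := by
    intro h; rw [h] at h1; simp only [Fin.val_zero] at h1; omega
  simp [polyMat, h2]

theorem polyMat_apply_zero (k : Fin (2 * h + 2)) : polyMat h k 0 = 1 ∨ polyMat h k 0 = -1 := by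
  by_cases hk : k.1 = 2 * h + 1 <;> simp [polyMat, hk]

/-- The normal vectors of the facets at a polygon `2`-face, without the last four coordinates. -/
def normalMatrix (L : Fin (m + 2) → Fin (m + 2) → Matrix (Fin (2 * h + 2)) (Fin 2) ℝ)
    (j : Fin (m + 2)) (κ : Fin (m + 2) → Fin (2 * h + 2)) :
    Matrix ({i : Fin (m + 2) // i ≠ j} × Fin 2) (Fin m × Fin 2) ℝ := fun x y =>
  blockEntry x.1.1.1 y.1.1
    (L x.1 y.1.castSucc.castSucc (pairMember (κ x.1) x.2) y.2)
    (polyMat h (pairMember (κ x.1) x.2) y.2)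

/-- At `t = 0` the second column of each diagonal block vanishes and the limit matrix remains. There
are finitely many choices of `j` and `κ`, so one neighbourhood of `0` serves all. -/
theorem eventually_posSpan (m h : ℕ) : ∀ᶠ t : ℝ in 𝓝 0, ∀ (j : Fin (m + 2))
    (κ : Fin (m + 2) → Fin (2 * h + 2)),
    PosSpan (fun (x : {i : Fin (m + 2) // i ≠ j} × Fin 2) (y : Fin m × Fin 2) =>
      blockEntry x.1.1.1 y.1.1 (lowEntry m x.1.1.1 y.1.1 (parSign x.2) y.2)
        ((if y.2 = 0 then 1 else t) * polyMat h (pairMember (κ x.1) x.2) y.2)) := by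
  rw [Filter.eventually_all]
  intro j
  rw [Filter.eventually_all]
  intro κ
  refine PosSpan.eventually (M := fun (t : ℝ)
    (x : {i : Fin (m + 2) // i ≠ j} × Fin 2) (y : Fin m × Fin 2) => blockEntry x.1.1.1 y.1.1
    (lowEntry m x.1.1.1 y.1.1 (parSign x.2) y.2)
    ((if y.2 = 0 then 1 else t) * polyMat h (pairMember (κ x.1) x.2) y.2)) ?_ ?_
  · refine continuous_matrix fun x y => ?_
    unfold blockEntry
    split_ifs <;> fun_prop
  · refine (congrArg PosSpan ?_).mpr (posSpan_limitMatrix (m := m)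
      (θ := fun i => polyMat h (pairMember (κ i) 1) 0) j fun i => polyMat_apply_zero _)
    ext ⟨i, s⟩ ⟨c, e⟩
    simp only [limitMatrix]
    congr 1
    by_cases he : e = 0
    · by_cases hs : s = 0
      · simp [he, hs, polyMat_pairMember_zero]
      · obtain rfl : s = 1 := by omega
        simp [he]
    · simp [he]

/-- Scaling row block `i` by `ε^i` and column block `c` by `ε^(-c)` fixes the diagonal blocks and
multiplies the lower ones by `ε^(i - c)`, so they become small. The factor `t⁻¹` on the second
columns restores the true diagonal blocks. -/
theorem exists_smallBlocks (m h : ℕ) :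
    ∃ L : Fin (m + 2) → Fin (m + 2) → Matrix (Fin (2 * h + 2)) (Fin 2) ℝ, SmallBlocks L ∧
      ∀ j κ, PosSpan (normalMatrix L j κ) := by
  obtain ⟨t, ht, ht0⟩ := (((eventually_posSpan m h).filter_mono nhdsWithin_le_nhds).and
    (self_mem_nhdsWithin (a := (0 : ℝ)) (s := Set.Ioi 0))).exists
  replace ht0 : 0 < t := ht0
  set L : ℝ → Fin (m + 2) → Fin (m + 2) → Matrix (Fin (2 * h + 2)) (Fin 2) ℝ :=
    fun ε i c k e => if c.1 < i.1 then
      ε ^ (i.1 - c.1) * ((if e = 0 then 1 else t⁻¹) * lowEntry m i.1 c.1 (parSign (parity k)) e)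
      else 0 with hL
  have hsmall : ∀ᶠ ε : ℝ in 𝓝 0, SmallBlocks (L ε) := by
    unfold SmallBlocks
    simp only [Filter.eventually_all]
    intro i c k e
    have hcont : Continuous fun ε => |L ε i c k e| * (16 * ((m + 2 : ℕ) : ℝ) * ((h : ℝ) + 1) ^ 2) := by
      simp only [hL]
      split_ifs <;> fun_prop
    have h0 : |L 0 i c k e| * (16 * ((m + 2 : ℕ) : ℝ) * ((h : ℝ) + 1) ^ 2) < 1 := by
      simp only [hL]
      by_cases hci : c.1 < i.1
      · rw [if_pos hci, zero_pow (Nat.sub_ne_zero_of_lt hci)]; simp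
      · rw [if_neg hci]; simp
    exact (hcont.continuousAt.eventually (gt_mem_nhds h0)).mono fun _ => le_of_lt
  obtain ⟨ε, hε, hε0⟩ := ((hsmall.filter_mono nhdsWithin_le_nhds).and
    (self_mem_nhdsWithin (a := (0 : ℝ)) (s := Set.Ioi 0))).exists
  replace hε0 : 0 < ε := hε0
  refine ⟨L ε, hε, fun j κ => (ht j κ).scale (a := fun x => ε ^ x.1.1.1)
    (b := fun y => (ε ^ y.1.1)⁻¹ * if y.2 = 0 then 1 else t⁻¹) (fun x => by positivity)
    (fun y => by split_ifs <;> positivity) ?_⟩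
  rintro ⟨⟨i, hi⟩, s⟩ ⟨c, e⟩
  simp only [normalMatrix, blockEntry, hL, parity_pairMember, Fin.val_castSucc]
  by_cases h1 : c.1 < i.1
  · simp only [h1, if_true]
    rw [pow_sub₀ _ hε0.ne' h1.le]
    ring
  · by_cases h2 : c.1 = i.1
    · simp only [h2, if_true, if_false, lt_irrefl]
      by_cases he : e = 0
      · simp only [he, if_true]; field_simp
      · simp only [he, if_false]; field_simp
    · simp [h1, h2]

theorem defForm_eq_sum {L : Fin (m + 2) → Fin (m + 2) → Matrix (Fin (2 * h + 2)) (Fin 2) ℝ}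
    {y : Fin (m + 2) → Fin 2 → ℝ} (hy : ∀ i : Fin (m + 2), m ≤ i.1 → y i = 0) (i : Fin (m + 2))
    (k : Fin (2 * h + 2)) :
    defForm L (i, k) y = ∑ c : Fin m × Fin 2, blockEntry i.1 c.1.1
      (L i c.1.castSucc.castSucc k c.2) (polyMat h k c.2) * y c.1.castSucc.castSucc c.2 := by
  have h1 : defForm L (i, k) y = ∑ c : Fin (m + 2), ∑ e,
      blockEntry i.1 c.1 (L i c k e) (polyMat h k e) * y c e := by
    have h0 : (polyMat h).mulVec (y i) k =
        ∑ c, if c = i then (polyMat h).mulVec (y c) k else 0 := by simp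
    rw [defForm_apply, Finset.sum_filter, h0, ← Finset.sum_add_distrib]
    refine Finset.sum_congr rfl fun c _ => ?_
    simp only [Matrix.mulVec, dotProduct, blockEntry, Fin.lt_def, Fin.ext_iff]
    by_cases h1 : c.1 < i.1
    · simp [h1, h1.ne]
    · by_cases h2 : c.1 = i.1 <;> simp [h1, h2]
  rw [h1, Fin.sum_univ_castSucc, Fin.sum_univ_castSucc, hy _ (by simp), hy _ (by simp),
    Fintype.sum_prod_type]
  simp

/-- On the kernel of the projection the last two blocks vanish and the tight forms are the rows of
`normalMatrix`. Their positive dependence says that a positive combination of the forms vanishes on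
the kernel; the injectivity clause is the one needed on the face. -/
theorem survives_twoFace (hr : 2 ≤ m + 2)
    {L : Fin (m + 2) → Fin (m + 2) → Matrix (Fin (2 * h + 2)) (Fin 2) ℝ} {j : Fin (m + 2)}
    {κ : Fin (m + 2) → Fin (2 * h + 2)} (hL : PosSpan (normalMatrix L j κ))
    {b : Fin (m + 2) × Fin (2 * h + 2) → ℝ} {x₀ : Fin (2 * (m + 2)) → ℝ}
    (hx₀ : x₀ ∈ polyhedron (coordForm L) b) (hact : active (coordForm L) b x₀ = twoFaceActive j κ) :
    Survives (lastFour (m + 2) hr) (polyhedron (coordForm L) b)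
      (tightFace (coordForm L) b (twoFaceActive j κ)) := by
  obtain ⟨⟨w, hw, hwM⟩, hinj⟩ := hL
  have hker : ∀ d, lastFour (m + 2) hr d = 0 → ∀ i : Fin (m + 2), m ≤ i.1 →
      blockEquiv (m + 2) d i = 0 := by
    intro d hd i hi
    ext c
    have h1 := congrFun hd ⟨2 * i.1 + c.1 - 2 * m, by omega⟩
    rw [blockEquiv_apply, coordBlock]
    refine Eq.trans ?_ h1
    simp only [lastFour, LinearMap.funLeft_apply]
    congr 1
    exact Fin.ext (by simp only []; omega)
  have hrow : ∀ d, lastFour (m + 2) hr d = 0 → ∀ x : {i : Fin (m + 2) // i ≠ j} × Fin 2,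
      coordForm L (x.1.1, pairMember (κ x.1) x.2) d = (normalMatrix L j κ).mulVec
        (fun c => blockEquiv (m + 2) d c.1.castSucc.castSucc c.2) x := fun d hd x =>
    defForm_eq_sum (hker d hd) x.1.1 _
  set g : {i : Fin (m + 2) // i ≠ j} × Fin 2 → Fin (m + 2) × Fin (2 * h + 2) :=
    fun x => (x.1.1, pairMember (κ x.1) x.2) with hg
  have hginj : Function.Injective g := by
    rintro ⟨⟨i, hi⟩, s⟩ ⟨⟨i', hi'⟩, s'⟩ hxy
    simp only [hg, Prod.mk.injEq] at hxy
    obtain ⟨rfl, h2⟩ := hxy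
    have := congrArg parity h2
    rw [parity_pairMember, parity_pairMember] at this
    rw [this]
  have hgimage : twoFaceActive j κ = Finset.univ.image g := by
    ext ⟨i, l⟩
    rw [mem_twoFaceActive, Finset.mem_image]
    constructor
    · rintro ⟨h1, h2⟩
      exact ⟨(⟨i, h1⟩, parity l), Finset.mem_univ _, Prod.ext rfl (exists_pairMember h2)⟩
    · rintro ⟨x, -, hx⟩
      rw [← hx]
      exact ⟨x.1.2, pairMember_eq_or _ _⟩
  have hsum : ∀ d, ∑ p ∈ twoFaceActive j κ, Function.extend g w 0 p * coordForm L p d =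
      ∑ x, w x * coordForm L (g x) d := by
    intro d
    rw [hgimage, Finset.sum_image fun x _ y _ hxy => hginj hxy]
    exact Finset.sum_congr rfl fun x _ => by rw [hginj.extend_apply]
  set f : (Fin (2 * (m + 2)) → ℝ) →ₗ[ℝ] ℝ := ∑ x, w x • coordForm L (g x) with hf
  have hfapp : ∀ d, f d = ∑ x, w x * coordForm L (g x) d := fun d => by simp [hf]
  have hf0 : ∀ d, lastFour (m + 2) hr d = 0 → f d = 0 := by
    intro d hd
    rw [hfapp]
    simp only [hg, hrow d hd]
    change dotProduct w ((normalMatrix L j κ).mulVec _) = 0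
    rw [Matrix.dotProduct_mulVec, hwM, zero_dotProduct]
  have hsurj : Function.Surjective (lastFour (m + 2) hr) :=
    LinearMap.funLeft_surjective_of_injective _ _ _ fun a b hab => by
      have := congrArg Fin.val hab
      exact Fin.ext (by simp only [] at this; omega)
  -- Since `f` vanishes on the kernel, composing it with any section of the projection gives the
  -- functional through which it factors.
  obtain ⟨σ, hσ⟩ := LinearMap.exists_rightInverse_of_surjective _ (LinearMap.range_eq_top.2 hsurj)
  refine survives_tightFace (ψ := f ∘ₗ σ) hx₀ hact (w := Function.extend g w 0) ?_ ?_ ?_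
  · intro p hp
    rw [hgimage] at hp
    obtain ⟨x, -, rfl⟩ := Finset.mem_image.1 hp
    rw [hginj.extend_apply]
    exact hw x
  · intro d
    rw [hsum, ← hfapp, LinearMap.comp_apply, ← sub_eq_zero, ← map_sub]
    refine hf0 _ ?_
    rw [map_sub, sub_eq_zero]
    exact (LinearMap.congr_fun hσ _).symm
  · intro d hd hd'
    have h1 := hinj (fun c => blockEquiv (m + 2) d c.1.castSucc.castSucc c.2) (by
      ext x
      rw [← hrow d hd]
      exact hd' _ (mem_twoFaceActive.2 ⟨x.1.2, pairMember_eq_or _ _⟩))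
    refine (blockEquiv (m + 2)).map_eq_zero_iff.1 ?_
    ext i c
    by_cases hi : m ≤ i.1
    · rw [hker d hd i hi]; rfl
    · exact congrFun h1 (⟨i.1, by omega⟩, c)

end Survival

theorem exists_isSurvivingPolygonProduct {r n : ℕ} (hr : 2 ≤ r) (hn : 4 ≤ n) (heven : Even n) :
    ∃ P : Set (Fin (2 * r) → ℝ),
      IsDeformedProductSystem r n P ∧ IsSurvivingPolygonProduct r n hr P := by
  obtain ⟨m, rfl⟩ := Nat.exists_eq_add_of_le' hr
  obtain ⟨h, rfl⟩ : ∃ h, n = 2 * h + 2 := by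
    obtain ⟨a, ha⟩ := heven
    exact ⟨a - 1, by omega⟩
  have hh : 1 ≤ h := by omega
  obtain ⟨L, hL, hspan⟩ := exists_smallBlocks m h
  obtain ⟨Φ, hΦ⟩ := exists_iso_coordForm hh hL
  refine ⟨_, isDeformedProductSystem_coordForm (L := L) hh, isPolytope_coordForm hh hL, _,
    isPolygon_polyMat hh, Φ, fun G hG => ?_⟩
  obtain ⟨j, κ, hG', x₀, hx₀, hact⟩ := hΦ G hG
  rw [hG']
  exact survives_twoFace hr (hspan j κ) hx₀ hact

end PolygonProducts

theorem mainTheorem3 :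
    (∀ (r n : ℕ) (hr : 2 ≤ r), 4 ≤ n → Even n →
      ∃ P : Set (Fin (2 * r) → ℝ),
        IsDeformedProductSystem r n P ∧ IsSurvivingPolygonProduct r n hr P) ∧
    (∀ (r n : ℕ) (hr : 2 ≤ r), 4 ≤ n → Even n →
      ∀ P : Set (Fin (2 * r) → ℝ), IsSurvivingPolygonProduct r n hr P →
        IsFourPolytope (lastFour r hr '' P) ∧
        (fNumber (lastFour r hr '' P) 0 : ℝ) = (n : ℝ) ^ r ∧
        (fNumber (lastFour r hr '' P) 1 : ℝ) = (r : ℝ) * (n : ℝ) ^ r ∧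
        (fNumber (lastFour r hr '' P) 2 : ℝ) =
          5 / 4 * (r : ℝ) * (n : ℝ) ^ r - 3 / 2 * (n : ℝ) ^ r + (r : ℝ) * (n : ℝ) ^ (r - 1) ∧
        (fNumber (lastFour r hr '' P) 3 : ℝ) =
          1 / 4 * (r : ℝ) * (n : ℝ) ^ r - 1 / 2 * (n : ℝ) ^ r + (r : ℝ) * (n : ℝ) ^ (r - 1)) ∧
    (∀ ε : ℝ, 0 < ε → ∃ N : ℕ, ∀ (r n : ℕ) (hr : 2 ≤ r), 4 ≤ n → Even n → N ≤ r → N ≤ n →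
      ∀ P : Set (Fin (2 * r) → ℝ), IsSurvivingPolygonProduct r n hr P →
        |fatness (lastFour r hr '' P) - 9| < ε) := by
  refine ⟨fun r n hr hn heven => PolygonProducts.exists_isSurvivingPolygonProduct hr hn heven,
    fun r n hr hn _ P hP => PolygonProducts.fVector_of_isSurvivingPolygonProduct hr hn hP,
    fun ε hε => ?_⟩
  -- The constant is `24 + 32`, from the two terms of the fatness bound.
  obtain ⟨N, hN⟩ := exists_nat_gt (56 / ε)
  have hN0 : (0 : ℝ) < N := (by positivity : (0 : ℝ) < 56 / ε).trans hN
  refine ⟨N, fun r n hr hn _ hNr hNn P hP => ?_⟩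
  have h1 : (24 : ℝ) / r ≤ 24 / N :=
    div_le_div_of_nonneg_left (by norm_num) hN0 (by exact_mod_cast hNr)
  have h2 : (32 : ℝ) / n ≤ 32 / N :=
    div_le_div_of_nonneg_left (by norm_num) hN0 (by exact_mod_cast hNn)
  refine (PolygonProducts.abs_fatness_sub_nine_le hr hn hP).trans_lt ?_
  calc (24 : ℝ) / r + 32 / n ≤ 24 / N + 32 / N := add_le_add h1 h2
    _ = 56 / N := by ring
    _ < ε := by rwa [div_lt_iff₀ hN0, mul_comm, ← div_lt_iff₀ hε]
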